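/- All graphs are finite and simple. A hole is an induced cycle of length at least four, and a graph is even-hole-free if it has no hole of even length. $N(a)$ is the set of neighbours of $a$, $N[a]=N(a)\cup\{a\}$, and a set $X$ of vertices is connected if $G[X]$ is connected. The length of a path is its number of edges; its interior is the set of its vertices that are not ends. A pyramid with apex $a$ and base $\{b_1,b_2,b_3\}$ is the union of a triangle $\{b_1,b_2,b_3\}$ not containing $a$ and paths $R_1,R_2,R_3$, where $R_i$ has ends $a,b_i$, that are pairwise vertex-disjoint except for $a$, at least two of them having length at least two. It is short if one of $R_1,R_2,R_3$ has length one. An extended near-prism is obtained from two triangles $\{a_1,a_2,a_3\}$, $\{b_1,b_2,b_3\}$, disjoint except that possibly $a_3=b_3$, and three pairwise vertex-disjoint paths $R_1,R_2,R_3$, where $R_i$ has ends $a_i,b_i$, by taking their union and adding one edge $cd$ (the cross-edge), where $c$ is in the interior of $R_1$ and $d$ is in the interior of $R_2$. Containing a pyramid or an extended near-prism means containing it as an induced subgraph. A vertex $a$ of $G$ is splendid if $V(G)\setminus N[a]$ is connected, every vertex in $N(a)$ has a neighbour in $V(G)\setminus N[a]$, and there is no short pyramid with apex $a$ in $G$.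 A proper strip is a triple $S=(A,B,C)$ of pairwise disjoint subsets of $V(G)$, with $A,B$ nonempty, such that every vertex of $V(S)=A\cup B\cup C$ belongs to an induced path of $G$ with one end in $A$, the other end in $B$, and interior contained in $C$. A pyramid strip system $\mathcal S=(a,S_1,\dots,S_k)$ with apex $a\in V(G)$ consists of $k\ge 3$ proper strips $S_i=(A_i,B_i,C_i)$, with the sets $V(S_i)$ pairwise disjoint and not containing $a$, such that for $i\neq j$ every vertex of $B_i$ is adjacent to every vertex of $B_j$ and there are no other edges between $V(S_i)$ and $V(S_j)$, and for each $i$, $a$ is adjacent to every vertex of $A_i$ and to no vertex of $B_i\cup C_i$. It is indecomposable if $A_i\cup C_i$ is connected for every $i$. Let $V(\mathcal S)=V(S_1)\cup\dots\cup V(S_k)\cup\{a\}$. **Theorem.** Let $G$ be an even-hole-free graph and let $a\in V(G)$ be splendid. Suppose that there is no extended near-prism contained in $G$ such that $a$ is an end of its cross-edge. Let $\mathcal S=(a,S_1,\dots,S_k)$ be an indecomposable pyramid strip system with apex $a$ such that $V(\mathcal S)$ is maximal under inclusion among all indecomposable pyramid strip systems in $G$ with apex $a$ (with any number of strips). Then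 $N[a]\setminus V(\mathcal S)$ is a clique. -/

import Mathlib

namespace EvenHoles

variable {V : Type*} (G : SimpleGraph V)

/-- `G` contains no hole (induced cycle of length at least four) of even length. -/
def EvenHoleFree : Prop :=
  ∀ n : ℕ, 4 ≤ n → Even n → IsEmpty (SimpleGraph.cycleGraph n ↪g G)

/-- The closed neighbourhood `N[a]`. -/
def closedNbhd (a : V) : Set V := insert a (G.neighborSet a)

/-- `X` is connected in `G`, that is, the induced subgraph `G[X]` is connected. -/
def ConnectedSet (X : Set V) : Prop := (G.induce X).Connected

variable {G}

/-- `x` belongs to the interior of the path `p`: it is a vertex of `p` and not an end of `p`. -/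
def InInterior {u v : V} (p : G.Walk u v) (x : V) : Prop :=
  x ∈ p.support ∧ x ≠ u ∧ x ≠ v

/-- `p` is an induced path of `G`. -/
structure IsInducedPath {u v : V} (p : G.Walk u v) : Prop where
  isPath : p.IsPath
  isChordless : p.IsChordless

/-- The paths `R 0`, `R 1`, `R 2` are the constituent paths of a pyramid with apex `a` and base
`{b 0, b 1, b 2}` that is an induced subgraph of `G`. -/
structure IsPyramid (a : V) (b : Fin 3 → V) (R : ∀ i, G.Walk a (b i)) : Prop where
  apex_ne : ∀ i, a ≠ b i
  triangle : ∀ i j, i ≠ j → G.Adj (b i) (b j)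
  isPath : ∀ i, (R i).IsPath
  disjoint : ∀ i j, i ≠ j → ∀ x, x ∈ (R i).support → x ∈ (R j).support → x = a
  two_long : ∃ i j, i ≠ j ∧ 2 ≤ (R i).length ∧ 2 ≤ (R j).length
  /-- The only edges of `G` between vertices of the pyramid are the edges of the pyramid. -/
  induced : ∀ x y, (∃ i, x ∈ (R i).support) → (∃ i, y ∈ (R i).support) → G.Adj x y →
    (∃ i, s(x, y) ∈ (R i).edges) ∨ (x ∈ Set.range b ∧ y ∈ Set.range b)

variable (G) in
/-- There is a short pyramid with apex `a` in `G` (as an induced subgraph): one of its constituent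
paths has length one. -/
def HasShortPyramid (a : V) : Prop :=
  ∃ (b : Fin 3 → V) (R : ∀ i, G.Walk a (b i)), IsPyramid a b R ∧ ∃ i, (R i).length = 1

/-- The paths `R 0`, `R 1`, `R 2` (with `R i` from `a i` to `b i`) together with the triangles
`{a 0, a 1, a 2}` and `{b 0, b 1, b 2}` form a near-prism, and together with the additional
cross-edge `c d`, where `c`, `d` are in the interiors of `R 0`, `R 1` respectively, they form an
extended near-prism that is an induced subgraph of `G`. The bases are disjoint except that possibly
`a 2 = b 2`. -/
structure IsExtendedNearPrism (a b : Fin 3 → V) (R : ∀ i, G.Walk (a i) (b i)) (c d : V) :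
    Prop where
  triangle_left : ∀ i j, i ≠ j → G.Adj (a i) (a j)
  triangle_right : ∀ i j, i ≠ j → G.Adj (b i) (b j)
  bases_inter : Set.range a ∩ Set.range b = {a 2} ∩ {b 2}
  isPath : ∀ i, (R i).IsPath
  disjoint : ∀ i j, i ≠ j → ∀ x, x ∈ (R i).support → x ∉ (R j).support
  left_mem : InInterior (R 0) c
  right_mem : InInterior (R 1) d
  cross_adj : G.Adj c d
  /-- The only edges of `G` between vertices of the extended near-prism are its own edges. -/
  induced : ∀ x y, (∃ i, x ∈ (R i).support) → (∃ i, y ∈ (R i).support) → G.Adj x y →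
    (∃ i, s(x, y) ∈ (R i).edges) ∨ (x ∈ Set.range a ∧ y ∈ Set.range a) ∨
      (x ∈ Set.range b ∧ y ∈ Set.range b) ∨ s(x, y) = s(c, d)

variable (G) in
/-- `G` contains an extended near-prism such that `v` is an end of its cross-edge. -/
def HasExtendedNearPrismAt (v : V) : Prop :=
  ∃ (a b : Fin 3 → V) (R : ∀ i, G.Walk (a i) (b i)) (c d : V),
    IsExtendedNearPrism a b R c d ∧ (v = c ∨ v = d)

variable (G)

/-- Splendid vertices. -/
structure Splendid (a : V) : Prop where
  connected : ConnectedSet G (closedNbhd G a)ᶜ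
  nbr_has_far_nbr : ∀ v ∈ G.neighborSet a, ∃ w ∈ (closedNbhd G a)ᶜ, G.Adj v w
  no_short_pyramid : ¬ HasShortPyramid G a

/-- A triple `(A, B, C)` of sets of vertices. -/
structure Triple (V : Type*) where
  A : Set V
  B : Set V
  C : Set V

/-- `V(S) = A ∪ B ∪ C` for `S = (A, B, C)`. -/
def Triple.verts (S : Triple V) : Set V := S.A ∪ S.B ∪ S.C

variable {G}

/-- `p` is a rung of `S = (A, B, C)`: an induced path from `A` to `B` with interior in `C`, such
that if it has positive length then its first vertex is not in `B` and its last not in `A`. -/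
structure IsRung (S : Triple V) {u v : V} (p : G.Walk u v) : Prop where
  isInducedPath : IsInducedPath p
  left_mem : u ∈ S.A
  right_mem : v ∈ S.B
  interior_mem : ∀ x, InInterior p x → x ∈ S.C
  ends_notMem : 0 < p.length → u ∉ S.B ∧ v ∉ S.A

variable (G)

/-- `S = (A, B, C)` is a strip: `A`, `B` are nonempty and disjoint from `C`, and every vertex of
`A ∪ B ∪ C` belongs to a rung. -/
structure IsStrip (S : Triple V) : Prop where
  nonempty_A : S.A.Nonempty
  nonempty_B : S.B.Nonempty
  disjoint_AC : Disjoint S.A S.C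
  disjoint_BC : Disjoint S.B S.C
  mem_rung : ∀ x ∈ S.verts, ∃ (u v : V) (p : G.Walk u v), IsRung S p ∧ x ∈ p.support

/-- A strip is proper if `A ∩ B = ∅`. -/
structure IsProperStrip (S : Triple V) : Prop extends IsStrip G S where
  disjoint_AB : Disjoint S.A S.B

/-- `(a, S₁, …, Sₖ)` is a pyramid strip system in `G`. -/
structure IsPyramidStripSystem (a : V) {k : ℕ} (S : Fin k → Triple V) : Prop where
  three_le : 3 ≤ k
  proper : ∀ i, IsProperStrip G (S i)
  disjoint : ∀ i j, i ≠ j → Disjoint (S i).verts (S j).verts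
  complete : ∀ i j, i ≠ j → ∀ x ∈ (S i).B, ∀ y ∈ (S j).B, G.Adj x y
  no_other_edges : ∀ i j, i ≠ j → ∀ x ∈ (S i).verts, ∀ y ∈ (S j).verts,
    G.Adj x y → x ∈ (S i).B ∧ y ∈ (S j).B
  apex_notMem : ∀ i, a ∉ (S i).verts
  apex_complete : ∀ i, ∀ x ∈ (S i).A, G.Adj a x
  apex_anticomplete : ∀ i, ∀ x ∈ (S i).B ∪ (S i).C, ¬ G.Adj a x

/-- A pyramid strip system is indecomposable if `Aᵢ ∪ Cᵢ` is connected for every `i`. -/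
structure IsIndecomposableSystem (a : V) {k : ℕ} (S : Fin k → Triple V) : Prop
    extends IsPyramidStripSystem G a S where
  connected : ∀ i, ConnectedSet G ((S i).A ∪ (S i).C)

/-- The vertex set `V(S₁) ∪ ⋯ ∪ V(Sₖ) ∪ {a}` of `(a, S₁, …, Sₖ)`. -/
def systemVerts (a : V) {k : ℕ} (S : Fin k → Triple V) : Set V :=
  (⋃ i, (S i).verts) ∪ {a}

/-- `(a, S₁, …, Sₖ)` is an indecomposable pyramid strip system, and its vertex set is maximal under
inclusion among the vertex sets of all indecomposable pyramid strip systems with apex `a`, with any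
number of strips. -/
structure IsMaximalSystem (a : V) {k : ℕ} (S : Fin k → Triple V) : Prop where
  indecomposable : IsIndecomposableSystem G a S
  maximal : ∀ (k' : ℕ) (S' : Fin k' → Triple V), IsIndecomposableSystem G a S' →
    systemVerts a S ⊆ systemVerts a S' → systemVerts a S' = systemVerts a S

end EvenHoles

/-! Almost everything is parity. If two nonadjacent vertices are joined by two paths whose interiors
are anticomplete, the union is a hole, so the lengths have odd sum (`PathIn.odd_add`); hence three
such paths with pairwise anticomplete interiors cannot exist. Write `D` for `A ∪ C`. Since the bases
of different strips are complete to each other, all paths from `a` through some `D i` to `B i`, over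
all `i`, have lengths of one parity `r`.

Call a nonneighbour of `a` that is not in the system outside. The first task is
`IsMaximalSystem.not_joined`: no component of the outside is attached to `D i` and `D j` with `i ≠
j`. Take a shortest linking path. Maximality keeps a component attached only to `D i` away from the
other bases (`IsMaximalSystem.not_att_B`): a first vertex with a neighbour there would be complete
to all of them, by parity, and a path leading to it could be merged into the strip `i`. If an end of
the linking path sees `B i ∪ C i`, there is an even hole or an extended near-prism whose cross-edge
contains `a` (`TwoAtt.false_of_reach_left`). If both ends see only `A i` and `A j`, there is an even
hole (`IsIndecomposableSystem.false_of_joined_A`). So each outside component attached to a strip can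
be absorbed into its `C`. Absorbed vertices need not lie on rungs, which is why the argument
continues with a `Frame`; the components attached to no strip form the set `R` of a `Core`.

Secondly, every neighbour of `a` outside the system has neighbours in all but at most one of the
enlarged sets `D i` (`IsMaximalSystem.att_or_att`). Otherwise a path from it towards the bases,
merged with the strips that it touches, gives a larger system, or the vertex itself is complete to
two missed bases and there is a short pyramid.

Finally, let two such vertices `y`, `z` be nonadjacent. They are not both attached to two strips
(`Core.not_two_common`), so there are three strips and exactly one is common (`OneCommon`). Paths
from `y` to the bases through the sets `D` have a constant parity (`Core.exists_rho`), and similarly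
for `z`. These parities are determined by whether all far neighbours lie in `R` and whether `y`, `z`
see the base of the strip they miss. Every combination ends in an even hole, except that one
configuration ends in a short pyramid. -/

namespace EvenHoles

/-! ### Induced paths as sequences, and the parity of holes. -/

variable {V : Type*} {G : SimpleGraph V}

/-- The sequence `f 0, …, f n` is an induced path of `G`. -/
structure IndSeq (G : SimpleGraph V) (f : ℕ → V) (n : ℕ) : Prop where
  adj : ∀ i, i < n → G.Adj (f i) (f (i + 1))
  chordless : ∀ i j, i + 1 < j → j ≤ n → ¬ G.Adj (f i) (f j)
  inj : ∀ i j, i < j → j ≤ n → f i ≠ f j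

/-- There is an induced path of length `n` from `u` to `v` with interior in `S`. -/
def PathIn (G : SimpleGraph V) (S : Set V) (u v : V) (n : ℕ) : Prop :=
  ∃ f : ℕ → V, IndSeq G f n ∧ f 0 = u ∧ f n = v ∧ ∀ i, 0 < i → i < n → f i ∈ S

/-- `S` and `T` are disjoint and there are no edges between them. -/
def Anti (G : SimpleGraph V) (S T : Set V) : Prop :=
  ∀ s ∈ S, ∀ t ∈ T, s ≠ t ∧ ¬ G.Adj s t

/-- `v` has a neighbour in `S`. -/
def Att (G : SimpleGraph V) (v : V) (S : Set V) : Prop := ∃ s ∈ S, G.Adj v s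

theorem cycleGraph_adj_iff {N : ℕ} (hN : 3 ≤ N) (i j : Fin N) (hij : i.val < j.val) :
    (SimpleGraph.cycleGraph N).Adj i j ↔ j.val = i.val + 1 ∨ (i.val = 0 ∧ j.val + 1 = N) := by
  rw [SimpleGraph.cycleGraph_adj']
  obtain ⟨i, hi⟩ := i
  obtain ⟨j, hj⟩ := j
  simp only [Fin.sub_def] at *
  have h1 : (N - j + i) % N = N - j + i := Nat.mod_eq_of_lt (by omega)
  have h2 : (N - i + j) % N = j - i := by
    rw [show N - i + j = (j - i) + N by omega, Nat.add_mod_right]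
    exact Nat.mod_eq_of_lt (by omega)
  rw [h1, h2]
  omega

theorem EvenHoleFree.odd_of_closed (hG : EvenHoleFree G) {N : ℕ} (hN : 4 ≤ N) (c : ℕ → V)
    (hadj : ∀ i j, i < j → j < N → (G.Adj (c i) (c j) ↔ j = i + 1 ∨ (i = 0 ∧ j + 1 = N)))
    (hinj : ∀ i j, i < j → j < N → c i ≠ c j) : N % 2 = 1 := by
  by_contra hodd
  refine (hG N hN (Nat.even_iff.2 (by omega))).false ?_
  refine ⟨⟨fun i => c i.val, ?_⟩, ?_⟩
  · intro i j hij
    rcases lt_trichotomy i.val j.val with h | h | h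
    · exact absurd hij (hinj _ _ h j.2)
    · exact Fin.ext h
    · exact absurd hij.symm (hinj _ _ h i.2)
  · intro i j
    change G.Adj (c i.val) (c j.val) ↔ _
    rcases lt_trichotomy i.val j.val with h | h | h
    · rw [hadj _ _ h j.2, cycleGraph_adj_iff (by omega) _ _ h]
    · have := Fin.ext h
      subst this
      simp
    · rw [G.adj_comm, (SimpleGraph.cycleGraph N).adj_comm, hadj _ _ h i.2,
        cycleGraph_adj_iff (by omega) _ _ h]

theorem IndSeq.adj_iff {f : ℕ → V} {n : ℕ} (hf : IndSeq G f n) {i j : ℕ} (hij : i < j)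
    (hj : j ≤ n) : G.Adj (f i) (f j) ↔ j = i + 1 := by
  constructor
  · intro h
    by_contra hne
    exact hf.chordless i j (by omega) hj h
  · rintro rfl
    exact hf.adj i (by omega)

namespace PathIn

variable {S T : Set V} {u v w x : V} {m n : ℕ}

theorem mono (h : PathIn G S u v n) (hST : S ⊆ T) : PathIn G T u v n := by
  obtain ⟨f, hf, h0, hn, hS⟩ := h
  exact ⟨f, hf, h0, hn, fun i h1 h2 => hST (hS i h1 h2)⟩

theorem refl (S : Set V) (u : V) : PathIn G S u u 0 :=
  ⟨fun _ => u, ⟨by omega, by omega, by omega⟩, rfl, rfl, by omega⟩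

theorem of_adj (S : Set V) (h : G.Adj u v) : PathIn G S u v 1 := by
  refine ⟨fun i => if i = 0 then u else v, ⟨?_, by omega, ?_⟩, by simp, by simp, by omega⟩
  · intro i hi
    have : i = 0 := by omega
    subst this
    simpa using h
  · intro i j hij hj
    have : i = 0 := by omega
    have : j = 1 := by omega
    subst i j
    simpa using h.ne

theorem symm (h : PathIn G S u v n) : PathIn G S v u n := by
  obtain ⟨f, hf, h0, hn, hS⟩ := h
  refine ⟨fun i => f (n - i), ⟨?_, ?_, ?_⟩, by simpa using hn, by simpa using h0, ?_⟩
  · intro i hi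
    have := (hf.adj (n - (i + 1)) (by omega)).symm
    rwa [show n - (i + 1) + 1 = n - i by omega] at this
  · intro i j hij hj h
    exact hf.chordless (n - j) (n - i) (by omega) (by omega) h.symm
  · intro i j hij hj h
    exact hf.inj (n - j) (n - i) (by omega) (by omega) h.symm
  · intro i h1 h2
    exact hS _ (by omega) (by omega)

theorem eq_one_of_adj (h : PathIn G S u v n) (huv : G.Adj u v) : n = 1 := by
  obtain ⟨f, hf, h0, hn, hS⟩ := h
  subst h0 hn
  rcases Nat.eq_zero_or_pos n with h | h
  · subst h
    exact absurd huv (G.irrefl)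
  · exact (hf.adj_iff h le_rfl).1 huv |>.trans (by omega)

theorem ne_of_pos (h : PathIn G S u v n) (hn : 0 < n) : u ≠ v := by
  obtain ⟨f, hf, rfl, rfl, -⟩ := h
  exact hf.inj 0 n hn le_rfl

theorem pos_of_ne (h : PathIn G S u v n) (huv : u ≠ v) : 0 < n := by
  obtain ⟨f, hf, rfl, rfl, -⟩ := h
  rcases Nat.eq_zero_or_pos n with h | h
  · subst h; exact absurd rfl huv
  · exact h

theorem two_le (h : PathIn G S u v n) (huv : u ≠ v) (hadj : ¬ G.Adj u v) : 2 ≤ n := by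
  have h1 := h.pos_of_ne huv
  by_contra h2
  have : n = 1 := by omega
  subst this
  obtain ⟨f, hf, rfl, rfl, -⟩ := h
  exact hadj (hf.adj 0 (by omega))

/-- Keeps the sequence and the position of the junction `v`, which matter when the near-prism is
assembled; `concat` forgets them. The junction is left out of both sides of the anticompleteness
condition. -/
theorem exists_concat (h : PathIn G S u v m) (h' : PathIn G T v w n)
    (hanti : Anti G (insert u S) (insert w T)) (hm : 0 < m) (hn : 0 < n) :
    ∃ f, IndSeq G f (m + n) ∧ f 0 = u ∧ f m = v ∧ f (m + n) = w ∧ (∀ i, 0 < i → i < m → f i ∈ S) ∧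
      ∀ i, m < i → i < m + n → f i ∈ T := by
  obtain ⟨f, hf, rfl, rfl, hS⟩ := h
  obtain ⟨g, hg, hg0, rfl, hT⟩ := h'
  have hfS : ∀ i, i < m → f i ∈ insert (f 0) S := by
    intro i hi
    rcases Nat.eq_zero_or_pos i with h | h
    · subst h; exact Or.inl rfl
    · exact Or.inr (hS i h hi)
  have hgT : ∀ i, 0 < i → i ≤ n → g i ∈ insert (g n) T := by
    intro i h0 hi
    rcases Nat.eq_or_lt_of_le hi with h | h
    · subst h; exact Or.inl rfl
    · exact Or.inr (hT i h0 h)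
  have key : ∀ i j, i < m → 0 < j → j ≤ n → f i ≠ g j ∧ ¬ G.Adj (f i) (g j) := fun i j hi hj hj' =>
    hanti _ (hfS i hi) _ (hgT j hj hj')
  refine ⟨fun i => if i ≤ m then f i else g (i - m), ⟨?_, ?_, ?_⟩, by simp, by simp, ?_, ?_, ?_⟩
  · intro i hi
    rcases lt_trichotomy i m with h | h | h
    · rw [if_pos h.le, if_pos (by omega)]
      exact hf.adj i h
    · subst h
      rw [if_pos le_rfl, if_neg (by omega), show i + 1 - i = 0 + 1 by omega, ← hg0]
      exact hg.adj 0 hn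
    · rw [if_neg (by omega), if_neg (by omega), show i + 1 - m = i - m + 1 by omega]
      exact hg.adj _ (by omega)
  · intro i j hij hj
    rcases Nat.lt_or_ge m j with h | h
    · rw [if_neg (by omega : ¬ j ≤ m)]
      rcases lt_trichotomy i m with h' | h' | h'
      · rw [if_pos h'.le]
        exact (key i (j - m) h' (by omega) (by omega)).2
      · subst h'
        rw [if_pos le_rfl, ← hg0]
        exact hg.chordless 0 _ (by omega) (by omega)
      · rw [if_neg (by omega)]
        exact hg.chordless _ _ (by omega) (by omega)
    · rw [if_pos h, if_pos (by omega)]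
      exact hf.chordless _ _ hij h
  · intro i j hij hj
    rcases Nat.lt_or_ge m j with h | h
    · rw [if_neg (by omega : ¬ j ≤ m)]
      rcases lt_trichotomy i m with h' | h' | h'
      · rw [if_pos h'.le]
        exact (key i (j - m) h' (by omega) (by omega)).1
      · subst h'
        rw [if_pos le_rfl, ← hg0]
        exact hg.inj 0 _ (by omega) (by omega)
      · rw [if_neg (by omega)]
        exact hg.inj _ _ (by omega) (by omega)
    · rw [if_pos h, if_pos (by omega)]
      exact hf.inj _ _ hij h
  · beta_reduce
    rw [if_neg (by omega)]
    congr 1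
    omega
  · intro i h0 hi
    beta_reduce
    rw [if_pos hi.le]
    exact hS i h0 hi
  · intro i h0 hi
    beta_reduce
    rw [if_neg (by omega)]
    exact hT _ (by omega) (by omega)

theorem concat (h : PathIn G S u v m) (h' : PathIn G T v w n)
    (hanti : Anti G (insert u S) (insert w T)) (hm : 0 < m) (hn : 0 < n) :
    PathIn G (insert v (S ∪ T)) u w (m + n) := by
  obtain ⟨f, hf, h0, h1, h2, h3, h4⟩ := h.exists_concat h' hanti hm hn
  refine ⟨f, hf, h0, h2, fun i h5 h6 => ?_⟩
  rcases lt_trichotomy i m with h | rfl | h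
  · exact Or.inr (Or.inl (h3 i h5 h))
  · exact Or.inl h1
  · exact Or.inr (Or.inr (h4 i h h6))

/-- The two paths close up to a cycle of length `m + n`. Nonadjacency of the ends makes each path at
least two long, so the cycle is a hole. -/
theorem odd_add (hG : EvenHoleFree G) (h : PathIn G S u v m) (h' : PathIn G T u v n)
    (huv : u ≠ v) (hadj : ¬ G.Adj u v) (hanti : Anti G S T) : (m + n) % 2 = 1 := by
  have hm := h.two_le huv hadj
  have hn := h'.two_le huv hadj
  obtain ⟨f, hf, rfl, rfl, hS⟩ := h
  obtain ⟨g, hg, hg0, hgn, hT⟩ := h'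
  have key : ∀ i j, 0 < i → i < m → 0 < j → j < n → f i ≠ g j ∧ ¬ G.Adj (f i) (g j) :=
    fun i j h1 h2 h3 h4 => hanti _ (hS i h1 h2) _ (hT j h3 h4)
  -- The cycle runs along `f` from `u` to `v` and then back along `g`; its last vertex is `g 1`.
  refine hG.odd_of_closed (by omega) (fun i => if i ≤ m then f i else g (m + n - i)) ?_ ?_
  · intro i j hij hj
    rcases Nat.lt_or_ge m j with h | h
    · rw [if_neg (by omega : ¬ j ≤ m)]
      rcases Nat.lt_or_ge m i with h' | h'
      · rw [if_neg (by omega), G.adj_comm, hg.adj_iff (by omega) (by omega)]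
        omega
      · rw [if_pos h']
        rcases Nat.eq_zero_or_pos i with h'' | h''
        · subst h''
          rw [← hg0, hg.adj_iff (by omega) (by omega)]
          omega
        · rcases Nat.eq_or_lt_of_le h' with h3 | h3
          · subst h3
            rw [← hgn, G.adj_comm, hg.adj_iff (by omega) (by omega)]
            omega
          · have := (key i (m + n - j) h'' h3 (by omega) (by omega)).2
            simp only [this, false_iff]
            omega
    · rw [if_pos h, if_pos (by omega), hf.adj_iff hij h]
      omega
  · intro i j hij hj
    rcases Nat.lt_or_ge m j with h | h
    · rw [if_neg (by omega : ¬ j ≤ m)]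
      rcases Nat.lt_or_ge m i with h' | h'
      · rw [if_neg (by omega)]
        exact (hg.inj _ _ (by omega) (by omega)).symm
      · rw [if_pos h']
        rcases Nat.eq_zero_or_pos i with h'' | h''
        · subst h''
          rw [← hg0]
          exact hg.inj _ _ (by omega) (by omega)
        · rcases Nat.eq_or_lt_of_le h' with h3 | h3
          · subst h3
            rw [← hgn]
            exact (hg.inj _ _ (by omega) (by omega)).symm
          · exact (key i (m + n - j) h'' h3 (by omega) (by omega)).1
    · rw [if_pos h, if_pos (by omega)]
      exact hf.inj _ _ hij h

end PathIn

end EvenHoles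

/-! ### Connected sets, shortening and cutting paths, and the passage to walks. -/

namespace EvenHoles

variable {V : Type*} {G : SimpleGraph V}

theorem Anti.symm {S T : Set V} (h : Anti G S T) : Anti G T S :=
  fun t ht s hs => ⟨(h s hs t ht).1.symm, fun h' => (h s hs t ht).2 h'.symm⟩

theorem Anti.mono {S T S' T' : Set V} (h : Anti G S T) (hS : S' ⊆ S) (hT : T' ⊆ T) :
    Anti G S' T' :=
  fun s hs t ht => h s (hS hs) t (hT ht)

theorem Att.mono {v : V} {S T : Set V} (h : Att G v S) (hST : S ⊆ T) : Att G v T := by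
  obtain ⟨s, hs, h⟩ := h
  exact ⟨s, hST hs, h⟩

theorem ConnectedSet.singleton (v : V) : ConnectedSet G {v} := by
  refine (SimpleGraph.connected_iff _).2 ⟨?_, ⟨⟨v, rfl⟩⟩⟩
  rintro ⟨x, rfl⟩ ⟨y, rfl⟩
  rfl

theorem ConnectedSet.union_of_inter {X Y : Set V} (hX : ConnectedSet G X) (hY : ConnectedSet G Y)
    {x : V} (h1 : x ∈ X) (h2 : x ∈ Y) : ConnectedSet G (X ∪ Y) :=
  SimpleGraph.induce_union_connected hX.preconnected hY.preconnected ⟨x, h1, h2⟩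

theorem ConnectedSet.union_of_adj {X Y : Set V} (hX : ConnectedSet G X) (hY : ConnectedSet G Y)
    {x y : V} (h1 : x ∈ X) (h2 : y ∈ Y) (h : G.Adj x y) : ConnectedSet G (X ∪ Y) :=
  SimpleGraph.connected_induce_union hX.preconnected hY.preconnected h1 h2 h

theorem ConnectedSet.insert {X : Set V} (hX : ConnectedSet G X) {v : V} (hv : Att G v X) :
    ConnectedSet G (insert v X) := by
  obtain ⟨x, hx, h⟩ := hv
  rw [Set.insert_eq]
  exact (ConnectedSet.singleton v).union_of_adj hX rfl hx h

theorem ConnectedSet.nonempty {X : Set V} (hX : ConnectedSet G X) : X.Nonempty := by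
  obtain ⟨⟨x, hx⟩⟩ := SimpleGraph.Connected.nonempty hX
  exact ⟨x, hx⟩

/-- The interior of a path. -/
def interior (f : ℕ → V) (n : ℕ) : Set V := {x | ∃ i, 0 < i ∧ i < n ∧ f i = x}

theorem connectedSet_segment {f : ℕ → V} (i n : ℕ)
    (hf : ∀ j, i ≤ j → j < i + n → G.Adj (f j) (f (j + 1))) :
    ConnectedSet G {x | ∃ j, i ≤ j ∧ j ≤ i + n ∧ f j = x} := by
  induction n with
  | zero =>
    convert ConnectedSet.singleton (G := G) (f i) using 1
    ext x
    constructor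
    · rintro ⟨j, h1, h2, rfl⟩
      rw [show j = i by omega]
      rfl
    · rintro rfl
      exact ⟨i, by omega, by omega, rfl⟩
  | succ n ih =>
    have h := (ih fun j h1 h2 => hf j h1 (by omega)).insert (v := f (i + n + 1))
      ⟨f (i + n), ⟨i + n, by omega, by omega, rfl⟩, (hf (i + n) (by omega) (by omega)).symm⟩
    convert h using 1
    ext x
    constructor
    · rintro ⟨j, h1, h2, rfl⟩
      rcases Nat.eq_or_lt_of_le h2 with h3 | h3
      · left; rw [h3]; rfl
      · right; exact ⟨j, h1, by omega, rfl⟩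
    · rintro (rfl | ⟨j, h1, h2, rfl⟩)
      · exact ⟨i + n + 1, by omega, by omega, rfl⟩
      · exact ⟨j, h1, by omega, rfl⟩

theorem IndSeq.connectedSet_interior {f : ℕ → V} {n : ℕ} (hf : IndSeq G f n) (hn : 2 ≤ n) :
    ConnectedSet G (interior f n) := by
  convert connectedSet_segment (G := G) (f := f) 1 (n - 2)
    (fun j h1 h2 => hf.adj j (by omega)) using 1
  ext x
  constructor
  · rintro ⟨j, h1, h2, rfl⟩
    exact ⟨j, by omega, by omega, rfl⟩
  · rintro ⟨j, h1, h2, rfl⟩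
    exact ⟨j, by omega, by omega, rfl⟩

theorem IndSeq.shift {f : ℕ → V} {n : ℕ} (hf : IndSeq G f n) {i m : ℕ} (h : i + m ≤ n) :
    IndSeq G (fun j => f (i + j)) m :=
  ⟨fun j hj => hf.adj (i + j) (by omega), fun j k h1 h2 => hf.chordless _ _ (by omega) (by omega),
    fun j k h1 h2 => hf.inj _ _ (by omega) (by omega)⟩

/-- A sequence of consecutive adjacent vertices with interior in `S` can be shortened to an induced
path. -/
theorem exists_pathIn_of_seq {S : Set V} {n : ℕ} {f : ℕ → V}
    (hf : ∀ i, i < n → G.Adj (f i) (f (i + 1))) (hS : ∀ i, 0 < i → i < n → f i ∈ S) :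
    ∃ m, PathIn G S (f 0) (f n) m := by
  induction n using Nat.strong_induction_on generalizing f with
  | _ n ih =>
    by_cases hinj : ∀ i j, i < j → j ≤ n → f i ≠ f j
    · by_cases hch : ∀ i j, i + 1 < j → j ≤ n → ¬ G.Adj (f i) (f j)
      · exact ⟨n, f, ⟨hf, hch, hinj⟩, rfl, rfl, hS⟩
      · push Not at hch
        obtain ⟨i, j, h1, h2, h3⟩ := hch
        -- A chord from position `i` to position `j` replaces the `j - i - 1` vertices between them.
        have := ih (n - (j - i - 1)) (by omega)
          (f := fun k => if k ≤ i then f k else f (k + (j - i - 1))) ?_ ?_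
        · rw [if_pos (Nat.zero_le _), if_neg (by omega),
            show n - (j - i - 1) + (j - i - 1) = n by omega] at this
          exact this
        · intro k hk
          rcases lt_trichotomy k i with h | h | h
          · rw [if_pos h.le, if_pos (by omega)]
            exact hf k (by omega)
          · subst h
            rw [if_pos le_rfl, if_neg (by omega), show k + 1 + (j - k - 1) = j by omega]
            exact h3
          · rw [if_neg (by omega), if_neg (by omega),
              show k + 1 + (j - i - 1) = k + (j - i - 1) + 1 by omega]
            exact hf _ (by omega)
        · intro k h0 hk
          split_ifs with h
          · exact hS _ h0 (by omega)
          · exact hS _ (by omega) (by omega)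
    · push Not at hinj
      obtain ⟨i, j, h1, h2, h3⟩ := hinj
      -- A repetition `f i = f j` allows the closed stretch of `j - i` steps to be cut out; if `j =
      -- n`, the new sequence ends at `f i`.
      have := ih (n - (j - i)) (by omega)
        (f := fun k => if k ≤ i then f k else f (k + (j - i))) ?_ ?_
      · rw [if_pos (Nat.zero_le _)] at this
        split_ifs at this with h
        · rw [show n - (j - i) = i by omega, h3, show j = n by omega] at this
          exact this
        · rw [show n - (j - i) + (j - i) = n by omega] at this
          exact this
      · intro k hk
        rcases lt_trichotomy k i with h | h | h
        · rw [if_pos h.le, if_pos (by omega)]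
          exact hf k (by omega)
        · subst h
          rw [if_pos le_rfl, if_neg (by omega), show k + 1 + (j - k) = j + 1 by omega, h3]
          exact hf j (by omega)
        · rw [if_neg (by omega), if_neg (by omega),
            show k + 1 + (j - i) = k + (j - i) + 1 by omega]
          exact hf _ (by omega)
      · intro k h0 hk
        split_ifs with h
        · exact hS _ h0 (by omega)
        · exact hS _ (by omega) (by omega)

theorem ConnectedSet.exists_pathIn_mem {S : Set V} (hS : ConnectedSet G S) {u v : V} (hu : u ∈ S)
    (hv : v ∈ S) : ∃ n, PathIn G S u v n := by
  obtain ⟨p⟩ := hS.preconnected ⟨u, hu⟩ ⟨v, hv⟩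
  have := exists_pathIn_of_seq (G := G) (S := S) (n := p.length) (f := fun i => (p.getVert i).1)
    (fun i hi => p.adj_getVert_succ hi) (fun i _ _ => (p.getVert i).2)
  simpa using this

theorem ConnectedSet.exists_pathIn {S : Set V} (hS : ConnectedSet G S) {u v : V} (hu : Att G u S)
    (hv : Att G v S) : ∃ n, PathIn G S u v n := by
  obtain ⟨s, hs, hus⟩ := hu
  obtain ⟨t, ht, hvt⟩ := hv
  obtain ⟨n, f, hf, rfl, rfl, hfS⟩ := hS.exists_pathIn_mem hs ht
  have hmem : ∀ i, i ≤ n → f i ∈ S := by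
    intro i hi
    rcases Nat.eq_zero_or_pos i with h | h
    · subst h; exact hs
    · rcases Nat.eq_or_lt_of_le hi with h' | h'
      · subst h'; exact ht
      · exact hfS i h h'
  have := exists_pathIn_of_seq (G := G) (S := S) (n := n + 2)
    (f := fun i => if i = 0 then u else if i = n + 2 then v else f (i - 1)) ?_ ?_
  · simpa using this
  · intro i hi
    rcases Nat.eq_zero_or_pos i with h | h
    · subst h
      simpa using hus
    · rw [if_neg (by omega), if_neg (by omega), if_neg (by omega)]
      split_ifs with h'
      · rw [show i - 1 = n by omega]
        exact hvt.symm
      · have := hf.adj (i - 1) (by omega)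
        rwa [show i - 1 + 1 = i by omega] at this
  · intro i h0 hi
    rw [if_neg (by omega), if_neg (by omega)]
    exact hmem _ (by omega)

namespace PathIn

variable {S T : Set V} {u v w x : V} {m n : ℕ}

/-- The interior of a path as a connected set. -/
theorem exists_interior (h : PathIn G S u v n) (hn : 2 ≤ n) :
    ∃ I ⊆ S, PathIn G I u v n ∧ ConnectedSet G I ∧ Att G u I ∧ Att G v I := by
  obtain ⟨f, hf, rfl, rfl, hS⟩ := h
  refine ⟨interior f n, ?_, ⟨f, hf, rfl, rfl, fun i h1 h2 => ⟨i, h1, h2, rfl⟩⟩,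
    hf.connectedSet_interior hn, ⟨f 1, ⟨1, by omega, by omega, rfl⟩, hf.adj 0 (by omega)⟩,
    ⟨f (n - 1), ⟨n - 1, by omega, by omega, rfl⟩, ?_⟩⟩
  · rintro x ⟨i, h1, h2, rfl⟩
    exact hS i h1 h2
  · have := hf.adj (n - 1) (by omega)
    rw [show n - 1 + 1 = n by omega] at this
    exact this.symm

/-- Removing the first vertex of a path. -/
theorem exists_cons (h : PathIn G S u v n) (hn : 2 ≤ n) :
    ∃ w ∈ S, G.Adj u w ∧ PathIn G {s ∈ S | u ≠ s ∧ ¬ G.Adj u s} w v (n - 1) ∧ u ≠ v ∧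
      ¬ G.Adj u v := by
  obtain ⟨f, hf, rfl, rfl, hS⟩ := h
  refine ⟨f 1, hS 1 (by omega) (by omega), hf.adj 0 (by omega), ⟨fun j => f (1 + j),
    hf.shift (by omega), rfl, ?_, ?_⟩, hf.inj _ _ (by omega) le_rfl,
    hf.chordless _ _ (by omega) le_rfl⟩
  · beta_reduce
    congr 1
    omega
  · intro i h0 hi
    exact ⟨hS _ (by omega) (by omega), hf.inj _ _ (by omega) (by omega),
      hf.chordless _ _ (by omega) (by omega)⟩

/-- Splitting a path at its first vertex with a given property. -/
theorem exists_split (h : PathIn G S u v n) (Q : V → Prop) (hv : Q v) :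
    ∃ w m k, m + k = n ∧ Q w ∧ PathIn G {s ∈ S | ¬ Q s} u w m ∧
      PathIn G {s ∈ S | w ≠ s} w v k ∧ (0 < m → ¬ Q u) ∧ (0 < m → 0 < k → w ∈ S) := by
  classical
  obtain ⟨f, hf, rfl, rfl, hS⟩ := h
  have hex : ∃ i, i ≤ n ∧ Q (f i) := ⟨n, le_rfl, hv⟩
  obtain ⟨hle, hQ⟩ := Nat.find_spec hex
  have hmin : ∀ j, j < Nat.find hex → ¬ Q (f j) := fun j hj hQj =>
    Nat.find_min hex hj ⟨by omega, hQj⟩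
  generalize Nat.find hex = i at *
  refine ⟨f i, i, n - i, by omega, hQ, ⟨f, ?_, rfl, rfl, ?_⟩, ⟨fun j => f (i + j),
    hf.shift (by omega), rfl, ?_, ?_⟩, fun h0 => hmin 0 h0, fun h0 h1 => hS _ h0 (by omega)⟩
  · simpa using hf.shift (i := 0) (m := i) (by omega)
  · intro j h0 hj
    exact ⟨hS _ h0 (by omega), hmin j hj⟩
  · beta_reduce
    congr 1
    omega
  · intro j h0 hj
    exact ⟨hS _ (by omega) (by omega), hf.inj _ _ (by omega) (by omega)⟩

end PathIn

/-- The walk along a sequence of consecutive adjacent vertices. -/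
theorem IndSeq.exists_walk {f : ℕ → V} {n : ℕ} (hf : IndSeq G f n) :
    ∃ p : G.Walk (f 0) (f n), p.length = n ∧ IsInducedPath p ∧
      ∀ x, x ∈ p.support ↔ ∃ i, i ≤ n ∧ f i = x := by
  have key : ∀ m, m ≤ n → ∃ p : G.Walk (f 0) (f m), p.length = m ∧ p.IsPath ∧
      (∀ x, x ∈ p.support ↔ ∃ i, i ≤ m ∧ f i = x) ∧
      ∀ i, i < m → s(f i, f (i + 1)) ∈ p.edges := by
    intro m
    induction m with
    | zero =>
      intro _
      refine ⟨.nil, rfl, .nil, fun x => ?_, by omega⟩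
      simp only [SimpleGraph.Walk.support_nil, List.mem_singleton]
      constructor
      · rintro rfl; exact ⟨0, le_rfl, rfl⟩
      · rintro ⟨i, hi, rfl⟩; rw [show i = 0 by omega]
    | succ m ih =>
      intro hm
      obtain ⟨p, h1, h2, h3, h4⟩ := ih (by omega)
      refine ⟨p.concat (hf.adj m (by omega)), by simp [h1], ?_, ?_, ?_⟩
      · refine h2.concat ?_ _
        rw [h3]
        rintro ⟨i, hi, h⟩
        exact hf.inj i (m + 1) (by omega) hm h
      · intro x
        rw [SimpleGraph.Walk.support_concat, List.mem_append, h3,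
          List.mem_singleton]
        constructor
        · rintro (⟨i, hi, rfl⟩ | rfl)
          · exact ⟨i, by omega, rfl⟩
          · exact ⟨m + 1, le_rfl, rfl⟩
        · rintro ⟨i, hi, rfl⟩
          rcases Nat.eq_or_lt_of_le hi with h | h
          · right; rw [h]
          · left; exact ⟨i, by omega, rfl⟩
      · intro i hi
        rw [SimpleGraph.Walk.edges_concat, List.concat_eq_append, List.mem_append]
        rcases Nat.eq_or_lt_of_le (Nat.le_of_lt_succ hi) with h | h
        · right; subst h; simp
        · left; exact h4 i h
  obtain ⟨p, h1, h2, h3, h4⟩ := key n le_rfl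
  refine ⟨p, h1, ⟨h2, ?_⟩, h3⟩
  rw [SimpleGraph.Walk.isChordless_iff_forall_mem_edges]
  intro x y hx hy hxy
  obtain ⟨i, hi, rfl⟩ := (h3 x).1 hx
  obtain ⟨j, hj, rfl⟩ := (h3 y).1 hy
  rcases lt_trichotomy i j with h | h | h
  · rw [(hf.adj_iff h hj).1 hxy]
    exact h4 i (by omega)
  · subst h; exact absurd hxy G.irrefl
  · rw [(hf.adj_iff h hi).1 hxy.symm, Sym2.eq_swap]
    exact h4 j (by omega)

theorem IsInducedPath.indSeq {u v : V} {p : G.Walk u v} (hp : IsInducedPath p) :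
    IndSeq G p.getVert p.length := by
  have hinj := hp.isPath.getVert_injOn
  refine ⟨fun i hi => p.adj_getVert_succ hi, ?_, ?_⟩
  · intro i j hij hj hadj
    have hmem := hp.isChordless.mem_edges (p.getVert_mem_support i) (p.getVert_mem_support j) hadj
    rw [SimpleGraph.Walk.edges, List.mem_map] at hmem
    obtain ⟨d, hd, he⟩ := hmem
    obtain ⟨k, hk, rfl⟩ := List.mem_iff_getElem.1 hd
    have hk' : k < p.length := by simpa using hk
    rw [SimpleGraph.Walk.darts_getElem_eq_getVert] at he
    simp only [SimpleGraph.Dart.edge_mk, Sym2.eq, Sym2.rel_iff', Prod.mk.injEq,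
      Prod.swap_prod_mk] at he
    rcases he with ⟨h1, h2⟩ | ⟨h1, h2⟩
    · have := hinj (by simp; omega) (by simp; omega) h1
      have := hinj (by simp; omega) (by simp; omega) h2
      omega
    · have := hinj (by simp; omega) (by simp; omega) h1
      have := hinj (by simp; omega) (by simp; omega) h2
      omega
  · intro i j hij hj h
    have := hinj (by simp; omega) (by simp; omega) h
    omega

theorem PathIn.exists_walk {S : Set V} {u v : V} {n : ℕ} (h : PathIn G S u v n) :
    ∃ p : G.Walk u v, p.length = n ∧ IsInducedPath p ∧ ∀ x ∈ p.support, x = u ∨ x = v ∨ x ∈ S := by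
  obtain ⟨f, hf, rfl, rfl, hS⟩ := h
  obtain ⟨p, h1, h2, h3⟩ := hf.exists_walk
  refine ⟨p, h1, h2, fun x hx => ?_⟩
  obtain ⟨i, hi, rfl⟩ := (h3 x).1 hx
  rcases Nat.eq_zero_or_pos i with h | h
  · subst h; exact Or.inl rfl
  · rcases Nat.eq_or_lt_of_le hi with h' | h'
    · subst h'; exact Or.inr (Or.inl rfl)
    · exact Or.inr (Or.inr (hS i h h'))

end EvenHoles

/-! ### Frames, and the common parity of the arms. -/

namespace EvenHoles

variable {V : Type*} {G : SimpleGraph V}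

/-- `A ∪ C` for `S = (A, B, C)`. -/
def Triple.D (S : Triple V) : Set V := S.A ∪ S.C

theorem Triple.A_subset_D (S : Triple V) : S.A ⊆ S.D := Set.subset_union_left

theorem Triple.C_subset_D (S : Triple V) : S.C ⊆ S.D := Set.subset_union_right

/-- A relaxed version of an indecomposable pyramid strip system: the vertices of `C` need not lie on
rungs. -/
structure Frame (G : SimpleGraph V) (a : V) {ι : Type*} (S : ι → Triple V) : Prop where
  conn : ∀ i, ConnectedSet G (S i).D
  antiD : ∀ i j, i ≠ j → Anti G (S i).D (S j).D
  antiDB : ∀ i j, i ≠ j → Anti G (S i).D (S j).B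
  adjB : ∀ i j, i ≠ j → ∀ x ∈ (S i).B, ∀ y ∈ (S j).B, G.Adj x y
  adjA : ∀ i, ∀ x ∈ (S i).A, G.Adj a x
  antiB : ∀ i, Anti G {a} (S i).B
  antiC : ∀ i, Anti G {a} (S i).C
  nonempty_A : ∀ i, (S i).A.Nonempty
  nonempty_B : ∀ i, (S i).B.Nonempty
  rungA : ∀ i, ∀ x ∈ (S i).A, ∃ b ∈ (S i).B, ∃ n, PathIn G (S i).C x b n
  rungB : ∀ i, ∀ b ∈ (S i).B, ∃ x ∈ (S i).A, ∃ n, PathIn G (S i).C x b n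

namespace Frame

variable {a : V} {ι : Type*} {S : ι → Triple V}

theorem att_apex (hF : Frame G a S) (i : ι) : Att G a (S i).D := by
  obtain ⟨x, hx⟩ := hF.nonempty_A i
  exact ⟨x, (S i).A_subset_D hx, hF.adjA i x hx⟩

theorem att_B (hF : Frame G a S) {i : ι} {b : V} (hb : b ∈ (S i).B) : Att G b (S i).D := by
  obtain ⟨x, hx, n, h⟩ := hF.rungB i b hb
  rcases Nat.lt_or_ge n 2 with hn | hn
  · have hne : x ≠ b := by
      rintro rfl
      exact (hF.antiB i a rfl x hb).2 (hF.adjA i x hx)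
    have hpos := h.pos_of_ne hne
    have : n = 1 := by omega
    subst this
    obtain ⟨f, hf, rfl, rfl, -⟩ := h
    exact ⟨f 0, (S i).A_subset_D hx, (hf.adj 0 (by omega)).symm⟩
  · obtain ⟨I, hI, -, -, -, h⟩ := h.exists_interior hn
    exact h.mono (hI.trans (S i).C_subset_D)

theorem exists_arm (hF : Frame G a S) {i : ι} {b : V} (hb : b ∈ (S i).B) :
    ∃ n, PathIn G (S i).D a b n :=
  (hF.conn i).exists_pathIn (hF.att_apex i) (hF.att_B hb)

/-- The two arms and the edge `b c` form a hole of length `m + n + 1`. -/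
theorem arm_parity_of_ne (hG : EvenHoleFree G) (hF : Frame G a S) {i j : ι} (hij : i ≠ j) {b c : V}
    (hb : b ∈ (S i).B) (hc : c ∈ (S j).B) {m n : ℕ} (hm : PathIn G (S i).D a b m)
    (hn : PathIn G (S j).D a c n) : m % 2 = n % 2 := by
  have h1 := hF.antiB i a rfl b hb
  have h2 := hF.antiB j a rfl c hc
  have hbc := hF.adjB i j hij b hb c hc
  have h := hm.concat (PathIn.of_adj ∅ hbc) (by
    have := hF.antiDB i j hij
    grind [Anti]) (hm.pos_of_ne h1.1) one_pos
  have := PathIn.odd_add hG h hn h2.1 h2.2 (by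
    have := hF.antiD i j hij
    have := hF.antiDB j i hij.symm
    grind [Anti, SimpleGraph.adj_comm])
  omega

end Frame

end EvenHoles

/-! ### Cores, outer vertices, and tails through `R`. -/

namespace EvenHoles

variable {V : Type*} {G : SimpleGraph V}

theorem PathIn.exists_prepend {S : Set V} {u v w : V} {n : ℕ} (h : PathIn G S w v n)
    (huw : G.Adj u w) (hw : w ∈ S) : ∃ m, PathIn G S u v m := by
  obtain ⟨f, hf, rfl, rfl, hS⟩ := h
  have := exists_pathIn_of_seq (G := G) (S := S) (n := n + 1)
    (f := fun i => if i = 0 then u else f (i - 1)) ?_ ?_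
  · simpa using this
  · intro i hi
    rcases Nat.eq_zero_or_pos i with h | h
    · subst h
      simpa using huw
    · rw [if_neg (by omega), if_neg (by omega)]
      have := hf.adj (i - 1) (by omega)
      rwa [show i - 1 + 1 = i by omega] at this
  · intro i h0 hi
    rw [if_neg (by omega)]
    rcases Nat.eq_zero_or_pos (i - 1) with h | h
    · rw [h]; exact hw
    · exact hS _ h (by omega)

/-- A frame together with the set `R` of all remaining vertices that are not neighbours of the
apex. -/
structure Core (G : SimpleGraph V) (a : V) {ι : Type*} (S : ι → Triple V) (R : Set V) (r : ℕ) :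
    Prop extends Frame G a S where
  three : ∀ i j : ι, ∃ l, l ≠ i ∧ l ≠ j
  antiR : ∀ i, Anti G R (S i).D
  apexR : Anti G {a} R
  disjointR : ∀ i, ∀ x ∈ R, x ∉ (S i).B
  reachC : ∀ i, ∀ c ∈ (S i).C, ∃ b ∈ (S i).B, ∃ n, PathIn G (S i).C c b n
  reachR : ∀ x ∈ R, ∃ i, ∃ b ∈ (S i).B, ∃ n, PathIn G R x b n
  parity : ∀ i, ∀ b ∈ (S i).B, ∀ n, PathIn G (S i).D a b n → n % 2 = r % 2

/-- A neighbour of the apex outside the frame. -/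
structure Outer (G : SimpleGraph V) (a : V) {ι : Type*} (S : ι → Triple V) (R : Set V) (y : V) :
    Prop where
  adj : G.Adj a y
  notMem_A : ∀ i, y ∉ (S i).A
  miss : ∀ i j, i ≠ j → Att G y (S i).D ∨ Att G y (S j).D
  far : (∃ i, Att G y ((S i).B ∪ (S i).C)) ∨ Att G y R

section

variable {a : V} {ι : Type*} {S : ι → Triple V} {R : Set V} {r : ℕ} {y z : V}

theorem Outer.notMem_D (hy : Outer G a S R y) (hF : Frame G a S) (i : ι) : y ∉ (S i).D := by
  rintro (h | h)
  · exact hy.notMem_A i h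
  · exact (hF.antiC i a rfl y h).2 hy.adj

theorem Outer.notMem_B (hy : Outer G a S R y) (hF : Frame G a S) (i : ι) : y ∉ (S i).B :=
  fun h => (hF.antiB i a rfl y h).2 hy.adj

theorem Outer.notMem_R (hy : Outer G a S R y) (K : Core G a S R r) : y ∉ R :=
  fun h => (K.apexR a rfl y h).2 hy.adj

/-- All neighbours of `y` that are not neighbours of the apex lie in `R`. -/
def RType (G : SimpleGraph V) {ι : Type*} (S : ι → Triple V) (y : V) : Prop :=
  ∀ i, Anti G {y} ((S i).B ∪ (S i).C)

/-- Three paths from `y` to `z` through different strips have pairwise odd length sums, which is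
impossible. -/
theorem Frame.no_three (hG : EvenHoleFree G) (hF : Frame G a S) (hyz : y ≠ z)
    (hadj : ¬ G.Adj y z) {i j l : ι} (hij : i ≠ j) (hil : i ≠ l) (hjl : j ≠ l)
    (hyi : Att G y (S i).D) (hyj : Att G y (S j).D) (hyl : Att G y (S l).D)
    (hzi : Att G z (S i).D) (hzj : Att G z (S j).D) (hzl : Att G z (S l).D) : False := by
  obtain ⟨m, hm⟩ := (hF.conn i).exists_pathIn hyi hzi
  obtain ⟨n, hn⟩ := (hF.conn j).exists_pathIn hyj hzj
  obtain ⟨k, hk⟩ := (hF.conn l).exists_pathIn hyl hzl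
  have h1 := hm.odd_add hG hn hyz hadj (hF.antiD i j hij)
  have h2 := hm.odd_add hG hk hyz hadj (hF.antiD i l hil)
  have h3 := hn.odd_add hG hk hyz hadj (hF.antiD j l hjl)
  omega

/-- Paths from a vertex to the bases of two different strips have lengths of the same parity. -/
theorem Frame.parity_of_ne (hG : EvenHoleFree G) (hF : Frame G a S) {v : V} {i j : ι} (hij : i ≠ j)
    {b c : V} (hb : b ∈ (S i).B) (hc : c ∈ (S j).B) (hvb : v ≠ b) (hvc : v ≠ c) {m n : ℕ}
    (hm : PathIn G (S i).D v b m) (hn : PathIn G (S j).D v c n) : m % 2 = n % 2 := by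
  have hbc := hF.adjB i j hij b hb c hc
  have hDB := hF.antiDB i j hij
  have hDB' := hF.antiDB j i hij.symm
  have hD := hF.antiD i j hij
  by_cases h1 : G.Adj v b
  · have e1 := hm.eq_one_of_adj h1
    by_cases h2 : G.Adj v c
    · have e2 := hn.eq_one_of_adj h2
      omega
    · have h := hm.concat (PathIn.of_adj ∅ hbc) (by grind [Anti]) (hm.pos_of_ne hvb) one_pos
      have := PathIn.odd_add hG h hn hvc h2 (by grind [Anti, SimpleGraph.adj_comm])
      omega
  · have h := hn.concat (PathIn.of_adj ∅ hbc.symm) (by grind [Anti, SimpleGraph.adj_comm])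
      (hn.pos_of_ne hvc) one_pos
    have := PathIn.odd_add hG h hm hvb h1 (by grind [Anti, SimpleGraph.adj_comm])
    omega

theorem Core.exists_path_to_B (K : Core G a S R r) {v : V} {i : ι}
    (hv : Att G v ((S i).B ∪ (S i).C)) : ∃ b ∈ (S i).B, ∃ n, PathIn G (S i).C v b n := by
  obtain ⟨s, hs | hs, h⟩ := hv
  · exact ⟨s, hs, 1, .of_adj _ h⟩
  · obtain ⟨b, hb, n, hn⟩ := K.reachC i s hs
    obtain ⟨m, hm⟩ := hn.exists_prepend h hs
    exact ⟨b, hb, m, hm⟩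

/-- The vertices of `R` with no neighbour in the bases. -/
def deep (G : SimpleGraph V) {ι : Type*} (S : ι → Triple V) (R : Set V) : Set V :=
  {x ∈ R | ∀ i, ∀ b ∈ (S i).B, ¬ G.Adj x b}

/-- A path from `y` through `R` to a vertex `p` of `R` with a neighbour in the bases, no other
vertex of the path having such a neighbour. -/
theorem Core.exists_tail (K : Core G a S R r) (hy : Outer G a S R y) (hR : RType G S y) :
    ∃ p ∈ R, ∃ n, 0 < n ∧ PathIn G (deep G S R) y p n ∧
      ∃ i, ∃ b ∈ (S i).B, G.Adj p b := by
  have hex : ∃ n, ∃ i, ∃ b ∈ (S i).B, PathIn G R y b n := by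
    rcases hy.far with ⟨i, s, hs, h⟩ | ⟨s, hs, h⟩
    · exact absurd h (hR i y rfl s hs).2
    · obtain ⟨i, b, hb, n, hn⟩ := K.reachR s hs
      obtain ⟨m, hm⟩ := hn.exists_prepend h hs
      exact ⟨m, i, b, hb, hm⟩
  obtain ⟨n, i, b, hb, hn⟩ := hex
  have hyB : ∀ j, ∀ c ∈ (S j).B, y ≠ c ∧ ¬ G.Adj y c := fun j c hc => hR j y rfl c (Or.inl hc)
  obtain ⟨p, m, k, -, hQ, h1, h2, -, h4⟩ := hn.exists_split
    (fun w => ∃ j, w ∈ (S j).B ∨ ∃ c ∈ (S j).B, G.Adj w c) ⟨i, Or.inl hb⟩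
  have hm : 0 < m := by
    rcases Nat.eq_zero_or_pos m with h | h
    · subst h
      obtain ⟨f, hf, h0, rfl, -⟩ := h1
      rw [h0] at hQ
      obtain ⟨j, h | ⟨c, hc, h⟩⟩ := hQ
      · exact absurd rfl (hyB j y h).1
      · exact absurd h (hyB j c hc).2
    · exact h
  have hpB : ∀ j, p ∉ (S j).B := by
    intro j hp
    obtain ⟨w, hw, hadj, -⟩ := h1.symm.exists_cons
      (h1.two_le (hyB j p hp).1 (hyB j p hp).2)
    exact hw.2 ⟨j, Or.inr ⟨p, hp, hadj.symm⟩⟩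
  obtain ⟨j, hj | ⟨c, hc, hpc⟩⟩ := hQ
  · exact absurd hj (hpB j)
  refine ⟨p, ?_, m, hm, h1.mono ?_, j, c, hc, hpc⟩
  · rcases Nat.eq_zero_or_pos k with h | h
    · subst h
      obtain ⟨f, hf, h0, h5, -⟩ := h2
      exact absurd hb (by rw [← h5, h0]; exact hpB i)
    · exact h4 hm h
  · rintro x ⟨hx, hx'⟩
    exact ⟨hx, fun j c hc h => hx' ⟨j, Or.inr ⟨c, hc, h⟩⟩⟩

end

end EvenHoles

/-! ### Outer vertices whose far neighbours all lie in `R`. -/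

namespace EvenHoles

variable {V : Type*} {G : SimpleGraph V}

section

variable {a : V} {ι : Type*} {S : ι → Triple V} {R : Set V} {r : ℕ} {y z : V}

theorem Frame.arm_of_rung (hF : Frame G a S) {i : ι} {x b : V} {l : ℕ} (hx : x ∈ (S i).A)
    (hb : b ∈ (S i).B) (hl : PathIn G (S i).C x b l) :
    0 < l ∧ PathIn G (insert x (S i).C) a b (l + 1) := by
  have hB := hF.antiB i
  have hC := hF.antiC i
  have hax := hF.adjA i x hx
  have hpos : 0 < l := by
    refine hl.pos_of_ne ?_
    rintro rfl
    exact (hB a rfl x hb).2 hax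
  refine ⟨hpos, ?_⟩
  have := (PathIn.of_adj ∅ hax).concat hl (by grind [Anti]) one_pos hpos
  rw [add_comm]
  exact this.mono (by grind)

theorem Triple.insert_subset_D {T : Triple V} {x : V} (hx : x ∈ T.A) : insert x T.C ⊆ T.D :=
  Set.insert_subset (T.A_subset_D hx) T.C_subset_D

theorem Core.rung_parity (K : Core G a S R r) {i : ι} {x b : V} {l : ℕ} (hx : x ∈ (S i).A)
    (hb : b ∈ (S i).B) (hl : PathIn G (S i).C x b l) : (l + 1) % 2 = r % 2 :=
  K.parity i b hb _ ((K.arm_of_rung hx hb hl).2.mono (Triple.insert_subset_D hx))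

theorem PathIn.cons {T : Set V} {u v w : V} {n : ℕ} (huv : G.Adj u v) (h : PathIn G T v w n)
    (hanti : Anti G {u} (insert w T)) (hn : 0 < n) : PathIn G (insert v T) u w (n + 1) := by
  have := (PathIn.of_adj ∅ huv).concat h (by simpa using hanti) one_pos hn
  rw [add_comm]
  simpa using this

theorem PathIn.snoc {T : Set V} {u v w : V} {n : ℕ} (h : PathIn G T u v n) (hvw : G.Adj v w)
    (hanti : Anti G (insert u T) {w}) (hn : 0 < n) : PathIn G (insert v T) u w (n + 1) := by
  have := h.concat (PathIn.of_adj ∅ hvw) (by simpa using hanti) hn one_pos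
  simpa using this

/-- From `y` to `b` there are two routes: the tail, ending with `p b` or with `p c b`, and the rung,
entered directly at `x` or via `a x`. The hole that they form makes the adjacencies of `y x` and of
`p b` determine each other once the parity of `n + r` is known. -/
theorem Core.tail_parity (hG : EvenHoleFree G) (K : Core G a S R r) (hy : Outer G a S R y)
    (hR : RType G S y) {p : V} (hp : p ∈ R) {n : ℕ} (hn : 0 < n)
    (hP : PathIn G (deep G S R) y p n) {i q : ι} {x b c : V} {l : ℕ} (hx : x ∈ (S i).A)
    (hb : b ∈ (S i).B) (hl : PathIn G (S i).C x b l) (hc : c ∈ (S q).B) (hpc : G.Adj p c)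
    (hq : G.Adj p b ∨ q ≠ i) : (G.Adj p b → (G.Adj y x ↔ (n + r) % 2 = 0)) ∧
      (¬ G.Adj p b → (G.Adj y x ↔ (n + r) % 2 = 1)) := by
  have hyR := hR i
  have haR := K.apexR
  have haB := K.antiB
  have hRD := K.antiR i
  have hRB := K.disjointR
  have hyb := hR i y rfl b (Or.inl hb)
  have hxD := (S i).A_subset_D hx
  have hCD := (S i).C_subset_D
  have hpar := K.rung_parity hx hb hl
  obtain ⟨hl0, harm⟩ := K.arm_of_rung hx hb hl
  -- The route along the rung has the parity of `r` if `y` is adjacent to `x`, and one more if it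
  -- must enter via `a`.
  have h1 : ∃ e, PathIn G (insert a (S i).D) y b e ∧
      ((G.Adj y x ∧ e % 2 = r % 2) ∨ (¬ G.Adj y x ∧ e % 2 = (r + 1) % 2)) := by
    by_cases hyx : G.Adj y x
    · refine ⟨l + 1, (PathIn.cons hyx hl ?_ hl0).mono ?_, .inl ⟨hyx, hpar⟩⟩
      · grind [Anti]
      · grind
    · refine ⟨l + 1 + 1, (PathIn.cons hy.adj.symm harm ?_ (by omega)).mono ?_,
        .inr ⟨hyx, by omega⟩⟩
      · have := hy.notMem_A i
        grind [Anti]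
      · grind
  obtain ⟨e, he, hpe⟩ := h1
  constructor
  · intro hpb
    have h2 := hP.snoc hpb (by grind [Anti, deep]) hn
    have := he.odd_add hG h2 hyb.1 hyb.2 (by grind [Anti, deep, SimpleGraph.adj_comm])
    grind
  · intro hpb
    have hqi : q ≠ i := hq.resolve_left hpb
    have hcb := K.adjB q i hqi c hc b hb
    have hDB := K.antiDB i q hqi.symm
    have hyc := hR q y rfl c (Or.inl hc)
    have h3 : PathIn G (insert c ∅) p b 2 := by
      refine PathIn.cons hpc (PathIn.of_adj ∅ hcb) ?_ one_pos
      grind [Anti]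
    have h2 := hP.concat h3 (by grind [Anti, deep]) hn two_pos
    have := he.odd_add hG h2 hyb.1 hyb.2 (by grind [Anti, deep, SimpleGraph.adj_comm])
    grind

theorem Core.exists_att_ne (K : Core G a S R r) (hy : Outer G a S R y) (i : ι) :
    ∃ j, j ≠ i ∧ Att G y (S j).D := by
  obtain ⟨l, hl, -⟩ := K.three i i
  obtain ⟨m, hm, hml⟩ := K.three i l
  rcases hy.miss l m hml.symm with h | h
  · exact ⟨l, hl, h⟩
  · exact ⟨m, hm, h⟩

theorem RType.exists_adj (hR : RType G S y) {i : ι} (h : Att G y (S i).D) :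
    ∃ x ∈ (S i).A, G.Adj y x := by
  obtain ⟨s, hs | hs, h⟩ := h
  · exact ⟨s, hs, h⟩
  · exact absurd h (hR i y rfl s (Or.inr hs)).2

/-- A second strip `j` attached to `y` forces all paths from `y` to `B i` through `D i` to have
parity `r`. Comparing these with the tail shows on which side of the dichotomy in `tail_parity` the
vertex `p` lies, for every rung of the strip `i`. -/
theorem Core.adj_of_rtype (hG : EvenHoleFree G) (K : Core G a S R r) (hy : Outer G a S R y)
    (hR : RType G S y) {i : ι} (hi : Att G y (S i).D) {x : V} (hx : x ∈ (S i).A) : G.Adj y x := by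
  obtain ⟨j, hji, hj⟩ := K.exists_att_ne hy i
  obtain ⟨x₀, hx₀, hyx₀⟩ := hR.exists_adj hi
  obtain ⟨xj, hxj, hyxj⟩ := hR.exists_adj hj
  obtain ⟨b₀, hb₀, l₀, hl₀⟩ := K.rungA i x₀ hx₀
  obtain ⟨bj, hbj, lj, hlj⟩ := K.rungA j xj hxj
  obtain ⟨b, hb, l, hl⟩ := K.rungA i x hx
  obtain ⟨p, hp, n, hn, hP, q, c, hc, hpc⟩ := K.exists_tail hy hR
  have hyB : ∀ j, ∀ c ∈ (S j).B, y ≠ c ∧ ¬ G.Adj y c := fun j c hc => hR j y rfl c (Or.inl hc)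
  have hX : ∀ b ∈ (S i).B, ∃ m, PathIn G (S i).D y b m ∧ m % 2 = r % 2 := by
    intro b hb
    obtain ⟨m, hm⟩ := (K.conn i).exists_pathIn hi (K.att_B hb)
    refine ⟨m, hm, ?_⟩
    have h1 := PathIn.cons hyxj hlj (by have := hR j; grind [Anti])
      (K.arm_of_rung hxj hbj hlj).1
    have := K.parity_of_ne hG hji.symm hb hbj (hyB i b hb).1 (hyB j bj hbj).1 hm
      (h1.mono (Triple.insert_subset_D hxj))
    have := K.rung_parity hxj hbj hlj
    omega
  have hRD := K.antiR i
  have hRB := K.disjointR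
  have key := fun {i : ι} {q : ι} {x b c : V} {l : ℕ} => K.tail_parity hG hy hR hp hn hP
    (i := i) (q := q) (x := x) (b := b) (c := c) (l := l)
  rcases Nat.mod_two_eq_zero_or_one (n + r) with hnr | hnr
  -- If `n + r` is even, then `p` must see `bj`. This supplies the detour `p bj b` for the hole when
  -- `y x` is a nonedge.
  · have hpj : G.Adj p bj := by
      by_contra hpj
      by_cases hqj : q = j
      · subst hqj
        have h1 := key hx₀ hb₀ hl₀ hc hpc (Or.inr hji)
        have hp0 : G.Adj p b₀ := by
          by_contra h
          have := (h1.2 h).1 hyx₀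
          omega
        have := ((key hxj hbj hlj hb₀ hp0 (Or.inr hji.symm)).2 hpj).1 hyxj
        omega
      · have := ((key hxj hbj hlj hc hpc (Or.inr hqj)).2 hpj).1 hyxj
        omega
    by_contra hyx
    have h1 := key hx hb hl hbj hpj (Or.inr hji)
    have hpb : ¬ G.Adj p b := fun h => hyx ((h1.1 h).2 hnr)
    obtain ⟨m, hm, hmr⟩ := hX b hb
    have hDB := K.antiDB i j hji.symm
    have hyb := hyB i b hb
    have hybj := hyB j bj hbj
    have h3 : PathIn G (insert bj ∅) p b 2 :=
      PathIn.cons hpj (PathIn.of_adj ∅ (K.adjB j i hji bj hbj b hb)) (by grind [Anti]) one_pos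
    have h2 := hP.concat h3 (by clear key hX hyB; grind [Anti, deep]) hn two_pos
    have := hm.odd_add hG h2 hyb.1 hyb.2 (by clear key hX hyB; grind [Anti, deep, SimpleGraph.adj_comm])
    omega
  -- If `n + r` is odd, then a neighbour of `p` in `B i` would close an even hole with a path from
  -- `y` through `D i`.
  · have hpi : ∀ b ∈ (S i).B, ¬ G.Adj p b := by
      intro b hb hpb
      obtain ⟨m, hm, hmr⟩ := hX b hb
      have hyb := hyB i b hb
      have h2 := hP.snoc hpb (by clear key hX hyB; grind [Anti, deep]) hn
      have := hm.odd_add hG h2 hyb.1 hyb.2 (by clear key hX hyB; grind [Anti, deep, SimpleGraph.adj_comm])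
      omega
    have hqi : q ≠ i := by
      rintro rfl
      exact hpi c hc hpc
    exact ((key hx hb hl hc hpc (Or.inr hqi)).2 (hpi b hb)).2 hnr

/-- If `z` is complete to `A i` and has no neighbour in `C i`, then there is an even path between
`y` and `z` through the strip. -/
theorem Core.exists_even_path (hG : EvenHoleFree G) (K : Core G a S R r) (hy : Outer G a S R y)
    (hz : Outer G a S R z) (hzR : RType G S z) (hyz : y ≠ z) (hadj : ¬ G.Adj y z) {i : ι}
    (hyi : Att G y (S i).D) (hzi : Att G z (S i).D) :
    ∃ t, PathIn G (S i).D y z t ∧ t % 2 = 0 := by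
  obtain ⟨x₀, hx₀⟩ := K.nonempty_A i
  obtain ⟨s, hs, hys⟩ := hyi
  obtain ⟨n, hn⟩ := (K.conn i).exists_pathIn_mem hs ((S i).A_subset_D hx₀)
  obtain ⟨n, hn⟩ := hn.exists_prepend hys hs
  obtain ⟨w, m, k, -, hw, h1, -, -, -⟩ := hn.exists_split (· ∈ (S i).A) hx₀
  have h2 : PathIn G (S i).C y w m := h1.mono (by
    rintro v ⟨hv | hv, hv'⟩
    · exact absurd hv hv'
    · exact hv)
  have hyw : y ≠ w := by
    rintro rfl
    exact hy.notMem_A i hw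
  have hzw := K.adj_of_rtype hG hz hzR hzi hw
  -- Unless `y w` is an edge, the path through `C i` forms a hole with `y a w`.
  have hodd : m % 2 = 1 := by
    by_cases h : G.Adj y w
    · rw [h2.eq_one_of_adj h]
    · have h3 : PathIn G (insert a ∅) y w 2 :=
        PathIn.cons hy.adj.symm (PathIn.of_adj ∅ (K.adjA i w hw)) (by grind [Anti]) one_pos
      have := h2.odd_add hG h3 hyw h (by
        have := K.antiC i
        grind [Anti, SimpleGraph.adj_comm])
      omega
  refine ⟨m + 1, (h2.snoc hzw.symm ?_ (by omega)).mono (Triple.insert_subset_D hw), by omega⟩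
  have := hzR i
  have := hz.notMem_D K.toFrame i
  grind [Anti, SimpleGraph.adj_comm]

end

end EvenHoles

/-! ### Joining paths that may have shortcuts. -/

namespace EvenHoles

variable {V : Type*} {G : SimpleGraph V}

section

variable {S T : Set V} {u v w z : V} {m n : ℕ}

theorem PathIn.diff (h : PathIn G S u v n) : PathIn G {s ∈ S | s ≠ u ∧ s ≠ v} u v n := by
  obtain ⟨f, hf, rfl, rfl, hS⟩ := h
  exact ⟨f, hf, rfl, rfl, fun i h1 h2 =>
    ⟨hS i h1 h2, (hf.inj 0 i h1 h2.le).symm, hf.inj i n h2 le_rfl⟩⟩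

theorem PathIn.exists_connected_insert (h : PathIn G S u v n) (hn : 0 < n) :
    ∃ I ⊆ S, PathIn G I u v n ∧ ConnectedSet G (insert u I) ∧ Att G v (insert u I) := by
  rcases Nat.lt_or_ge n 2 with h2 | h2
  · have : n = 1 := by omega
    subst this
    obtain ⟨f, hf, rfl, rfl, hS⟩ := h
    have := hf.adj 0 (by omega)
    exact ⟨∅, Set.empty_subset _, .of_adj _ this, by simpa using ConnectedSet.singleton (f 0),
      f 0, by simp, this.symm⟩
  · obtain ⟨I, hI, h3, h4, h5, h6⟩ := h.exists_interior h2
    exact ⟨I, hI, h3, h4.insert h5, h6.mono (Set.subset_insert _ _)⟩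

/-- Two paths with a common end can be concatenated, unless there is a path between their other ends
that avoids the common end. -/
theorem PathIn.exists_or_anti (h : PathIn G S u v m) (h' : PathIn G T v w n) (hm : 0 < m)
    (hn : 0 < n) : (∃ k, PathIn G (S ∪ T) u w k) ∨ ∃ I ⊆ S, ∃ J ⊆ T,
      PathIn G I u v m ∧ PathIn G J v w n ∧ Anti G (insert u I) (insert w J) := by
  obtain ⟨I, hI, h1, h2, -⟩ := h.exists_connected_insert hm
  obtain ⟨J, hJ, h3, h4, -⟩ := h'.symm.exists_connected_insert hn
  by_cases hanti : Anti G (insert u I) (insert w J)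
  · exact Or.inr ⟨I, hI, J, hJ, h1, h3.symm, hanti⟩
  · left
    have hc : ConnectedSet G (insert u I ∪ insert w J) := by
      rw [Anti] at hanti
      push Not at hanti
      obtain ⟨s, hs, t, ht, hst⟩ := hanti
      by_cases h : s = t
      · subst h
        exact h2.union_of_inter h4 hs ht
      · exact h2.union_of_adj h4 hs ht (hst h)
    obtain ⟨k, hk⟩ := hc.exists_pathIn_mem (Or.inl (Set.mem_insert u I))
      (Or.inr (Set.mem_insert w J))
    exact ⟨k, hk.diff.mono (by grind)⟩

theorem PathIn.concat_or (h : PathIn G S u v m) (h' : PathIn G T v w n) (huw : u ≠ w) :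
    (∃ k, PathIn G (S ∪ T) u w k) ∨ PathIn G (insert v (S ∪ T)) u w (m + n) := by
  rcases Nat.eq_zero_or_pos m with rfl | hm
  · obtain ⟨f, hf, h1, h2, -⟩ := h
    obtain rfl : u = v := h1.symm.trans h2
    rw [zero_add]
    exact Or.inr (h'.mono (by grind))
  rcases Nat.eq_zero_or_pos n with rfl | hn
  · obtain ⟨f, hf, h1, h2, -⟩ := h'
    obtain rfl : v = w := h1.symm.trans h2
    exact Or.inr (h.mono (by grind))
  rcases h.exists_or_anti h' hm hn with hk | ⟨I, hI, J, hJ, h1, h3, hanti⟩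
  · exact Or.inl hk
  · exact Or.inr ((h1.concat h3 hanti hm hn).mono
      (Set.insert_subset_insert (Set.union_subset_union hI hJ)))

theorem PathIn.trans (h : PathIn G S u v m) (h' : PathIn G T v w n) (huw : u ≠ w) :
    ∃ k, PathIn G (insert v (S ∪ T)) u w k := by
  rcases h.concat_or h' huw with ⟨k, hk⟩ | hk
  · exact ⟨k, hk.mono (Set.subset_insert _ _)⟩
  · exact ⟨_, hk⟩

/-- Either `z` misses the path after `u`, or one can leave from `z` along the path to `v`. Adjacency
of `z` to `u` itself is not considered. -/
theorem PathIn.nonadj_or (h : PathIn G S u v n) (hn : 0 < n) (z : V) :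
    (PathIn G {s ∈ S | ¬ G.Adj z s} u v n ∧ ¬ G.Adj z v) ∨ ∃ m, PathIn G S z v m := by
  obtain ⟨f, hf, rfl, rfl, hS⟩ := h
  by_cases hex : ∃ i, 0 < i ∧ i ≤ n ∧ G.Adj z (f i)
  · obtain ⟨i, h1, h2, h3⟩ := hex
    right
    rcases h2.lt_or_eq with h4 | rfl
    · have : PathIn G S (f i) (f n) (n - i) :=
        ⟨fun j => f (i + j), hf.shift (by omega), rfl, congrArg f (by omega),
          fun j _ _ => hS _ (by omega) (by omega)⟩
      exact this.exists_prepend h3 (hS i h1 h4)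
    · exact ⟨1, .of_adj _ h3⟩
  · push Not at hex
    exact Or.inl ⟨⟨f, hf, rfl, rfl, fun i h1 h2 => ⟨hS i h1 h2, hex i h1 h2.le⟩⟩,
      hex n hn le_rfl⟩

end

end EvenHoles

/-! ### Parity of paths from outer vertices. -/

namespace EvenHoles

variable {V : Type*} {G : SimpleGraph V}

section

variable {a : V} {ι : Type*} {S : ι → Triple V} {R : Set V} {r : ℕ} {y z : V}

theorem Outer.anti_of_not_att (hy : Outer G a S R y) (hF : Frame G a S) {i : ι}
    (h : ¬ Att G y ((S i).B ∪ (S i).C)) : Anti G {y} ((S i).B ∪ (S i).C) := by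
  rintro _ rfl s hs
  refine ⟨?_, fun h' => h ⟨s, hs, h'⟩⟩
  rintro rfl
  rcases hs with hs | hs
  · exact hy.notMem_B hF i hs
  · exact hy.notMem_D hF i (Or.inr hs)

theorem Outer.rtype_or (hy : Outer G a S R y) (hF : Frame G a S) :
    RType G S y ∨ ∃ i, Att G y ((S i).B ∪ (S i).C) := by
  by_cases h : ∃ i, Att G y ((S i).B ∪ (S i).C)
  · exact Or.inr h
  · exact Or.inl fun i => hy.anti_of_not_att hF fun h' => h ⟨i, h'⟩

theorem Outer.anti_D (hy : Outer G a S R y) (hF : Frame G a S) {i : ι}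
    (h : ¬ Att G y (S i).D) : Anti G {y} (S i).D := by
  rintro _ rfl s hs
  refine ⟨?_, fun h' => h ⟨s, hs, h'⟩⟩
  rintro rfl
  exact hy.notMem_D hF i hs

theorem Outer.ne_of_mem_B (hy : Outer G a S R y) (hF : Frame G a S) {i : ι} {b : V}
    (hb : b ∈ (S i).B) : y ≠ b := by
  rintro rfl
  exact hy.notMem_B hF i hb

/-- Two strips attached to `y` exist because `y` misses at most one; any other path to a base is
compared with one in a different strip by `Frame.parity_of_ne`. -/
theorem Core.exists_rho (hG : EvenHoleFree G) (K : Core G a S R r) (hy : Outer G a S R y) :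
    ∃ ρ, ∀ i, ∀ b ∈ (S i).B, ∀ n, PathIn G (S i).D y b n → n % 2 = ρ % 2 := by
  obtain ⟨i₀, -⟩ := hy.far.elim (fun ⟨i, _⟩ => ⟨i, trivial⟩) (fun ⟨s, hs, _⟩ =>
    (K.reachR s hs).elim fun i _ => (⟨i, trivial⟩ : ∃ _ : ι, True))
  obtain ⟨j, -, hj⟩ := K.exists_att_ne hy i₀
  obtain ⟨l, hlj, hl⟩ := K.exists_att_ne hy j
  obtain ⟨b, hb⟩ := K.nonempty_B j
  obtain ⟨c, hc⟩ := K.nonempty_B l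
  obtain ⟨m, hm⟩ := (K.conn j).exists_pathIn hj (K.att_B hb)
  obtain ⟨n, hn⟩ := (K.conn l).exists_pathIn hl (K.att_B hc)
  have hB : ∀ i, ∀ b ∈ (S i).B, y ≠ b := fun i b hb => hy.ne_of_mem_B K.toFrame hb
  have h1 := K.parity_of_ne hG hlj.symm hb hc (hB _ _ hb) (hB _ _ hc) hm hn
  refine ⟨m, fun i d hd k hk => ?_⟩
  by_cases hij : i = j
  · subst hij
    have := K.parity_of_ne hG hlj.symm hd hc (hB _ _ hd) (hB _ _ hc) hk hn
    omega
  · exact K.parity_of_ne hG hij hd hb (hB _ _ hd) (hB _ _ hb) hk hm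

/-- Nonadjacent neighbours of `a` have no other nonneighbour of `a` as a common neighbour. -/
theorem Outer.no_common (hG : EvenHoleFree G) (hy : Outer G a S R y) (hz : Outer G a S R z)
    (hyz : y ≠ z) (hadj : ¬ G.Adj y z) {w : V} (haw : a ≠ w) (hnaw : ¬ G.Adj a w)
    (h1 : G.Adj y w) (h2 : G.Adj z w) : False := by
  have ha := hy.adj
  have ha' := hz.adj
  have hP : ∀ v, G.Adj y v → G.Adj z v → PathIn G {v} y z 2 := by
    intro v h1 h2
    have := PathIn.cons h1 (PathIn.of_adj ∅ h2.symm) (by grind [Anti]) one_pos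
    simpa using this
  have := (hP a ha.symm ha'.symm).odd_add hG (hP w h1 h2) hyz hadj (by grind [Anti])
  omega

/-- A path whose interior avoids the neighbours of the apex is odd if it joins two nonadjacent
neighbours of the apex. -/
theorem odd_of_anti_apex (hG : EvenHoleFree G) {T : Set V} {u v : V} {n : ℕ} (hau : G.Adj a u)
    (hav : G.Adj a v) (huv : u ≠ v) (hT : Anti G {a} T) (h : PathIn G T u v n) : n % 2 = 1 := by
  by_cases hadj : G.Adj u v
  · rw [h.eq_one_of_adj hadj]
  · have h' : PathIn G {a} u v 2 := by
      have := PathIn.cons hau.symm (PathIn.of_adj ∅ hav) (by grind [Anti]) one_pos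
      simpa using this
    have := h.odd_add hG h' huv hadj hT.symm
    omega

theorem Core.path_of_adj_A (K : Core G a S R r) {i : ι} {x b : V} {l : ℕ}
    (hy : Anti G {y} ((S i).B ∪ (S i).C)) (hx : x ∈ (S i).A) (hyx : G.Adj y x)
    (hb : b ∈ (S i).B) (hl : PathIn G (S i).C x b l) : PathIn G (S i).D y b (l + 1) :=
  ((PathIn.cons hyx hl (by grind [Anti]) (K.arm_of_rung hx hb hl).1)).mono
    (Triple.insert_subset_D hx)

/-- If `y` is anticomplete to a strip, then the paths from `y` to the bases through the sets `C`
have parity `r + 1`. -/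
theorem Core.parity_of_anti (hG : EvenHoleFree G) (K : Core G a S R r) (hy : Outer G a S R y)
    {i j : ι} (hij : i ≠ j) (hD : Anti G {y} (S j).D) (hB : Anti G {y} (S j).B) {b : V}
    (hb : b ∈ (S i).B) {n : ℕ} (hn : PathIn G (S i).C y b n) : n % 2 = (r + 1) % 2 := by
  obtain ⟨x, hx⟩ := K.nonempty_A j
  obtain ⟨c, hc, l, hl⟩ := K.rungA j x hx
  obtain ⟨hl0, harm⟩ := K.arm_of_rung hx hc hl
  have hpar := K.rung_parity hx hc hl
  have hxC := Triple.insert_subset_D hx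
  have h1 := (PathIn.cons hy.adj.symm (harm.mono hxC) (by grind [Anti]) (by omega))
  have hyb := hy.ne_of_mem_B K.toFrame hb
  have hyc := hB y rfl c hc
  have haD := K.antiC i
  have haB := K.antiB i
  have haB' := K.antiB j
  have hDB := K.antiDB i j hij
  have hDB' := K.antiDB j i hij.symm
  have hDD := K.antiD i j hij
  have hC := (S i).C_subset_D
  have h2 := hn.concat (PathIn.of_adj ∅ (K.adjB i j hij b hb c hc)) (by
    clear haD haB haB' hDB' hDD
    grind [Anti]) (hn.pos_of_ne hyb) one_pos
  have := h1.odd_add hG h2 hyc.1 hyc.2 (by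
    have hab := haB a rfl b hb
    clear haB haB'  hDB hD hB
    grind [Anti, SimpleGraph.adj_comm])
  omega

end

end EvenHoles

/-! ### Nonadjacent outer vertices with two common strips. -/

namespace EvenHoles

variable {V : Type*} {G : SimpleGraph V}

section

variable {a : V} {ι : Type*} {S : ι → Triple V} {R : Set V} {r : ℕ} {y z : V}

/-- The union of the sets `B j ∪ C j` for `j ≠ i`. -/
def others (S : ι → Triple V) (i : ι) : Set V := {x | ∃ j, j ≠ i ∧ x ∈ (S j).B ∪ (S j).C}

theorem Core.exists_path_others (K : Core G a S R r) (hyz : y ≠ z) {i : ι}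
    (hy : Att G y (others S i)) (hz : Att G z (others S i)) :
    ∃ n, PathIn G (others S i) y z n := by
  obtain ⟨s, ⟨j, hj, hs⟩, hys⟩ := hy
  obtain ⟨t, ⟨l, hl, ht⟩, hzt⟩ := hz
  obtain ⟨b, hb, m, hm⟩ := K.exists_path_to_B ⟨s, hs, hys⟩
  obtain ⟨c, hc, n, hn⟩ := K.exists_path_to_B ⟨t, ht, hzt⟩
  have hBE : ∀ q, q ≠ i → (S q).B ⊆ others S i := fun q hq x hx => ⟨q, hq, Or.inl hx⟩
  have hCE : ∀ q, q ≠ i → (S q).C ⊆ others S i := fun q hq x hx => ⟨q, hq, Or.inr hx⟩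
  have hm' := hm.mono (hCE j hj)
  have hn' := hn.mono (hCE l hl)
  have key : ∀ u v w m n, v ∈ others S i → u ≠ w → PathIn G (others S i) u v m →
      PathIn G (others S i) v w n → ∃ k, PathIn G (others S i) u w k := by
    intro u v w m n hv huw h1 h2
    obtain ⟨k, hk⟩ := h1.trans h2 huw
    exact ⟨k, hk.mono (by grind)⟩
  have hbc : ∃ k, PathIn G (others S i) b c k := by
    by_cases hjl : j = l
    · subst hjl
      by_cases hbc : b = c
      · subst hbc
        exact ⟨0, .refl _ _⟩
      -- Two vertices of one base need not be adjacent, so the connection is made through the base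
      -- of a third strip.
      · obtain ⟨q, hqi, hqj⟩ := K.three i j
        obtain ⟨d, hd⟩ := K.nonempty_B q
        exact key b d c 1 1 (hBE q hqi hd) hbc (.of_adj _ (K.adjB j q hqj.symm b hb d hd))
          (.of_adj _ (K.adjB q j hqj d hd c hc))
    · exact ⟨1, .of_adj _ (K.adjB j l hjl b hb c hc)⟩
  obtain ⟨k, hk⟩ := hbc
  by_cases hyc : y = c
  · subst hyc
    exact ⟨n, hn'.symm⟩
  · obtain ⟨q, hq⟩ := key y b c _ _ (hBE j hj hb) hyc hm' hk
    exact key y c z _ _ (hBE l hl hc) hyz hq hn'.symm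

theorem Core.anti_others (K : Core G a S R r) (i : ι) : Anti G (S i).D (others S i) := by
  rintro s hs t ⟨j, hj, ht | ht⟩
  · exact K.antiDB i j hj.symm s hs t ht
  · exact K.antiD i j hj.symm s hs t ((S j).C_subset_D ht)

theorem Core.apex_anti_others (K : Core G a S R r) (i : ι) : Anti G {a} (others S i) := by
  rintro s hs t ⟨j, hj, ht | ht⟩
  · exact K.antiB j s hs t ht
  · exact K.antiC j s hs t ht

/-- Paths from `y` and `z` to the bases of two different strips form a path between `y` and `z`. -/
theorem Frame.path_across (hF : Frame G a S) (hyz : y ≠ z) (hadj : ¬ G.Adj y z) {i j : ι}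
    (hij : i ≠ j) {T U : Set V} (hT : T ⊆ (S i).D) (hU : U ⊆ (S j).D) {b c : V}
    (hb : b ∈ (S i).B) (hc : c ∈ (S j).B) {m n : ℕ} (hm : PathIn G T y b m)
    (hn : PathIn G U z c n) (hyb : y ≠ b) (hzc : z ≠ c) (hy : Anti G {y} (insert c U))
    (hz : Anti G {z} (insert b T)) : PathIn G (insert b (insert c (T ∪ U))) y z (m + n + 1) := by
  have hDB := hF.antiDB i j hij
  have hDB' := hF.antiDB j i hij.symm
  have hD := hF.antiD i j hij
  have h1 := PathIn.cons (hF.adjB i j hij b hb c hc) hn.symm (by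
    clear hDB hD hT hy
    grind [Anti, SimpleGraph.adj_comm]) (hn.pos_of_ne hzc)
  have h2 := hm.concat h1 (by
    clear hDB'
    grind [Anti, SimpleGraph.adj_comm]) (hm.pos_of_ne hyb) (by omega)
  rw [add_assoc]
  exact h2.mono (by grind)

theorem Frame.anti_across (hF : Frame G a S) {i j l : ι} (hil : l ≠ i) (hjl : l ≠ j)
    {T U : Set V} (hT : T ⊆ (S i).D) (hU : U ⊆ (S j).D) {b c : V}
    (hb : b ∈ (S i).B) (hc : c ∈ (S j).B) :
    Anti G (S l).D (insert b (insert c (T ∪ U))) := by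
  have h5 := hF.antiDB l i hil
  have h6 := hF.antiD l i hil
  have h7 := hF.antiDB l j hjl
  have h8 := hF.antiD l j hjl
  grind [Anti]

/-- Here `y` sees the sets `B ∪ C` only in the strip `i`. This forces `y` to be complete to `A q`
for all `q ≠ i`, hence attached to a third strip `l`, which `z` must then miss altogether. Therefore
paths to the bases have parity `r` from `y` and `r + 1` from `z`, and a path from `y` to `z` made of
one of each and an edge between bases is even. According to whether `z` meets the path from `y` to
`b₁`, such a path contradicts the apex or the path through the strip `j`. -/
theorem Core.false_of_not_att_others (hG : EvenHoleFree G) (K : Core G a S R r)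
    (hy : Outer G a S R y) (hz : Outer G a S R z) (hyz : y ≠ z) (hadj : ¬ G.Adj y z) {i j : ι}
    (hij : i ≠ j) (hyi : Att G y (S i).D) (hyj : Att G y (S j).D) (hzi : Att G z (S i).D)
    (hzj : Att G z (S j).D) (hyE : ¬ Att G y (others S i)) (hyN : ∃ i, Att G y ((S i).B ∪ (S i).C))
    (hzN : ∃ i, Att G z ((S i).B ∪ (S i).C)) {t : ℕ} (hT : PathIn G (S i).D y z t)
    (ht : t % 2 = 1) : False := by
  have hF := K.toFrame
  obtain ⟨ρ, hρ⟩ := K.exists_rho hG hy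
  obtain ⟨σ, hσ⟩ := K.exists_rho hG hz
  have hyBC : ∀ q, q ≠ i → Anti G {y} ((S q).B ∪ (S q).C) := fun q hq =>
    hy.anti_of_not_att hF fun ⟨s, hs, h⟩ => hyE ⟨s, ⟨q, hq, hs⟩, h⟩
  have hy1 : Att G y ((S i).B ∪ (S i).C) := by
    obtain ⟨q, s, hs, hq⟩ := hyN
    by_cases h : q = i
    · exact h ▸ ⟨s, hs, hq⟩
    · exact absurd hq (hyBC q h y rfl s hs).2
  obtain ⟨b₁, hb₁, n₁, hY⟩ := K.exists_path_to_B hy1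
  have hCD : ∀ q, (S q).C ⊆ (S q).D := fun q => (S q).C_subset_D
  -- the parity of paths from `y` to the bases
  have hρr : ρ % 2 = r % 2 := by
    obtain ⟨x, hx | hx, hyx⟩ := hyj
    · obtain ⟨b, hb, l, hl⟩ := K.rungA j x hx
      have h1 := hρ j b hb _ (K.path_of_adj_A (hyBC j hij.symm) hx hyx hb hl)
      have h2 := K.rung_parity hx hb hl
      omega
    · exact absurd hyx (hyBC j hij.symm y rfl x (Or.inr hx)).2
  have hn₁ : n₁ % 2 = r % 2 := (hρ i b₁ hb₁ _ (hY.mono (hCD i))).trans hρr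
  -- If `y x` is a nonedge, the route `y a x` and a rung to `b` has parity `r + 1`, as does the
  -- route from `y` through `b₁` to `b`.
  have hcompl : ∀ q, q ≠ i → ∀ x ∈ (S q).A, G.Adj y x := by
    intro q hq x hx
    by_contra hyx
    obtain ⟨b, hb, l, hl⟩ := K.rungA q x hx
    obtain ⟨hl0, harm⟩ := K.arm_of_rung hx hb hl
    have hpar := K.rung_parity hx hb hl
    have hxD := (S q).A_subset_D hx
    have hyA := hy.notMem_A q
    have hyq := hyBC q hq
    have hyb := hyq y rfl b (Or.inl hb)
    have h1 := PathIn.cons hy.adj.symm harm (by grind [Anti]) (by omega)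
    have hbb := K.adjB i q hq.symm b₁ hb₁ b hb
    have hyb₁ := hy.ne_of_mem_B hF hb₁
    have hDB := K.antiDB i q hq.symm
    have h2 := hY.concat (PathIn.of_adj ∅ hbb) (by
      have := hCD i
      grind [Anti]) (hY.pos_of_ne hyb₁) one_pos
    have hD := K.antiD i q hq.symm
    have hC := hCD i
    have hC' := hCD q
    have hDB' := K.antiDB q i hq
    have haB := K.antiB i a rfl b₁ hb₁
    have haC := K.antiC i
    have := h1.odd_add hG h2 hyb.1 hyb.2 (by
      clear hDB hyq hyA
      grind [Anti, SimpleGraph.adj_comm])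
    omega
  -- a third strip
  obtain ⟨l, hli, hlj⟩ := K.three i j
  have hyl : Att G y (S l).D := by
    obtain ⟨x, hx⟩ := K.nonempty_A l
    exact ⟨x, Or.inl hx, hcompl l hli x hx⟩
  have hzl : ¬ Att G z (S l).D := fun hzl =>
    K.no_three hG hyz hadj hij hli.symm hlj.symm hyi hyj hyl hzi hzj hzl
  have hzD := hz.anti_D hF hzl
  have hpath : ∀ b ∈ (S l).B, ∃ k, PathIn G (S l).D y b k ∧ k % 2 = r % 2 := by
    intro b hb
    obtain ⟨x, hx, m, hm⟩ := K.rungB l b hb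
    exact ⟨_, K.path_of_adj_A (hyBC l hli) hx (hcompl l hli x hx) hb hm, K.rung_parity hx hb hm⟩
  obtain ⟨t', hT'⟩ := (K.conn j).exists_pathIn hyj hzj
  have htt : (t + t') % 2 = 1 := hT.odd_add hG hT' hyz hadj (K.antiD i j hij)
  -- A neighbour of `z` in `B l` would give a path from `y` to `z` anticomplete to both the path
  -- through `i` and the path through `j`, whose lengths have odd sum.
  have hzB : Anti G {z} (S l).B := by
    rintro _ rfl b hb
    refine ⟨hz.ne_of_mem_B hF hb, fun hzb => ?_⟩
    obtain ⟨k, hk, -⟩ := hpath b hb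
    have hyb := hyBC l hli y rfl b (Or.inl hb)
    have h1 := hk.snoc hzb.symm (by grind [Anti, SimpleGraph.adj_comm]) (hk.pos_of_ne hyb.1)
    have hX : ∀ q, q ≠ l → Anti G (S q).D (insert b (S l).D) := by
      intro q hq
      have := K.antiDB q l hq
      have := K.antiD q l hq
      grind [Anti]
    have h2 := hT.odd_add hG h1 hyz hadj (hX i hli.symm)
    have h3 := hT'.odd_add hG h1 hyz hadj (hX j hlj.symm)
    omega
  have hzσ : ∀ q, q ≠ l → ∀ b ∈ (S q).B, ∀ m, PathIn G (S q).C z b m → m % 2 = (r + 1) % 2 :=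
    fun q hq b hb m hm => K.parity_of_anti hG hz hq hzD hzB hb hm
  have hσr : σ % 2 = (r + 1) % 2 := by
    obtain ⟨q, hq⟩ := hzN
    have hql : q ≠ l := by
      rintro rfl
      obtain ⟨s, hs | hs, h⟩ := hq
      · exact (hzB z rfl s hs).2 h
      · exact (hzD z rfl s (hCD _ hs)).2 h
    obtain ⟨b, hb, m, hm⟩ := K.exists_path_to_B hq
    have h1 := hzσ q hql b hb m hm
    have h2 := hσ q b hb m (hm.mono (hCD q))
    omega
  -- If `z` saw only `A q`, a rung would give a path to the base of parity `r` instead of `r + 1`.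
  have hZ : ∀ q, Att G z (S q).D → ∃ b ∈ (S q).B, ∃ m, PathIn G (S q).C z b m := by
    intro q hq
    apply K.exists_path_to_B
    by_contra hna
    have hanti := hz.anti_of_not_att hF hna
    obtain ⟨x, hx | hx, hzx⟩ := hq
    · obtain ⟨b, hb, m, hm⟩ := K.rungA q x hx
      have h1 := hσ q b hb _ (K.path_of_adj_A hanti hx hzx hb hm)
      have h2 := K.rung_parity hx hb hm
      omega
    · exact (hanti z rfl x (Or.inr hx)).2 hzx
  have hZpar : ∀ q, ∀ b ∈ (S q).B, ∀ m, PathIn G (S q).C z b m → m % 2 = (r + 1) % 2 :=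
    fun q b hb m hm => (hσ q b hb m (hm.mono (hCD q))).trans hσr
  -- `z` has no neighbours on a path from `y` to `b₁` avoiding them
  have hno : ∀ b ∈ (S i).B, ∀ m, PathIn G {s ∈ (S i).C | ¬ G.Adj z s} y b m → ¬ G.Adj z b →
      False := by
    intro b hb m hm hzb
    obtain ⟨c, hc, k, hk⟩ := hZ j hzj
    have h1 := (hρ i b hb _ (hm.mono ((Set.sep_subset _ _).trans (hCD i)))).trans hρr
    have h2 := hZpar j c hc k hk
    have hyj' := hyBC j hij.symm
    have hzb' := hz.ne_of_mem_B hF hb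
    have hzC : z ∉ (S i).C := fun h => hz.notMem_D hF i (Or.inr h)
    have h3 := hF.path_across hyz hadj hij ((Set.sep_subset _ _).trans (hCD i)) (hCD j) hb hc hm hk
      (hy.ne_of_mem_B hF hb) (hz.ne_of_mem_B hF hc)
      (hyj'.mono subset_rfl (Set.insert_subset (Or.inl hc) Set.subset_union_right))
      (by clear hρ hσ hpath hZ hZpar hzσ hyBC hcompl hyN hzN hCD hyE; grind [Anti])
    have haB := K.antiB i a rfl b hb
    have haB' := K.antiB j a rfl c hc
    have haC := K.antiC i
    have haC' := K.antiC j
    -- The path across has even length and avoids all neighbours of `a` in its interior, so it forms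
    -- an even hole with `y a z`.
    have := odd_of_anti_apex hG hy.adj hz.adj hyz (by
      clear hρ hσ hpath hZ hZpar hzσ hyBC hcompl hyN hzN hCD hyE hzB hzD
      grind [Anti]) h3
    omega
  rcases Nat.lt_or_ge n₁ 2 with h2 | h2
  · have hpos := hY.pos_of_ne (hy.ne_of_mem_B hF hb₁)
    have : n₁ = 1 := by omega
    subst this
    obtain ⟨f, hf, h3, h4, -⟩ := hY
    have hyb : G.Adj y b₁ := by
      have := hf.adj 0 (by omega)
      rwa [h3, h4] at this
    have haB := K.antiB i a rfl b₁ hb₁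
    exact hno b₁ hb₁ 1 (.of_adj _ hyb)
      (hy.no_common hG hz hyz hadj haB.1 haB.2 hyb)
  · obtain ⟨w, hw, hyw, hwb, hyb, hyb'⟩ := hY.exists_cons h2
    have haw := K.antiC i a rfl w hw
    have hzw : ¬ G.Adj z w := hy.no_common hG hz hyz hadj haw.1 haw.2 hyw
    rcases hwb.nonadj_or (by omega) z with ⟨h3, h4⟩ | ⟨m, hm⟩
    · refine hno b₁ hb₁ _ ((PathIn.cons hyw h3 ?_ (by omega)).mono ?_) h4
      · rintro _ rfl v (rfl | ⟨⟨-, h⟩, -⟩)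
        · exact ⟨hyb, hyb'⟩
        · exact h
      · rintro v (rfl | ⟨⟨h, -⟩, h'⟩)
        · exact ⟨hw, hzw⟩
        · exact ⟨h, h'⟩
    -- Now `z` reaches `b₁` while avoiding `y` and its neighbours. The even path through the strips
    -- `l` and `i` is compared with the path through `j`, which is even because `t` is odd.
    · have h1 := hZpar i b₁ hb₁ m (hm.mono (Set.sep_subset _ _))
      obtain ⟨b, hb⟩ := K.nonempty_B l
      obtain ⟨k, hk, hkr⟩ := hpath b hb
      have hzl : Anti G {z} (insert b (S l).D) := by
        rintro _ rfl v (rfl | hv)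
        · exact hzB _ rfl v hb
        · exact hzD _ rfl v hv
      have hyi : Anti G {y} (insert b₁ {s ∈ (S i).C | y ≠ s ∧ ¬ G.Adj y s}) := by
        rintro _ rfl v (rfl | hv)
        · exact ⟨hyb, hyb'⟩
        · exact hv.2
      have hsub : {s ∈ (S i).C | y ≠ s ∧ ¬ G.Adj y s} ⊆ (S i).D :=
        (Set.sep_subset _ _).trans (hCD i)
      have h3 := hF.path_across hyz hadj hli subset_rfl hsub hb hb₁ hk hm
        (hy.ne_of_mem_B hF hb) (hz.ne_of_mem_B hF hb₁) hyi hzl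
      have := hT'.odd_add hG h3 hyz hadj
        (hF.anti_across hlj.symm hij.symm subset_rfl hsub hb hb₁)
      omega

/-- Two nonadjacent outer vertices are not attached to two common strips. -/
theorem Core.not_two_common (hG : EvenHoleFree G) (K : Core G a S R r) (hy : Outer G a S R y)
    (hz : Outer G a S R z) (hyz : y ≠ z) (hadj : ¬ G.Adj y z) {i j : ι} (hij : i ≠ j)
    (hyi : Att G y (S i).D) (hyj : Att G y (S j).D) (hzi : Att G z (S i).D)
    (hzj : Att G z (S j).D) : False := by
  have hF := K.toFrame
  have hadj' : ¬ G.Adj z y := fun h => hadj h.symm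
  obtain ⟨t, hT⟩ := (K.conn i).exists_pathIn hyi hzi
  obtain ⟨u, hU⟩ := (K.conn j).exists_pathIn hyj hzj
  have htu := hT.odd_add hG hU hyz hadj (K.antiD i j hij)
  rcases hz.rtype_or hF with hzR | hzN
  · obtain ⟨t', hT', h1⟩ := K.exists_even_path hG hy hz hzR hyz hadj hyi hzi
    obtain ⟨u', hU', h2⟩ := K.exists_even_path hG hy hz hzR hyz hadj hyj hzj
    have := hT'.odd_add hG hU' hyz hadj (K.antiD i j hij)
    omega
  rcases hy.rtype_or hF with hyR | hyN
  · obtain ⟨t', hT', h1⟩ := K.exists_even_path hG hz hy hyR hyz.symm hadj' hzi hyi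
    obtain ⟨u', hU', h2⟩ := K.exists_even_path hG hz hy hyR hyz.symm hadj' hzj hyj
    have := hT'.odd_add hG hU' hyz.symm hadj' (K.antiD i j hij)
    omega
  -- One of the two paths is odd, say through the strip `i`. If both vertices see the `B ∪ C` part
  -- of the other strips, a path there avoids the neighbours of `a`, so it is also odd, and the two
  -- odd paths close up.
  have key : ∀ {i j : ι} {t : ℕ}, i ≠ j → Att G y (S i).D → Att G y (S j).D → Att G z (S i).D →
      Att G z (S j).D → PathIn G (S i).D y z t → t % 2 = 1 → False := by
    intro i j t hij hyi hyj hzi hzj hT ht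
    by_cases hyE : Att G y (others S i)
    · by_cases hzE : Att G z (others S i)
      · obtain ⟨n, hn⟩ := K.exists_path_others hyz hyE hzE
        have h1 := odd_of_anti_apex hG hy.adj hz.adj hyz (K.apex_anti_others i) hn
        have h2 := hT.odd_add hG hn hyz hadj (K.anti_others i)
        omega
      · exact K.false_of_not_att_others hG hz hy hyz.symm hadj' hij hzi hzj hyi hyj hzE hzN hyN
          hT.symm ht
    · exact K.false_of_not_att_others hG hy hz hyz hadj hij hyi hyj hzi hzj hyE hyN hzN hT ht
  rcases Nat.mod_two_eq_zero_or_one t with ht | ht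
  · exact key hij.symm hyj hyi hzj hzi hU (by omega)
  · exact key hij hyi hyj hzi hzj hT ht

end

end EvenHoles

/-! ### Exactly one common strip; both vertices have all far neighbours in `R`. -/

namespace EvenHoles

variable {V : Type*} {G : SimpleGraph V}

section

variable {a : V} {ι : Type*} {S : ι → Triple V} {R : Set V} {r : ℕ} {y z : V}

theorem PathIn.odd_add_concat (hG : EvenHoleFree G) {X Y Z : Set V} {u v w : V} {k m n : ℕ}
    (h : PathIn G X u v k) (h1 : PathIn G Y u w m) (h2 : PathIn G Z w v n) (huv : u ≠ v)
    (hadj : ¬ G.Adj u v) (huw : u ≠ w) (hwv : w ≠ v) (hX : Anti G X (insert w (Y ∪ Z)))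
    (hYZ : Anti G (insert u Y) (insert v Z)) : (k + m + n) % 2 = 1 := by
  have := h.odd_add hG (h1.concat h2 hYZ (h1.pos_of_ne huw) (h2.pos_of_ne hwv)) huv hadj hX
  omega

/-- Two nonadjacent outer vertices attached to exactly one common strip. -/
structure OneCommon (G : SimpleGraph V) (a : V) {ι : Type*} (S : ι → Triple V) (R : Set V) (r : ℕ)
    (y z : V) (i j l : ι) : Prop extends Core G a S R r where
  free : EvenHoleFree G
  hy : Outer G a S R y
  hz : Outer G a S R z
  ne : y ≠ z
  nadj : ¬ G.Adj y z
  ij : i ≠ j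
  il : i ≠ l
  jl : j ≠ l
  all : ∀ q, q = i ∨ q = j ∨ q = l
  yi : Att G y (S i).D
  yj : Att G y (S j).D
  yl : ¬ Att G y (S l).D
  zi : Att G z (S i).D
  zj : ¬ Att G z (S j).D
  zl : Att G z (S l).D

namespace OneCommon

variable {i j l : ι}

theorem symm (H : OneCommon G a S R r y z i j l) : OneCommon G a S R r z y i l j :=
  { H with
    hy := H.hz
    hz := H.hy
    ne := H.ne.symm
    nadj := fun h => H.nadj h.symm
    ij := H.il
    il := H.ij
    jl := H.jl.symm
    all := fun q => by have := H.all q; tauto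
    yi := H.zi
    yj := H.zl
    yl := H.zj
    zi := H.yi
    zj := H.yl
    zl := H.yj }

theorem y_anti (H : OneCommon G a S R r y z i j l) : Anti G {y} (S l).D :=
  H.hy.anti_D H.toFrame H.yl

theorem z_anti (H : OneCommon G a S R r y z i j l) : Anti G {z} (S j).D :=
  H.hz.anti_D H.toFrame H.zj

/-- The hole runs through the common strip from `y` to `z` and returns along the tail, the edge `p
c`, and the strip `j`. If `p c` is a nonedge, the detour `p d c` changes the parity, as in
`parity_of_tail_nonadj`. -/
theorem parity_of_tail_adj (H : OneCommon G a S R r y z i j l) (hyR : RType G S y)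
    (hzR : RType G S z) {t k n : ℕ} {c p : V} {T : Set V} (hT : PathIn G (S i).D y z t)
    (hk : PathIn G (S j).D y c k) (hc : c ∈ (S j).B) (hp : p ∈ R) (hTR : T ⊆ R)
    (hTB : ∀ q, Anti G T (S q).B) (hyT : Anti G {y} (insert p T)) (hP : PathIn G T p z n)
    (hn : 0 < n) (hpc : G.Adj p c) : (t + k + n) % 2 = 0 := by
  have hyc := hyR j y rfl c (Or.inl hc)
  have hzc := hzR j z rfl c (Or.inl hc)
  have hzD := H.z_anti
  have hyz := H.ne
  have hadj := H.nadj
  have hRi := H.antiR i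
  have hRj := H.antiR j
  have hDB := H.antiDB i j H.ij
  have hDD := H.antiD i j H.ij
  have hTBj := hTB j
  have hpB := H.disjointR j p hp
  have h1 := PathIn.cons hpc.symm hP (by
    clear hRi hRj hTB hDB hDD hTR hzD
    grind [Anti, SimpleGraph.adj_comm]) hn
  have h2 := hT.odd_add_concat H.free hk h1 hyz hadj hyc.1 hzc.1.symm (by
      clear hTBj hTB hzD
      grind [Anti, SimpleGraph.adj_comm]) (by
      clear hTBj hTB hDB hDD hRi
      grind [Anti, SimpleGraph.adj_comm])
  omega

theorem parity_of_tail_nonadj (H : OneCommon G a S R r y z i j l) (hyR : RType G S y)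
    (hzR : RType G S z) {t k n : ℕ} {c d p : V} {T : Set V} (hT : PathIn G (S i).D y z t)
    (hk : PathIn G (S j).D y c k) (hc : c ∈ (S j).B) (hd : d ∈ (S l).B) (hp : p ∈ R) (hTR : T ⊆ R)
    (hTB : ∀ q, Anti G T (S q).B) (hyT : Anti G {y} (insert p T)) (hP : PathIn G T p z n)
    (hn : 0 < n) (hpc : ¬ G.Adj p c) (hpd : G.Adj p d) : (t + k + n) % 2 = 1 := by
  have hyc := hyR j y rfl c (Or.inl hc)
  have hyd := hyR l y rfl d (Or.inl hd)
  have hzc := hzR j z rfl c (Or.inl hc)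
  have hzd := hzR l z rfl d (Or.inl hd)
  have hzD := H.z_anti.symm
  have hyz := H.ne
  have hadj := H.nadj
  have hRi := (H.antiR i).symm
  have hRj := (H.antiR j).symm
  have hDB := H.antiDB i j H.ij
  have hDD := H.antiD i j H.ij
  have hDB' := H.antiDB i l H.il
  have hDBj := H.antiDB j l H.jl
  have hTBj := hTB j
  have hTBl := hTB l
  have hpB := H.disjointR j p hp
  have hpB' := H.disjointR l p hp
  have h0 := PathIn.cons hpd.symm hP (by
    clear hRi hRj hTB hTBj hDB hDB' hDBj hDD hTR hzD
    grind [Anti, SimpleGraph.adj_comm]) hn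
  have h1 := PathIn.cons (H.adjB j l H.jl c hc d hd) h0 (by
    clear hRi hRj hTB hTBl hDB hDB' hDBj hDD hTR hzD
    grind [Anti, SimpleGraph.adj_comm]) (by omega)
  have h2 := hT.odd_add_concat H.free hk h1 hyz hadj hyc.1 hzc.1.symm (by
      clear hTBj hTBl hTB hzD hyT hDBj hRj
      grind [Anti]) (by
      clear hTBj hTBl hTB hDB hDD hDB' hRi
      grind [Anti])
  omega

/-- Start from the tail of `z`, ending at `p`. Since `z` sees the sets `A` of the strips `i`, `l`
but not that of `j`, `tail_parity` forces `p` to treat `B j` oppositely to `B i`. If `y` misses the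
tail, the even path through the common strip closes an even hole. Otherwise `y` has a tail to the
same `p`, and as `y` is complete to both `A i` and `A j`, the behaviour of `p` on the two bases
gives contradictory parities. -/
theorem false_of_rtype_of_rtype (H : OneCommon G a S R r y z i j l) (hyR : RType G S y)
    (hzR : RType G S z) : False := by
  have hK := H.toCore
  obtain ⟨t, hT, ht⟩ := hK.exists_even_path H.free H.hy H.hz hzR H.ne H.nadj H.yi H.zi
  obtain ⟨p, hp, n, hn, hP, q, c, hc, hpc⟩ := hK.exists_tail H.hz hzR
  have hzA : ∀ q, Att G z (S q).D → ∀ x ∈ (S q).A, G.Adj z x := fun q hq x hx =>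
    hK.adj_of_rtype H.free H.hz hzR hq hx
  have hyA : ∀ q, Att G y (S q).D → ∀ x ∈ (S q).A, G.Adj y x := fun q hq x hx =>
    hK.adj_of_rtype H.free H.hy hyR hq hx
  have hzp : ∀ q, Att G z (S q).D → ∀ c ∈ (S q).B, G.Adj p c → (n + r) % 2 = 0 := by
    intro q hq c hc hpc
    obtain ⟨x, hx, m, hm⟩ := H.rungB q c hc
    exact ((hK.tail_parity H.free H.hz hzR hp hn hP hx hc hm hc hpc (Or.inl hpc)).1 hpc).1
      (hzA q hq x hx)
  have hpath : ∀ c ∈ (S j).B, ∃ k, PathIn G (S j).D y c k ∧ k % 2 = r % 2 := by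
    intro c hc
    obtain ⟨x, hx, m, hm⟩ := H.rungB j c hc
    exact ⟨_, hK.path_of_adj_A (hyR j) hx (hyA j H.yj x hx) hc hm, hK.rung_parity hx hc hm⟩
  have hdeepR : deep G S R ⊆ R := Set.sep_subset _ _
  have hdeepB : ∀ q, Anti G (deep G S R) (S q).B := by
    rintro q s ⟨hs, hs'⟩ b hb
    refine ⟨?_, hs' q b hb⟩
    rintro rfl
    exact H.disjointR q s hs hb
  -- the tail of `z` is anticomplete to `y`
  have hsub : {s ∈ deep G S R | ¬ G.Adj y s} ⊆ deep G S R := Set.sep_subset _ _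
  have hyp : y ≠ p := by
    rintro rfl
    exact H.hy.notMem_R hK hp
  have hyT : ¬ G.Adj y p → Anti G {y} (insert p {s ∈ deep G S R | ¬ G.Adj y s}) := by
    rintro h _ rfl v (rfl | ⟨hv, hv'⟩)
    · exact ⟨hyp, h⟩
    · refine ⟨?_, hv'⟩
      rintro rfl
      exact H.hy.notMem_R hK (hdeepR hv)
  rcases Nat.mod_two_eq_zero_or_one (n + r) with hnr | hnr
  -- For even `n + r`, the vertex `p` sees the bases of the strips attached to `z`, and no vertex of
  -- `B j`.
  · have hex : ∀ q, Att G z (S q).D → ∃ d ∈ (S q).B, G.Adj p d := by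
      intro q' hq'
      by_cases hqq : q = q'
      · exact hqq ▸ ⟨c, hc, hpc⟩
      · obtain ⟨b, hb⟩ := H.nonempty_B q'
        obtain ⟨x, hx, m, hm⟩ := H.rungB q' b hb
        refine ⟨b, hb, ?_⟩
        by_contra hpb
        have := ((hK.tail_parity H.free H.hz hzR hp hn hP hx hb hm hc hpc (Or.inr hqq)).2 hpb).1
          (hzA q' hq' x hx)
        omega
    obtain ⟨d, hd, hpd⟩ := hex l H.zl
    obtain ⟨e, he, hpe⟩ := hex i H.zi
    have hpB : ∀ b ∈ (S j).B, ¬ G.Adj p b := by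
      intro b hb hpb
      obtain ⟨x, hx, m, hm⟩ := H.rungB j b hb
      have := ((hK.tail_parity H.free H.hz hzR hp hn hP hx hb hm hb hpb (Or.inl hpb)).1 hpb).2 hnr
      exact H.zj ⟨x, Or.inl hx, this⟩
    rcases hP.nonadj_or hn y with ⟨h1, h2⟩ | ⟨m, hm⟩
    · obtain ⟨b, hb⟩ := H.nonempty_B j
      obtain ⟨k, hk, hkr⟩ := hpath b hb
      have := H.parity_of_tail_nonadj hyR hzR hT hk hb hd hp (hsub.trans hdeepR)
        (fun q => (hdeepB q).mono hsub subset_rfl) (hyT h2) h1.symm hn (hpB b hb) hpd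
      omega
    · have hm0 := hm.pos_of_ne hyp
      obtain ⟨x, hx, k, hk⟩ := H.rungB i e he
      have h1 := ((hK.tail_parity H.free H.hy hyR hp hm0 hm hx he hk he hpe (Or.inl hpe)).1 hpe).1
        (hyA i H.yi x hx)
      obtain ⟨b, hb⟩ := H.nonempty_B j
      obtain ⟨x', hx', k', hk'⟩ := H.rungB j b hb
      have h2 := ((hK.tail_parity H.free H.hy hyR hp hm0 hm hx' hb hk' hd hpd
        (Or.inr H.jl.symm)).2 (hpB b hb)).1 (hyA j H.yj x' hx')
      omega
  -- For odd `n + r`, the vertex `p` misses `B i` and `B l`, so `j` is the only strip whose base it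
  -- can see.
  · have hpi : ∀ q, Att G z (S q).D → ∀ b ∈ (S q).B, ¬ G.Adj p b := by
      intro q hq b hb hpb
      have := hzp q hq b hb hpb
      omega
    have hq : q = j := by
      rcases H.all q with rfl | h | rfl
      · exact absurd hpc (hpi q H.zi c hc)
      · exact h
      · exact absurd hpc (hpi q H.zl c hc)
    subst hq
    rcases hP.nonadj_or hn y with ⟨h1, h2⟩ | ⟨m, hm⟩
    · obtain ⟨k, hk, hkr⟩ := hpath c hc
      have := H.parity_of_tail_adj hyR hzR hT hk hc hp (hsub.trans hdeepR)
        (fun q => (hdeepB q).mono hsub subset_rfl) (hyT h2) h1.symm hn hpc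
      omega
    · have hm0 := hm.pos_of_ne hyp
      obtain ⟨x, hx, k, hk⟩ := H.rungB q c hc
      have h1 := ((hK.tail_parity H.free H.hy hyR hp hm0 hm hx hc hk hc hpc (Or.inl hpc)).1 hpc).1
        (hyA q H.yj x hx)
      obtain ⟨b, hb⟩ := H.nonempty_B i
      obtain ⟨x', hx', k', hk'⟩ := H.rungB i b hb
      have h2 := ((hK.tail_parity H.free H.hy hyR hp hm0 hm hx' hb hk' hc hpc
        (Or.inr H.ij.symm)).2 (hpi i H.zi b hb)).1 (hyA i H.yi x' hx')
      omega

end OneCommon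

end

end EvenHoles

/-! ### Exactly one common strip; cases settled by a single comparison of parities. -/

namespace EvenHoles

variable {V : Type*} {G : SimpleGraph V}

namespace OneCommon

variable {a : V} {ι : Type*} {S : ι → Triple V} {R : Set V} {r : ℕ} {y z : V} {i j l : ι}

/-- As `y` misses `D l`, the path `a y b` forms a hole with any arm of the strip `l` ending at `b`.
-/
theorem odd_of_adj_B (H : OneCommon G a S R r y z i j l) {b : V} (hb : b ∈ (S l).B)
    (hyb : G.Adj y b) : r % 2 = 1 := by
  obtain ⟨n, hn⟩ := H.exists_arm hb
  have hab := H.antiB l a rfl b hb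
  have h1 : PathIn G {y} a b 2 := by
    have := PathIn.cons H.hy.adj (PathIn.of_adj ∅ hyb) (by grind [Anti]) one_pos
    simpa using this
  have h2 := h1.odd_add H.free hn hab.1 hab.2 H.y_anti
  have := H.parity l b hb n hn
  omega

theorem anti_insert (H : OneCommon G a S R r y z i j l) {b : V} (hb : b ∈ (S l).B) :
    Anti G (S i).D (insert b (S l).D) := by
  have := H.antiDB i l H.il
  have := H.antiD i l H.il
  grind [Anti]

theorem even_of_rtype (H : OneCommon G a S R r y z i j l) (hzR : RType G S z) :
    ∃ t, PathIn G (S i).D y z t ∧ t % 2 = 0 :=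
  H.toCore.exists_even_path H.free H.hy H.hz hzR H.ne H.nadj H.yi H.zi

theorem path_of_rtype (H : OneCommon G a S R r y z i j l) (hzR : RType G S z) {b : V}
    (hb : b ∈ (S l).B) : ∃ n, PathIn G (S l).D z b n ∧ n % 2 = r % 2 := by
  have hK := H.toCore
  obtain ⟨x, hx, m, hm⟩ := H.rungB l b hb
  exact ⟨_, hK.path_of_adj_A (hzR l) hx (hK.adj_of_rtype H.free H.hz hzR H.zl hx) hb hm,
    hK.rung_parity hx hb hm⟩

/-- A path from `z` through the strip `l` to `b` is odd, so continuing it to `y` gives an even path;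
there is also an even path through the common strip. -/
theorem false_of_rtype_of_adj (H : OneCommon G a S R r y z i j l) (hzR : RType G S z) {b : V}
    (hb : b ∈ (S l).B) (hyb : G.Adj y b) : False := by
  obtain ⟨t, hT, ht⟩ := H.even_of_rtype hzR
  obtain ⟨n, hn, hnr⟩ := H.path_of_rtype hzR hb
  have hr := H.odd_of_adj_B hb hyb
  have hzb := hzR l z rfl b (Or.inl hb)
  have hyD := H.y_anti.symm
  have hne := H.ne.symm
  have hnadj : ¬ G.Adj z y := fun h => H.nadj h.symm
  have h1 := hn.snoc hyb.symm (by grind [Anti]) (hn.pos_of_ne hzb.1)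
  have := hT.odd_add H.free h1.symm H.ne H.nadj (H.anti_insert hb)
  omega

/-- Since `y` is anticomplete to the whole strip `l`, `parity_of_anti` fixes the parity of one path
through a set `C`, and the constancy of the parity does the rest. -/
theorem parity_of_anti_B (H : OneCommon G a S R r y z i j l) (hyB : Anti G {y} (S l).B)
    (hyN : ∃ q, Att G y ((S q).B ∪ (S q).C)) {q : ι} {b : V} {n : ℕ} (hb : b ∈ (S q).B)
    (hn : PathIn G (S q).D y b n) : n % 2 = (r + 1) % 2 := by
  have hK := H.toCore
  obtain ⟨ρ, hρ⟩ := hK.exists_rho H.free H.hy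
  obtain ⟨q', hq'⟩ := hyN
  have hne : q' ≠ l := by
    rintro rfl
    obtain ⟨s, hs | hs, h⟩ := hq'
    · exact (hyB y rfl s hs).2 h
    · exact (H.y_anti y rfl s (Or.inr hs)).2 h
  obtain ⟨c, hc, m, hm⟩ := hK.exists_path_to_B hq'
  have h1 := hK.parity_of_anti H.free H.hy hne H.y_anti hyB hc hm
  have h2 := hρ q' c hc m (hm.mono (S q').C_subset_D)
  have h3 := hρ q b hb n hn
  omega

/-- Attachment to `A q` alone would yield, along a rung, a path of the wrong parity `r`. -/
theorem exists_path_C (H : OneCommon G a S R r y z i j l) (hyB : Anti G {y} (S l).B)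
    (hyN : ∃ q, Att G y ((S q).B ∪ (S q).C)) {q : ι} (hq : Att G y (S q).D) :
    ∃ b ∈ (S q).B, ∃ n, PathIn G (S q).C y b n := by
  have hK := H.toCore
  apply hK.exists_path_to_B
  by_contra hna
  have hanti := H.hy.anti_of_not_att H.toFrame hna
  obtain ⟨x, hx | hx, hyx⟩ := hq
  · obtain ⟨b, hb, m, hm⟩ := H.rungA q x hx
    have h1 := H.parity_of_anti_B hyB hyN hb (hK.path_of_adj_A hanti hx hyx hb hm)
    have h2 := hK.rung_parity hx hb hm
    omega
  · exact (hanti y rfl x (Or.inr hx)).2 hyx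

theorem y_anti_insert (H : OneCommon G a S R r y z i j l) (hyB : Anti G {y} (S l).B) {c : V}
    (hc : c ∈ (S l).B) : Anti G {y} (insert c (S l).D) := by
  have := H.y_anti
  grind [Anti]

/-- Paths to the bases have parity `r + 1` from `y` and `r` from `z`, so the path across the strips
`j`, `l` is even, like the one through `i`. -/
theorem false_of_rtype_of_anti (H : OneCommon G a S R r y z i j l) (hzR : RType G S z)
    (hyB : Anti G {y} (S l).B) (hyN : ∃ q, Att G y ((S q).B ∪ (S q).C)) : False := by
  have hF := H.toFrame
  obtain ⟨t, hT, ht⟩ := H.even_of_rtype hzR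
  obtain ⟨b, hb⟩ := H.nonempty_B j
  obtain ⟨c, hc⟩ := H.nonempty_B l
  obtain ⟨m, hm⟩ := (H.conn j).exists_pathIn H.yj (H.att_B hb)
  obtain ⟨n, hn, hnr⟩ := H.path_of_rtype hzR hc
  have h1 := H.parity_of_anti_B hyB hyN hb hm
  have h2 := hF.path_across H.ne H.nadj H.jl subset_rfl subset_rfl hb hc hm hn
    (H.hy.ne_of_mem_B hF hb) (H.hz.ne_of_mem_B hF hc) (H.y_anti_insert hyB hc)
    (H.symm.y_anti_insert (fun z' hz' s hs => hzR j z' hz' s (Or.inl hs)) hb)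
  have := hT.odd_add H.free h2 H.ne H.nadj
    (hF.anti_across H.ij H.il subset_rfl subset_rfl hb hc)
  omega

theorem no_common (H : OneCommon G a S R r y z i j l) {q : ι} {b : V} (hb : b ∈ (S q).B)
    (hyb : G.Adj y b) : ¬ G.Adj z b :=
  H.hy.no_common H.free H.hz H.ne H.nadj (H.antiB q a rfl b hb).1 (H.antiB q a rfl b hb).2 hyb

/-- The path `y b c z` makes every path through the common strip even. But the edge `y b` makes
paths from `y` to the bases odd, so the path from `y` through `D j` and `c` to `z` is even too. -/
theorem false_of_adj_of_adj (H : OneCommon G a S R r y z i j l) {b c : V} (hb : b ∈ (S l).B)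
    (hyb : G.Adj y b) (hc : c ∈ (S j).B) (hzc : G.Adj z c) : False := by
  have hF := H.toFrame
  obtain ⟨t, hT⟩ := (H.conn i).exists_pathIn H.yi H.zi
  have hzb := H.no_common hb hyb
  have hyc := H.symm.no_common hc hzc
  have hneb := H.hz.ne_of_mem_B hF hb
  have hnec := H.hy.ne_of_mem_B hF hc
  have hne := H.ne
  have hnadj := H.nadj
  have hbc := H.adjB l j H.jl.symm b hb c hc
  obtain ⟨ρ, hρ⟩ := H.toCore.exists_rho H.free H.hy
  have h1 := PathIn.cons hbc (PathIn.of_adj ∅ hzc.symm) (by grind [Anti, SimpleGraph.adj_comm])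
    one_pos
  have h2 := PathIn.cons hyb h1 (by grind [Anti]) two_pos
  have hDB := H.antiDB i l H.il
  have hDB' := H.antiDB i j H.ij
  have h3 := hT.odd_add H.free h2 H.ne H.nadj (by grind [Anti])
  obtain ⟨m, hm⟩ := (H.conn j).exists_pathIn H.yj (H.att_B hc)
  have h4 := hρ j c hc m hm
  have h5 := hρ l b hb 1 (.of_adj _ hyb)
  have hzD := H.z_anti.symm
  have h6 := hm.snoc hzc.symm (by grind [Anti]) (hm.pos_of_ne hnec)
  have := hT.odd_add H.free h6 H.ne H.nadj (H.symm.anti_insert hc)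
  omega

end OneCommon

end EvenHoles

/-! ### Exactly one common strip; neither vertex sees the strip attached only to the other. -/

namespace EvenHoles

variable {V : Type*} {G : SimpleGraph V}

namespace OneCommon

variable {a : V} {ι : Type*} {S : ι → Triple V} {R : Set V} {r : ℕ} {y z : V} {i j l : ι}

theorem even_of_anti_of_anti (H : OneCommon G a S R r y z i j l) (hyB : Anti G {y} (S l).B)
    (hzB : Anti G {z} (S j).B) (hyN : ∃ q, Att G y ((S q).B ∪ (S q).C))
    (hzN : ∃ q, Att G z ((S q).B ∪ (S q).C)) {t : ℕ} (hT : PathIn G (S i).D y z t) :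
    t % 2 = 0 := by
  have hF := H.toFrame
  obtain ⟨b, hb⟩ := H.nonempty_B j
  obtain ⟨c, hc⟩ := H.nonempty_B l
  obtain ⟨m, hm⟩ := (H.conn j).exists_pathIn H.yj (H.att_B hb)
  obtain ⟨n, hn⟩ := (H.conn l).exists_pathIn H.zl (H.att_B hc)
  have h1 := H.parity_of_anti_B hyB hyN hb hm
  have h2 := H.symm.parity_of_anti_B hzB hzN hc hn
  have h3 := hF.path_across H.ne H.nadj H.jl subset_rfl subset_rfl hb hc hm hn
    (H.hy.ne_of_mem_B hF hb) (H.hz.ne_of_mem_B hF hc) (H.y_anti_insert hyB hc)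
    (H.symm.y_anti_insert hzB hb)
  have := hT.odd_add H.free h3 H.ne H.nadj
    (hF.anti_across H.ij H.il subset_rfl subset_rfl hb hc)
  omega

/-- All paths from `y` to `z` through the common strip are even, while those through `C i` alone
would be odd by the apex. So vertices of `A i` are needed; with a minimal set of them, parity lets
both `y` and `z` reach the base while avoiding a chosen one, contradicting minimality or giving an
even path between neighbours of `a`. -/
theorem false_of_anti_of_anti [Finite V] (H : OneCommon G a S R r y z i j l)
    (hyB : Anti G {y} (S l).B) (hzB : Anti G {z} (S j).B)
    (hyN : ∃ q, Att G y ((S q).B ∪ (S q).C)) (hzN : ∃ q, Att G z ((S q).B ∪ (S q).C)) :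
    False := by
  have hF := H.toFrame
  have hCD := (S i).C_subset_D
  have haC := H.antiC i
  have hTeven : ∀ t, PathIn G (S i).D y z t → t % 2 = 0 := fun t hT =>
    H.even_of_anti_of_anti hyB hzB hyN hzN hT
  have hnoC : ∀ t, ¬ PathIn G (S i).C y z t := by
    intro t hT
    have := odd_of_anti_apex H.free H.hy.adj H.hz.adj H.ne haC hT
    have := hTeven t (hT.mono hCD)
    omega
  -- A minimal set of vertices of `A i` that suffices, together with `C i`, to connect `y` and `z`.
  obtain ⟨A', hA'⟩ := Set.Finite.exists_minimal
    (s := {A' | A' ⊆ (S i).A ∧ ∃ n, PathIn G ((S i).C ∪ A') y z n}) (Set.toFinite _)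
    ⟨(S i).A, subset_rfl, by
      obtain ⟨n, hn⟩ := (H.conn i).exists_pathIn H.yi H.zi
      exact ⟨n, hn.mono (by rw [Triple.D, Set.union_comm])⟩⟩
  obtain ⟨⟨hA'A, n, hT⟩, hmin⟩ := hA'
  have hE : (S i).C ∪ A' ⊆ (S i).D := Set.union_subset hCD (hA'A.trans (S i).A_subset_D)
  have hn := hTeven n (hT.mono hE)
  obtain ⟨x, m, k, hmk, hx, hT1, hT2, -, -⟩ := hT.exists_split (fun v => v ∈ A' ∨ v = z) (Or.inr rfl)
  replace hT1 : PathIn G (S i).C y x m := hT1.mono (by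
    rintro v ⟨hv | hv, hv'⟩
    · exact hv
    · exact absurd (Or.inl hv) hv')
  replace hx : x ∈ A' := by
    rcases hx with hx | rfl
    · exact hx
    · exact absurd hT1 (hnoC m)
  have hno : ∀ t, ¬ PathIn G ((S i).C ∪ (A' \ {x})) y z t := by
    intro t ht
    exact (hmin ⟨Set.sdiff_subset.trans hA'A, t, ht⟩ Set.sdiff_subset hx).2 rfl
  replace hT2 : PathIn G ((S i).C ∪ (A' \ {x})) x z k := hT2.mono (by
    rintro v ⟨hv | hv, hv'⟩
    · exact Or.inl hv
    · exact Or.inr ⟨hv, Ne.symm hv'⟩)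
  have hyx : y ≠ x := by
    rintro rfl
    exact H.hy.notMem_A i (hA'A hx)
  have hm := odd_of_anti_apex H.free H.hy.adj (H.adjA i x (hA'A hx)) hyx haC hT1
  obtain ⟨b, hb, q, hq⟩ := H.rungA i x (hA'A hx)
  have hqr := H.toCore.rung_parity (hA'A hx) hb hq
  have hyb := H.hy.ne_of_mem_B hF hb
  have hzb := H.hz.ne_of_mem_B hF hb
  have hxC : insert x ((S i).C ∪ (S i).C) ⊆ (S i).D := by
    rw [Set.union_self]
    exact Triple.insert_subset_D (hA'A hx)
  have hxE : insert x ((S i).C ∪ (A' \ {x}) ∪ (S i).C) ⊆ (S i).D := by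
    refine Set.insert_subset ((S i).A_subset_D (hA'A hx)) (Set.union_subset ?_ hCD)
    exact (Set.union_subset_union_right _ Set.sdiff_subset).trans hE
  have hyρ := fun (n : ℕ) => H.parity_of_anti_B (n := n) hyB hyN hb
  have hzρ := fun (n : ℕ) => H.symm.parity_of_anti_B (n := n) hzB hzN hb
  -- The path from `y` via `x` and its rung to `b` would have parity `r` instead of `r + 1`, so it
  -- is not induced and `x` can be bypassed. The same happens for `z`, because `k` is odd.
  obtain ⟨k₁, hU1⟩ : ∃ k, PathIn G (S i).C y b k := by
    rcases hT1.concat_or hq hyb with ⟨k, hk⟩ | h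
    · exact ⟨k, hk.mono (by rw [Set.union_self])⟩
    · have := hyρ _ (h.mono hxC)
      omega
  obtain ⟨k₂, hU2⟩ : ∃ k, PathIn G ((S i).C ∪ (A' \ {x})) z b k := by
    rcases hT2.symm.concat_or hq hzb with ⟨k, hk⟩ | h
    · exact ⟨k, hk.mono (Set.union_subset subset_rfl Set.subset_union_left)⟩
    · have := hzρ _ (h.mono hxE)
      omega
  have hab := H.antiB i a rfl b hb
  -- The first neighbour `t` of `a` on the way from `b` to `z` is `z` or lies in `A'`; in both cases
  -- the part from `b` to `t` has parity `r + 1`, just as the path from `y` to `b`.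
  obtain ⟨t, m', k', -, hat, h1, h2, -, h4⟩ := hU2.symm.exists_split (G.Adj a ·) H.hz.adj
  have h1' : PathIn G (S i).C b t m' := h1.mono (by
    rintro v ⟨hv | hv, hv'⟩
    · exact hv
    · exact absurd (H.adjA i v (hA'A hv.1)) hv')
  have hbt : b ≠ t := by
    rintro rfl
    exact hab.2 hat
  have hm' := h1.pos_of_ne hbt
  have ht : t = z ∨ t ∈ A' \ {x} := by
    rcases Nat.eq_zero_or_pos k' with h | h
    · subst h
      obtain ⟨f, -, h5, h6, -⟩ := h2
      exact Or.inl (h5.symm.trans h6)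
    · rcases h4 hm' h with h5 | h5
      · exact absurd hat (haC a rfl t h5).2
      · exact Or.inr h5
  have hyt : y ≠ t := by
    rcases ht with rfl | ht
    · exact H.ne
    · rintro rfl
      exact H.hy.notMem_A i (hA'A ht.1)
  have hpar : m' % 2 = (r + 1) % 2 := by
    rcases ht with rfl | ht
    · exact hzρ _ (h1'.symm.mono hCD)
    · have := H.toCore.rung_parity (hA'A ht.1) hb h1'.symm
      omega
  have hpar' := hyρ _ (hU1.mono hCD)
  rcases hU1.concat_or h1' hyt with ⟨k, hk⟩ | h
  · rcases ht with rfl | ht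
    · exact hnoC _ (hk.mono (by rw [Set.union_self]))
    · obtain ⟨s, hs⟩ := hk.trans (h2.mono (Set.sep_subset _ _)) H.ne
      refine hno s (hs.mono (Set.insert_subset (Or.inr ht) ?_))
      rw [Set.union_self, ← Set.union_assoc, Set.union_self]
  · have := odd_of_anti_apex H.free H.hy.adj hat hyt (by grind [Anti]) h
    omega

end OneCommon

end EvenHoles

/-! ### Building pyramids from paths. -/

namespace EvenHoles

variable {V : Type*} {G : SimpleGraph V}

theorem IsInducedPath.mem_edges {u v x y : V} {p : G.Walk u v} (hp : IsInducedPath p)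
    (hx : x ∈ p.support) (hy : y ∈ p.support) (h : G.Adj x y) : s(x, y) ∈ p.edges :=
  hp.isChordless.mem_edges hx hy h

theorem exists_isPyramid {a : V} {b : Fin 3 → V} {T : Fin 3 → Set V} {n : Fin 3 → ℕ}
    (hab : ∀ i, a ≠ b i) (hb : ∀ i j, i ≠ j → G.Adj (b i) (b j))
    (h : ∀ i, PathIn G (T i) a (b i) (n i)) (hT : ∀ i j, i ≠ j → Anti G (T i) (insert (b j) (T j)))
    (h2 : ∃ i j, i ≠ j ∧ 2 ≤ n i ∧ 2 ≤ n j) :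
    ∃ R : ∀ i, G.Walk a (b i), IsPyramid a b R ∧ ∀ i, (R i).length = n i := by
  choose R hR1 hR2 hR3 using fun i => (h i).exists_walk
  have ha : ∀ i, a ∈ (R i).support := fun i => (R i).start_mem_support
  have key : ∀ i j, i ≠ j → ∀ x ∈ (R i).support, ∀ y ∈ (R j).support, x = a ∨ y = a ∨
      (x ∈ Set.range b ∧ y ∈ Set.range b ∧ x ≠ y) ∨ (x ≠ y ∧ ¬ G.Adj x y) := by
    intro i j hij x hx y hy
    rcases hR3 i x hx with rfl | rfl | hx
    · exact Or.inl rfl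
    · rcases hR3 j y hy with rfl | rfl | hy
      · exact Or.inr (Or.inl rfl)
      · exact Or.inr (Or.inr (Or.inl ⟨⟨i, rfl⟩, ⟨j, rfl⟩, (hb i j hij).ne⟩))
      · exact Or.inr (Or.inr (Or.inr ((hT j i hij.symm).symm _ (Or.inl rfl) _ hy)))
    · rcases hR3 j y hy with rfl | hy
      · exact Or.inr (Or.inl rfl)
      · exact Or.inr (Or.inr (Or.inr (hT i j hij _ hx _ hy)))
  refine ⟨R, ⟨hab, hb, fun i => (hR2 i).isPath, ?_, ?_, ?_⟩, hR1⟩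
  · intro i j hij x hx hx'
    rcases key i j hij x hx x hx' with h | h | h | h
    · exact h
    · exact h
    · exact absurd rfl h.2.2
    · exact absurd rfl h.1
  · obtain ⟨i, j, hij, h⟩ := h2
    exact ⟨i, j, hij, by rwa [hR1, hR1]⟩
  · rintro x y ⟨i, hx⟩ ⟨j, hy⟩ hxy
    by_cases hij : i = j
    · subst hij
      exact Or.inl ⟨i, (hR2 i).mem_edges hx hy hxy⟩
    · rcases key i j hij x hx y hy with rfl | rfl | h | h
      · exact Or.inl ⟨j, (hR2 j).mem_edges (ha j) hy hxy⟩
      · exact Or.inl ⟨i, (hR2 i).mem_edges hx (ha i) hxy⟩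
      · exact Or.inr ⟨h.1, h.2.1⟩
      · exact absurd hxy h.2

/-- The base is `{z, b, c}` and the short path is the edge `a z`. -/
theorem hasShortPyramid {a z b c : V} {T U : Set V} {m n : ℕ} (haz : G.Adj a z) (hzb : G.Adj z b)
    (hzc : G.Adj z c) (hbc : G.Adj b c) (hm : PathIn G T a b m) (hn : PathIn G U a c n)
    (hm2 : 2 ≤ m) (hn2 : 2 ≤ n) (hTU : Anti G T (insert c U)) (hUb : Anti G U {b})
    (hz : Anti G {z} (T ∪ U)) : HasShortPyramid G a := by
  obtain ⟨R, hR, hlen⟩ := exists_isPyramid (G := G) (a := a) (b := ![z, b, c]) (T := ![∅, T, U])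
    (n := ![1, m, n]) (by
      have := hm.ne_of_pos (by omega)
      have := hn.ne_of_pos (by omega)
      simp [Fin.forall_fin_succ, *, haz.ne])
    (by simp [Fin.forall_fin_succ, hzb, hzc, hbc, hzb.symm, hzc.symm, hbc.symm])
    (by simp [Fin.forall_fin_succ, hm, hn, PathIn.of_adj, haz])
    (by
      intro i j hij
      fin_cases i <;> fin_cases j <;> simp at hij ⊢ <;> grind [Anti, SimpleGraph.adj_comm])
    ⟨1, 2, by decide, by simpa using hm2, by simpa using hn2⟩
  exact ⟨_, R, hR, 0, by simpa using hlen 0⟩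

end EvenHoles

/-! ### The short pyramid case, and adjacency of all outer vertices. -/

namespace EvenHoles

variable {V : Type*} {G : SimpleGraph V}

namespace OneCommon

variable {a : V} {ι : Type*} {S : ι → Triple V} {R : Set V} {r : ℕ} {y z : V} {i j l : ι}

/-- Here `r` is odd, so `y` reaches `c` through `D j` by an even path, and one more edge leads to
`z`. -/
theorem even_of_anti_of_adj (H : OneCommon G a S R r y z i j l) (hyB : Anti G {y} (S l).B)
    (hyN : ∃ q, Att G y ((S q).B ∪ (S q).C)) {c : V} (hc : c ∈ (S j).B) (hzc : G.Adj z c)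
    {t : ℕ} (hT : PathIn G (S i).D y z t) : t % 2 = 0 := by
  have hr := H.symm.odd_of_adj_B hc hzc
  obtain ⟨m, hm⟩ := (H.conn j).exists_pathIn H.yj (H.att_B hc)
  have h1 := H.parity_of_anti_B hyB hyN hc hm
  have hyc := H.symm.no_common hc hzc
  have hnec := H.hy.ne_of_mem_B H.toFrame hc
  have hzD := H.z_anti.symm
  have hne := H.ne
  have hnadj := H.nadj
  have h2 := hm.snoc hzc.symm (by grind [Anti]) (hm.pos_of_ne hnec)
  have := hT.odd_add H.free h2 H.ne H.nadj (H.symm.anti_insert hc)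
  omega

/-- Otherwise the path from `y` to `b` continued by `b c z` is even and avoids the neighbours of `a`
in its interior; a neighbour of `z` on the way would join `y` and `z` inside `C i`. -/
theorem adj_of_path_C (H : OneCommon G a S R r y z i j l)
    (hno : ∀ t, ¬ PathIn G (S i).C y z t) {b c : V} (hb : b ∈ (S i).B) (hc : c ∈ (S j).B)
    (hzc : G.Adj z c) {n : ℕ} (hn : PathIn G (S i).C y b n) (hpar : n % 2 = 0) : G.Adj z b := by
  have hF := H.toFrame
  by_contra hzb
  have hyb := H.hy.ne_of_mem_B hF hb
  rcases hn.symm.nonadj_or (hn.pos_of_ne hyb) z with ⟨h, -⟩ | ⟨m, hm⟩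
  · have hzb' := H.hz.ne_of_mem_B hF hb
    have hzC : z ∉ (S i).C := fun h => H.hz.notMem_D hF i (Or.inr h)
    have hyc := H.symm.no_common hc hzc
    have hyc' := H.hy.ne_of_mem_B hF hc
    have h1 := hF.path_across H.ne H.nadj H.ij ((Set.sep_subset _ _).trans (S i).C_subset_D)
      (Set.empty_subset (S j).D) hb hc h.symm (PathIn.of_adj ∅ hzc) hyb
      (H.hz.ne_of_mem_B hF hc) (by grind [Anti]) (by grind [Anti])
    have haC := H.antiC i
    have hab := H.antiB i a rfl b hb
    have hac := H.antiB j a rfl c hc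
    have := odd_of_anti_apex H.free H.hy.adj H.hz.adj H.ne (by grind [Anti]) h1
    omega
  · exact hno _ hm.symm

/-- The vertex `z` sees some `b` in `B i` and `c` in `B j`. If `z` misses a rung from `x` to `b`,
the arms to `b` and `c` and the edge `a z` form a short pyramid. Otherwise that rung is separated
from a path from `y` to `b` inside `C i`, and both are even, which gives an even hole with or
without the detour `y a x`. -/
theorem false_of_anti_of_adj (H : OneCommon G a S R r y z i j l) (hns : ¬ HasShortPyramid G a)
    (hyB : Anti G {y} (S l).B) (hyN : ∃ q, Att G y ((S q).B ∪ (S q).C)) {c : V}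
    (hc : c ∈ (S j).B) (hzc : G.Adj z c) : False := by
  have hF := H.toFrame
  have hCD := (S i).C_subset_D
  have haC := H.antiC i
  have hr := H.symm.odd_of_adj_B hc hzc
  have hno : ∀ t, ¬ PathIn G (S i).C y z t := by
    intro t hT
    have := odd_of_anti_apex H.free H.hy.adj H.hz.adj H.ne haC hT
    have := H.even_of_anti_of_adj hyB hyN hc hzc (hT.mono hCD)
    omega
  obtain ⟨b, hb, n, hY⟩ := H.exists_path_C hyB hyN H.yi
  have hn := H.parity_of_anti_B hyB hyN hb (hY.mono hCD)
  have hzb := H.adj_of_path_C hno hb hc hzc hY (by omega)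
  have hyb := H.symm.no_common hb hzb
  have hyb' := H.hy.ne_of_mem_B hF hb
  have hab := H.antiB i a rfl b hb
  have hac := H.antiB j a rfl c hc
  obtain ⟨x, hx, l', hl⟩ := H.rungB i b hb
  have hlr := H.toCore.rung_parity hx hb hl
  obtain ⟨hl0, -⟩ := H.arm_of_rung hx hb hl
  have hax := H.adjA i x hx
  have hzx : z ≠ x := by
    rintro rfl
    exact H.hz.notMem_A i hx
  have hyx : y ≠ x := by
    rintro rfl
    exact H.hy.notMem_A i hx
  obtain ⟨I, hIC, hI, hIc, hIx, hIb⟩ := hl.exists_interior (by omega)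
  obtain ⟨hxb, hxb'⟩ : x ≠ b ∧ ¬ G.Adj x b := by
    refine ⟨hI.ne_of_pos hl0, fun h => ?_⟩
    have := hI.eq_one_of_adj h
    omega
  have harm := PathIn.cons hax hI (by grind [Anti]) hl0
  have hzC : z ∉ (S i).C := fun h => H.hz.notMem_D hF i (Or.inr h)
  have hyC : y ∉ (S i).C := fun h => H.hy.notMem_D hF i (Or.inr h)
  by_cases hzI : Att G z I
  · obtain ⟨J, hJC, hJ, hJc, hJy, hJb⟩ := hY.exists_interior (hY.two_le hyb' hyb)
    -- Any contact would connect `y` to `z` inside `C i`.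
    have hJI : Anti G (insert y J) I := by
      by_contra hanti
      have hc : ConnectedSet G (insert y J ∪ I) := by
        rw [Anti] at hanti
        push Not at hanti
        obtain ⟨s, hs, t, ht, hst⟩ := hanti
        by_cases h : s = t
        · subst h
          exact (hJc.insert hJy).union_of_inter hIc hs ht
        · exact (hJc.insert hJy).union_of_adj hIc hs ht (hst h)
      obtain ⟨k, hk⟩ := (hc.insert (hzI.mono Set.subset_union_right)).exists_pathIn_mem
        (u := y) (v := z) (by simp) (by simp)
      exact hno k (hk.diff.mono (by grind))
    have hyx' : ¬ G.Adj y x := by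
      intro h
      have h1 := PathIn.cons h hI (by grind [Anti]) hl0
      have := H.parity_of_anti_B hyB hyN hb (h1.mono
        ((Set.insert_subset_insert hIC).trans (Triple.insert_subset_D hx)))
      omega
    by_cases hxJ : Att G x J
    · obtain ⟨k, hk⟩ := hJc.exists_pathIn hxJ hJb
      have h1 := H.toCore.rung_parity hx hb (hk.mono hJC)
      have h2 := hI.odd_add H.free hk hxb hxb'
        (hJI.symm.mono subset_rfl (Set.subset_insert _ _))
      omega
    · have hxC : x ∉ (S i).C := fun h => (haC a rfl x h).2 hax
      have h1 := PathIn.cons H.hy.adj.symm harm (by grind [Anti]) (by omega)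
      have h2 := hJ.odd_add H.free h1 hyb' hyb (by
        have h3 : Anti G J {a} := (haC.mono subset_rfl hJC).symm
        have h4 : ∀ s ∈ J, s ≠ x ∧ ¬ G.Adj s x := fun s hs =>
          ⟨fun h => hxC (h ▸ hJC hs), fun h => hxJ ⟨s, hs, h.symm⟩⟩
        clear haC hno
        grind [Anti])
      omega
  · have hzI' : Anti G {z} I := by
      rintro _ rfl s hs
      exact ⟨fun h => hzC (h ▸ hIC hs), fun h => hzI ⟨s, hs, h⟩⟩
    have hzx' : ¬ G.Adj z x := by
      intro h
      have h1 := PathIn.cons h.symm (PathIn.of_adj ∅ hzb) (by grind [Anti]) one_pos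
      have := hI.odd_add H.free h1 hxb hxb' (by grind [Anti, SimpleGraph.adj_comm])
      omega
    obtain ⟨k, hk⟩ := H.exists_arm hc
    have hxI : insert x I ⊆ (S i).D :=
      (Set.insert_subset_insert hIC).trans (Triple.insert_subset_D hx)
    refine hns (hasShortPyramid H.hz.adj hzb hzc (H.adjB i j H.ij b hb c hc) harm hk (by omega)
      (hk.two_le hac.1 hac.2) ?_ ?_ ?_)
    · exact (H.symm.anti_insert hc).mono hxI subset_rfl
    · exact (H.antiDB j i H.ij.symm).mono subset_rfl (Set.singleton_subset_iff.2 hb)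
    · have := H.z_anti
      clear hno haC
      grind [Anti]

end OneCommon

section

variable {a : V} {ι : Type*} {S : ι → Triple V} {R : Set V} {r : ℕ} {y z : V}

theorem OneCommon.false [Finite V] {i j l : ι} (H : OneCommon G a S R r y z i j l)
    (hns : ¬ HasShortPyramid G a) : False := by
  have hF := H.toFrame
  have hB : ∀ {v : V}, Outer G a S R v → ∀ q, (∃ b ∈ (S q).B, G.Adj v b) ∨ Anti G {v} (S q).B := by
    intro v hv q
    by_cases h : ∃ b ∈ (S q).B, G.Adj v b
    · exact Or.inl h
    · refine Or.inr ?_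
      rintro _ rfl b hb
      exact ⟨hv.ne_of_mem_B hF hb, fun h' => h ⟨b, hb, h'⟩⟩
  rcases H.hz.rtype_or hF with hzR | hzN
  · rcases H.hy.rtype_or hF with hyR | hyN
    · exact H.false_of_rtype_of_rtype hyR hzR
    · rcases hB H.hy l with ⟨b, hb, hyb⟩ | hyB
      · exact H.false_of_rtype_of_adj hzR hb hyb
      · exact H.false_of_rtype_of_anti hzR hyB hyN
  · rcases H.hy.rtype_or hF with hyR | hyN
    · rcases hB H.hz j with ⟨b, hb, hzb⟩ | hzB
      · exact H.symm.false_of_rtype_of_adj hyR hb hzb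
      · exact H.symm.false_of_rtype_of_anti hyR hzB hzN
    · rcases hB H.hy l with ⟨b, hb, hyb⟩ | hyB
      · rcases hB H.hz j with ⟨c, hc, hzc⟩ | hzB
        · exact H.false_of_adj_of_adj hb hyb hc hzc
        · exact H.symm.false_of_anti_of_adj hns hzB hzN hb hyb
      · rcases hB H.hz j with ⟨c, hc, hzc⟩ | hzB
        · exact H.false_of_anti_of_adj hns hyB hyN hc hzc
        · exact H.false_of_anti_of_anti hyB hzB hyN hzN

/-- Any two outer vertices are equal or adjacent. -/
theorem Core.adj_of_outer [Finite V] (hG : EvenHoleFree G) (hns : ¬ HasShortPyramid G a)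
    (K : Core G a S R r) (hy : Outer G a S R y) (hz : Outer G a S R z) (hyz : y ≠ z) :
    G.Adj y z := by
  by_contra hadj
  obtain ⟨i₀, -⟩ := hy.far.elim (fun ⟨i, _⟩ => ⟨i, trivial⟩) (fun ⟨s, hs, _⟩ =>
    (K.reachR s hs).elim fun i _ => (⟨i, trivial⟩ : ∃ _ : ι, True))
  have htwo : ∀ i j, i ≠ j → Att G y (S i).D → Att G z (S i).D → Att G y (S j).D →
      Att G z (S j).D → False := fun i j hij h1 h2 h3 h4 =>
    K.not_two_common hG hy hz hyz hadj hij h1 h3 h2 h4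
  obtain ⟨i₁, h1, -⟩ := K.three i₀ i₀
  obtain ⟨i₂, h2, h3⟩ := K.three i₀ i₁
  -- Among any three strips each vertex misses at most one and they share at most one, so they miss
  -- different ones.
  have key : ∃ i j l, i ≠ j ∧ i ≠ l ∧ j ≠ l ∧ Att G y (S i).D ∧ Att G y (S j).D ∧
      ¬ Att G y (S l).D ∧ Att G z (S i).D ∧ ¬ Att G z (S j).D ∧ Att G z (S l).D := by
    have a1 := hy.miss i₀ i₁ h1.symm
    have a2 := hy.miss i₀ i₂ h2.symm
    have a3 := hy.miss i₁ i₂ h3.symm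
    have a4 := hz.miss i₀ i₁ h1.symm
    have a5 := hz.miss i₀ i₂ h2.symm
    have a6 := hz.miss i₁ i₂ h3.symm
    have b1 := htwo i₀ i₁ h1.symm
    have b2 := htwo i₀ i₂ h2.symm
    have b3 := htwo i₁ i₂ h3.symm
    by_contra hcon
    push Not at hcon
    have c1 := hcon i₀ i₁ i₂ h1.symm h2.symm h3.symm
    have c2 := hcon i₀ i₂ i₁ h2.symm h1.symm h3
    have c3 := hcon i₁ i₀ i₂ h1 h3.symm h2.symm
    have c4 := hcon i₁ i₂ i₀ h3.symm h1 h2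
    have c5 := hcon i₂ i₀ i₁ h2 h3 h1.symm
    have c6 := hcon i₂ i₁ i₀ h3 h2 h1
    clear hcon htwo
    grind
  obtain ⟨i, j, l, hij, hil, hjl, yi, yj, yl, zi, zj, zl⟩ := key
  refine OneCommon.false (i := i) (j := j) (l := l) { K with
    free := hG, hy := hy, hz := hz, ne := hyz, nadj := hadj, ij := hij, il := hil, jl := hjl
    yi := yi, yj := yj, yl := yl, zi := zi, zj := zj, zl := zl
    all := ?_ } hns
  intro q
  by_contra hq
  push Not at hq
  obtain ⟨hqi, hqj, hql⟩ := hq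
  exact htwo i q hqi.symm yi zi ((hy.miss q l hql).resolve_right yl)
    ((hz.miss q j hqj).resolve_right zj)

end

end EvenHoles

/-! ### Merging several strips and a path into one strip. -/

namespace EvenHoles

variable {V : Type*} {G : SimpleGraph V}

/-- Lets the merged system be described over an `Option` type, with `none` for the merged strip. -/
theorem IsIndecomposableSystem.of_equiv {a : V} {ι : Type*} {k : ℕ} (e : Fin k ≃ ι)
    (T : ι → Triple V) (hk : 3 ≤ k) (proper : ∀ i, IsProperStrip G (T i))
    (disjoint : ∀ i j, i ≠ j → Disjoint (T i).verts (T j).verts)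
    (complete : ∀ i j, i ≠ j → ∀ x ∈ (T i).B, ∀ y ∈ (T j).B, G.Adj x y)
    (no_other : ∀ i j, i ≠ j → ∀ x ∈ (T i).verts, ∀ y ∈ (T j).verts,
      G.Adj x y → x ∈ (T i).B ∧ y ∈ (T j).B)
    (apex_notMem : ∀ i, a ∉ (T i).verts) (apex_complete : ∀ i, ∀ x ∈ (T i).A, G.Adj a x)
    (apex_anti : ∀ i, ∀ x ∈ (T i).B ∪ (T i).C, ¬ G.Adj a x)
    (connected : ∀ i, ConnectedSet G (T i).D) :
    IsIndecomposableSystem G a (T ∘ e) where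
  three_le := hk
  proper _ := proper _
  disjoint _ _ hij := disjoint _ _ (e.injective.ne hij)
  complete _ _ hij := complete _ _ (e.injective.ne hij)
  no_other_edges _ _ hij := no_other _ _ (e.injective.ne hij)
  apex_notMem _ := apex_notMem _
  apex_complete _ := apex_complete _
  apex_anticomplete _ := apex_anti _
  connected _ := connected _

/-- The strip obtained from the strips `S j` with `j ∈ J` and the path `f 0, …, f n`. -/
def mergedStrip {ι : Type*} (S : ι → Triple V) (J : Set ι) (f : ℕ → V) (n : ℕ) : Triple V where
  A := {x | x = f 0 ∨ ∃ j ∈ J, x ∈ (S j).A}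
  B := {x | x = f n ∨ ∃ j ∈ J, x ∈ (S j).B}
  C := {x | (∃ m, 0 < m ∧ m < n ∧ f m = x) ∨ ∃ j ∈ J, x ∈ (S j).C}

theorem mem_mergedStrip_verts {ι : Type*} {S : ι → Triple V} {J : Set ι} {f : ℕ → V} {n : ℕ}
    {x : V} : x ∈ (mergedStrip S J f n).verts ↔
      (∃ m ≤ n, f m = x) ∨ ∃ j ∈ J, x ∈ (S j).verts := by
  simp only [Triple.verts, mergedStrip, Set.mem_union, Set.mem_ofPred_eq]
  constructor
  · rintro (((rfl | h) | (rfl | h)) | (⟨m, -, h, rfl⟩ | h))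
    · exact Or.inl ⟨0, by omega, rfl⟩
    · obtain ⟨j, hj, h⟩ := h
      exact Or.inr ⟨j, hj, by tauto⟩
    · exact Or.inl ⟨n, by omega, rfl⟩
    · obtain ⟨j, hj, h⟩ := h
      exact Or.inr ⟨j, hj, by tauto⟩
    · exact Or.inl ⟨m, by omega, rfl⟩
    · obtain ⟨j, hj, h⟩ := h
      exact Or.inr ⟨j, hj, by tauto⟩
  · rintro (⟨m, hm, rfl⟩ | ⟨j, hj, (h | h) | h⟩)
    · rcases Nat.eq_zero_or_pos m with rfl | h0
      · tauto
      · rcases hm.lt_or_eq with h1 | rfl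
        · exact Or.inr (Or.inl ⟨m, h0, h1, rfl⟩)
        · tauto
    · exact Or.inl (Or.inl (Or.inr ⟨j, hj, h⟩))
    · exact Or.inl (Or.inr (Or.inr ⟨j, hj, h⟩))
    · exact Or.inr (Or.inr ⟨j, hj, h⟩)

/-- The path itself is one rung and the old rungs remain rungs; the exclusions only prevent a vertex
of the path from receiving two roles. -/
theorem IsProperStrip.merged {ι : Type*} {S : ι → Triple V} (hS : ∀ j, IsProperStrip G (S j))
    (hdisj : ∀ i j, i ≠ j → Disjoint (S i).verts (S j).verts) {J : Set ι} {f : ℕ → V} {n : ℕ}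
    (hf : IndSeq G f n) (hn : 0 < n) (h0 : ∀ j ∈ J, f 0 ∉ (S j).B ∪ (S j).C)
    (h1 : ∀ j ∈ J, f n ∉ (S j).A ∪ (S j).C)
    (h2 : ∀ m, 0 < m → m < n → ∀ j ∈ J, f m ∉ (S j).A ∪ (S j).B) :
    IsProperStrip G (mergedStrip S J f n) := by
  have hAB : ∀ i j x, x ∈ (S i).A → x ∉ (S j).B := by
    intro i j x hx hx'
    by_cases hij : i = j
    · subst hij
      exact (Set.disjoint_left.1 (hS i).disjoint_AB) hx hx'
    · exact Set.disjoint_left.1 (hdisj i j hij) (Or.inl (Or.inl hx)) (Or.inl (Or.inr hx'))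
  have hAC : ∀ i j x, x ∈ (S i).A → x ∉ (S j).C := by
    intro i j x hx hx'
    by_cases hij : i = j
    · subst hij
      exact (Set.disjoint_left.1 (hS i).disjoint_AC) hx hx'
    · exact Set.disjoint_left.1 (hdisj i j hij) (Or.inl (Or.inl hx)) (Or.inr hx')
  have hBC : ∀ i j x, x ∈ (S i).B → x ∉ (S j).C := by
    intro i j x hx hx'
    by_cases hij : i = j
    · subst hij
      exact (Set.disjoint_left.1 (hS i).disjoint_BC) hx hx'
    · exact Set.disjoint_left.1 (hdisj i j hij) (Or.inl (Or.inr hx)) (Or.inr hx')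
  have hne0 : ∀ m, 0 < m → m ≤ n → f 0 ≠ f m := fun m h1 h2 => hf.inj 0 m h1 h2
  have hnen : ∀ m, m < n → f m ≠ f n := fun m h1 => hf.inj m n h1 le_rfl
  have hAB' : ∀ x, x ∈ (mergedStrip S J f n).A → x ∉ (mergedStrip S J f n).B := by
    rintro x (rfl | ⟨j, hj, hx⟩) (h | ⟨i, hi, h⟩)
    · exact hne0 n hn le_rfl h
    · exact h0 i hi (Or.inl h)
    · exact h1 j hj (Or.inl (h ▸ hx))
    · exact hAB j i x hx h
  refine ⟨⟨⟨f 0, Or.inl rfl⟩, ⟨f n, Or.inl rfl⟩, ?_, ?_, ?_⟩, Set.disjoint_left.2 hAB'⟩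
  · refine Set.disjoint_left.2 ?_
    rintro x (rfl | ⟨j, hj, hx⟩) (⟨m, h3, h4, h⟩ | ⟨i, hi, h⟩)
    · exact hne0 m h3 h4.le h.symm
    · exact h0 i hi (Or.inr h)
    · exact h2 m h3 h4 j hj (Or.inl (h ▸ hx))
    · exact hAC j i x hx h
  · refine Set.disjoint_left.2 ?_
    rintro x (rfl | ⟨j, hj, hx⟩) (⟨m, h3, h4, h⟩ | ⟨i, hi, h⟩)
    · exact hnen m h4 h
    · exact h1 i hi (Or.inr h)
    · exact h2 m h3 h4 j hj (Or.inr (h ▸ hx))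
    · exact hBC j i x hx h
  · intro x hx
    rcases mem_mergedStrip_verts.1 hx with ⟨m, hm, rfl⟩ | ⟨j, hj, hx⟩
    · obtain ⟨p, hp, hind, hsupp⟩ := hf.exists_walk
      refine ⟨f 0, f n, p, ⟨hind, Or.inl rfl, Or.inl rfl, ?_, fun _ => ⟨hAB' _ (Or.inl rfl),
        fun h => hAB' _ h (Or.inl rfl)⟩⟩, (hsupp _).2 ⟨m, hm, rfl⟩⟩
      rintro x ⟨h, hx0, hxn⟩
      obtain ⟨i, hi, rfl⟩ := (hsupp x).1 h
      refine Or.inl ⟨i, Nat.pos_of_ne_zero ?_, lt_of_le_of_ne hi ?_, rfl⟩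
      · rintro rfl
        exact hx0 rfl
      · rintro rfl
        exact hxn rfl
    · obtain ⟨u, v, p, hp, hxp⟩ := (hS j).mem_rung x hx
      have hu : u ∈ (mergedStrip S J f n).A := Or.inr ⟨j, hj, hp.left_mem⟩
      have hv : v ∈ (mergedStrip S J f n).B := Or.inr ⟨j, hj, hp.right_mem⟩
      exact ⟨u, v, p, ⟨hp.isInducedPath, hu, hv,
        fun y hy => Or.inr ⟨j, hj, hp.interior_mem y hy⟩,
        fun _ => ⟨hAB' u hu, fun h => hAB' v h hv⟩⟩, hxp⟩

end EvenHoles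

/-! ### The contradiction to maximality. -/

namespace EvenHoles

variable {V : Type*} {G : SimpleGraph V}

theorem ConnectedSet.of_patches {X s : Set V} (hX : ConnectedSet G X) (hXs : X ⊆ s)
    (h : ∀ v ∈ s, ∃ F ⊆ s, ConnectedSet G F ∧ v ∈ F ∧ ∃ x ∈ X, x ∈ F) : ConnectedSet G s := by
  obtain ⟨u, hu⟩ := hX.nonempty
  refine SimpleGraph.induce_connected_of_patches u (hXs hu) fun {v} hv => ?_
  obtain ⟨F, hF, hFc, hvF, x, hx, hxF⟩ := h v hv
  exact ⟨X ∪ F, Set.union_subset hXs hF, Or.inl hu, Or.inr hvF,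
    (hX.union_of_inter hFc hx hxF).preconnected _ _⟩

variable {a : V} {k : ℕ} {S : Fin k → Triple V}

/-- Replacing the strips in `J` by their merger with the path gives an indecomposable system with at
least three strips, containing the old one and a new vertex. Every merged strip must touch the path
before `f n`, because `f n` goes to `B` and cannot help to connect `A ∪ C`. -/
theorem IsMaximalSystem.false_of_merge (hS : IsMaximalSystem G a S) {J : Set (Fin k)}
    {i₁ i₂ : Fin k} (hi : i₁ ≠ i₂) (hi₁ : i₁ ∉ J) (hi₂ : i₂ ∉ J) {f : ℕ → V} {n : ℕ}
    (hf : IndSeq G f n) (hn : 0 < n) (hau : G.Adj a (f 0))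
    (ha : ∀ m, 0 < m → m ≤ n → a ≠ f m ∧ ¬ G.Adj a (f m))
    (h0 : ∀ j ∈ J, f 0 ∉ (S j).B ∪ (S j).C) (h1 : ∀ j ∈ J, f n ∉ (S j).A ∪ (S j).C)
    (h2 : ∀ m, 0 < m → m < n → ∀ j ∈ J, f m ∉ (S j).A ∪ (S j).B)
    (hdisj : ∀ m ≤ n, ∀ j ∉ J, f m ∉ (S j).verts)
    (hanti : ∀ m < n, ∀ j ∉ J, ∀ x ∈ (S j).verts, ¬ G.Adj (f m) x)
    (hB : ∀ j ∉ J, ∀ x ∈ (S j).B, G.Adj (f n) x) (hD : ∀ j ∉ J, ∀ x ∈ (S j).D, ¬ G.Adj (f n) x)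
    (hatt : ∀ j ∈ J, ∃ m < n, f m ∈ (S j).D ∨ Att G (f m) (S j).D)
    (hnew : ∃ m ≤ n, ∀ j, f m ∉ (S j).verts) : False := by
  have hI := hS.indecomposable
  let T : Option {j // j ∉ J} → Triple V := fun o => o.elim (mergedStrip S J f n) fun j => S j
  have hcard : 3 ≤ Nat.card (Option {j // j ∉ J}) := by
    have h : 2 ≤ Nat.card {j // j ∉ J} := by
      have : Nontrivial {j // j ∉ J} := ⟨⟨i₁, hi₁⟩, ⟨i₂, hi₂⟩, by simpa using hi⟩
      exact Finite.one_lt_card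
    rw [Finite.card_option]
    omega
  have hdisjoint : ∀ j : {j // j ∉ J}, ∀ x ∈ (mergedStrip S J f n).verts, x ∉ (S j).verts := by
    rintro ⟨j, hj⟩ x hx
    rcases mem_mergedStrip_verts.1 hx with ⟨m, hm, rfl⟩ | ⟨i, hi, hx⟩
    · exact hdisj m hm j hj
    · refine Set.disjoint_left.1 (hI.disjoint i j ?_) hx
      rintro rfl
      exact hj hi
  have hcomplete : ∀ j : {j // j ∉ J}, ∀ x ∈ (mergedStrip S J f n).B, ∀ y ∈ (S j).B,
      G.Adj x y := by
    rintro ⟨j, hj⟩ x (rfl | ⟨i, hi, hx⟩) y hy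
    · exact hB j hj y hy
    · refine hI.complete i j ?_ x hx y hy
      rintro rfl
      exact hj hi
  have hno : ∀ j : {j // j ∉ J}, ∀ x ∈ (mergedStrip S J f n).verts, ∀ y ∈ (S j).verts,
      G.Adj x y → x ∈ (mergedStrip S J f n).B ∧ y ∈ (S j).B := by
    rintro ⟨j, hj⟩ x hx y hy hxy
    rcases mem_mergedStrip_verts.1 hx with ⟨m, hm, rfl⟩ | ⟨i, hi, hx⟩
    · rcases hm.lt_or_eq with hm | rfl
      · exact absurd hxy (hanti m hm j hj y hy)
      · refine ⟨Or.inl rfl, ?_⟩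
        rcases hy with (h | h) | h
        · exact absurd hxy (hD j hj y (Or.inl h))
        · exact h
        · exact absurd hxy (hD j hj y (Or.inr h))
    · have hij : i ≠ j := by
        rintro rfl
        exact hj hi
      have := hI.no_other_edges i j hij x hx y hy hxy
      exact ⟨Or.inr ⟨i, hi, this.1⟩, this.2⟩
  have hsys := IsIndecomposableSystem.of_equiv (G := G) (a := a)
    (Finite.equivFin (Option {j // j ∉ J})).symm T hcard ?_ ?_ ?_ ?_ ?_ ?_ ?_ ?_
  · obtain ⟨m, hm, hfm⟩ := hnew
    have hmem : f m ∈ systemVerts a S := by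
      rw [← hS.maximal _ _ hsys ?_]
      · refine Or.inl (Set.mem_iUnion.2 ⟨Finite.equivFin _ none, ?_⟩)
        simpa [T] using mem_mergedStrip_verts.2 (Or.inl ⟨m, hm, rfl⟩)
      · rintro x (hx | hx)
        · obtain ⟨j, hj⟩ := Set.mem_iUnion.1 hx
          by_cases hjJ : j ∈ J
          · refine Or.inl (Set.mem_iUnion.2 ⟨Finite.equivFin _ none, ?_⟩)
            simpa [T] using mem_mergedStrip_verts.2 (Or.inr ⟨j, hjJ, hj⟩)
          · refine Or.inl (Set.mem_iUnion.2 ⟨Finite.equivFin _ (some ⟨j, hjJ⟩), ?_⟩)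
            simpa [T] using hj
        · exact Or.inr hx
    rcases hmem with h | h
    · obtain ⟨j, hj⟩ := Set.mem_iUnion.1 h
      exact hfm j hj
    · rcases Nat.eq_zero_or_pos m with rfl | h3
      · exact hau.ne h.symm
      · exact (ha m h3 hm).1 h.symm
  · rintro (_ | j)
    · exact IsProperStrip.merged hI.proper hI.disjoint hf hn h0 h1 h2
    · exact hI.proper j
  · rintro (_ | i) (_ | j) hij
    · exact absurd rfl hij
    · exact Set.disjoint_left.2 (hdisjoint j)
    · exact (Set.disjoint_left.2 (hdisjoint i)).symm
    · exact hI.disjoint i j fun h => hij (congrArg some (Subtype.ext h))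
  · rintro (_ | i) (_ | j) hij x hx y hy
    · exact absurd rfl hij
    · exact hcomplete j x hx y hy
    · exact (hcomplete i y hy x hx).symm
    · exact hI.complete i j (fun h => hij (congrArg some (Subtype.ext h))) x hx y hy
  · rintro (_ | i) (_ | j) hij x hx y hy hxy
    · exact absurd rfl hij
    · exact hno j x hx y hy hxy
    · exact (hno i y hy x hx hxy.symm).symm
    · exact hI.no_other_edges i j (fun h => hij (congrArg some (Subtype.ext h))) x hx y hy hxy
  · rintro (_ | j)
    · intro h
      rcases mem_mergedStrip_verts.1 h with ⟨m, hm, h⟩ | ⟨i, hi, h⟩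
      · rcases Nat.eq_zero_or_pos m with rfl | h3
        · exact hau.ne h.symm
        · exact (ha m h3 hm).1 h.symm
      · exact hI.apex_notMem i h
    · exact hI.apex_notMem j
  · rintro (_ | j) x hx
    · rcases hx with rfl | ⟨i, hi, hx⟩
      · exact hau
      · exact hI.apex_complete i x hx
    · exact hI.apex_complete j x hx
  · rintro (_ | j) x hx
    · rcases hx with (rfl | ⟨i, hi, hx⟩) | (⟨m, h3, h4, rfl⟩ | ⟨i, hi, hx⟩)
      · exact (ha n hn le_rfl).2
      · exact hI.apex_anticomplete i x (Or.inl hx)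
      · exact (ha m h3 h4.le).2
      · exact hI.apex_anticomplete i x (Or.inr hx)
    · exact hI.apex_anticomplete j x hx
  · rintro (_ | j)
    · have hX := connectedSet_segment (G := G) (f := f) 0 (n - 1) fun j _ h => hf.adj j (by omega)
      have hXs : {x | ∃ j, 0 ≤ j ∧ j ≤ 0 + (n - 1) ∧ f j = x} ⊆ (mergedStrip S J f n).D := by
        rintro x ⟨m, -, hm, rfl⟩
        rcases Nat.eq_zero_or_pos m with rfl | h3
        · exact Or.inl (Or.inl rfl)
        · exact Or.inr (Or.inl ⟨m, h3, by omega, rfl⟩)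
      have hDs : ∀ j ∈ J, (S j).D ⊆ (mergedStrip S J f n).D := by
        rintro j hj x (hx | hx)
        · exact Or.inl (Or.inr ⟨j, hj, hx⟩)
        · exact Or.inr (Or.inr ⟨j, hj, hx⟩)
      refine hX.of_patches hXs fun v hv => ?_
      have hcase : (∃ j, 0 ≤ j ∧ j ≤ 0 + (n - 1) ∧ f j = v) ∨ ∃ j ∈ J, v ∈ (S j).D := by
        rcases hv with (rfl | ⟨i, hi, hx⟩) | (⟨m, h3, h4, rfl⟩ | ⟨i, hi, hx⟩)
        · exact Or.inl ⟨0, le_rfl, by omega, rfl⟩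
        · exact Or.inr ⟨i, hi, Or.inl hx⟩
        · exact Or.inl ⟨m, by omega, by omega, rfl⟩
        · exact Or.inr ⟨i, hi, Or.inr hx⟩
      rcases hcase with hv | ⟨j, hj, hv⟩
      · exact ⟨_, hXs, hX, hv, v, hv, hv⟩
      · obtain ⟨m, hm, h⟩ := hatt j hj
        have hmX : f m ∈ {x | ∃ j, 0 ≤ j ∧ j ≤ 0 + (n - 1) ∧ f j = x} :=
          ⟨m, by omega, by omega, rfl⟩
        rcases h with h | h
        · exact ⟨_, hDs j hj, hI.connected j, hv, f m, hmX, h⟩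
        · exact ⟨insert (f m) (S j).D, Set.insert_subset (hXs hmX) (hDs j hj),
            ConnectedSet.insert (hI.connected j) h, Or.inr hv, f m, hmX, Or.inl rfl⟩
    · exact hI.connected j

end EvenHoles

/-! ### Strip systems as frames; outside sets attached to a single strip. -/

namespace EvenHoles

variable {V : Type*} {G : SimpleGraph V}

theorem IsRung.indSeq {T : Triple V} {u v : V} {p : G.Walk u v} (hp : IsRung T p) :
    IndSeq G p.getVert p.length ∧ ∀ i, 0 < i → i < p.length → p.getVert i ∈ T.C := by
  have h := hp.isInducedPath.indSeq
  refine ⟨h, fun i h0 hi => hp.interior_mem _ ⟨p.getVert_mem_support i, ?_, ?_⟩⟩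
  · have := h.inj 0 i h0 hi.le
    rwa [p.getVert_zero, ne_comm] at this
  · have := h.inj i p.length hi le_rfl
    rwa [p.getVert_length] at this

theorem IsStrip.exists_indSeq {T : Triple V} (hT : IsStrip G T) {x : V} (hx : x ∈ T.verts) :
    ∃ (f : ℕ → V) (n : ℕ), IndSeq G f n ∧ f 0 ∈ T.A ∧ f n ∈ T.B ∧
      (∀ i, 0 < i → i < n → f i ∈ T.C) ∧ ∃ i ≤ n, f i = x := by
  obtain ⟨u, v, p, hp, hxp⟩ := hT.mem_rung x hx
  obtain ⟨h1, h2⟩ := hp.indSeq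
  obtain ⟨i, hi, hi'⟩ := SimpleGraph.Walk.mem_support_iff_exists_getVert.1 hxp
  exact ⟨p.getVert, p.length, h1, by simpa using hp.left_mem, by simpa using hp.right_mem, h2, i,
    hi', hi⟩

theorem Triple.D_subset_verts (T : Triple V) : T.D ⊆ T.verts := by
  rintro x (h | h)
  · exact Or.inl (Or.inl h)
  · exact Or.inr h

theorem IsProperStrip.disjoint_BD {T : Triple V} (hT : IsProperStrip G T) {x : V} (hx : x ∈ T.B) :
    x ∉ T.D := by
  rintro (h | h)
  · exact Set.disjoint_left.1 hT.disjoint_AB h hx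
  · exact Set.disjoint_left.1 hT.disjoint_BC hx h

theorem IsProperStrip.exists_rung_of_mem_A {T : Triple V} (hT : IsProperStrip G T) {x : V}
    (hx : x ∈ T.A) : ∃ b ∈ T.B, ∃ n, PathIn G T.C x b n := by
  obtain ⟨f, n, hf, h0, hn, hC, i, hi, rfl⟩ := hT.exists_indSeq (Or.inl (Or.inl hx))
  rcases Nat.eq_zero_or_pos i with rfl | h
  · exact ⟨f n, hn, n, f, hf, rfl, rfl, hC⟩
  · rcases hi.lt_or_eq with hi | rfl
    · exact absurd (hC i h hi) (Set.disjoint_left.1 hT.disjoint_AC hx)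
    · exact absurd hn (Set.disjoint_left.1 hT.disjoint_AB hx)

theorem IsProperStrip.exists_rung_of_mem_B {T : Triple V} (hT : IsProperStrip G T) {b : V}
    (hb : b ∈ T.B) : ∃ x ∈ T.A, ∃ n, PathIn G T.C x b n := by
  obtain ⟨f, n, hf, h0, hn, hC, i, hi, rfl⟩ := hT.exists_indSeq (Or.inl (Or.inr hb))
  rcases Nat.eq_zero_or_pos i with rfl | h
  · exact absurd hb (Set.disjoint_left.1 hT.disjoint_AB h0)
  · rcases hi.lt_or_eq with hi | rfl
    · exact absurd (hC i h hi) (Set.disjoint_left.1 hT.disjoint_BC hb)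
    · exact ⟨f 0, h0, i, f, hf, rfl, rfl, hC⟩

theorem IsProperStrip.exists_path_of_mem_C {T : Triple V} (hT : IsProperStrip G T) {c : V}
    (hc : c ∈ T.C) : ∃ b ∈ T.B, ∃ n, PathIn G T.C c b n := by
  obtain ⟨f, n, hf, h0, hn, hC, i, hi, rfl⟩ := hT.exists_indSeq (Or.inr hc)
  exact ⟨f n, hn, n - i, fun j => f (i + j), hf.shift (by omega), rfl, congrArg f (by omega),
    fun j h1 h2 => hC _ (by omega) (by omega)⟩

variable {a : V} {k : ℕ} {S : Fin k → Triple V}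

theorem IsIndecomposableSystem.frame (hS : IsIndecomposableSystem G a S) : Frame G a S where
  conn := hS.connected
  antiD i j hij x hx y hy := by
    have h1 := (S i).D_subset_verts hx
    have h2 := (S j).D_subset_verts hy
    refine ⟨fun h => Set.disjoint_left.1 (hS.disjoint i j hij) h1 (h ▸ h2), fun h => ?_⟩
    exact (hS.proper i).disjoint_BD (hS.no_other_edges i j hij x h1 y h2 h).1 hx
  antiDB i j hij x hx y hy := by
    have h1 := (S i).D_subset_verts hx
    have h2 : y ∈ (S j).verts := Or.inl (Or.inr hy)
    refine ⟨fun h => Set.disjoint_left.1 (hS.disjoint i j hij) h1 (h ▸ h2), fun h => ?_⟩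
    exact (hS.proper i).disjoint_BD (hS.no_other_edges i j hij x h1 y h2 h).1 hx
  adjB := hS.complete
  adjA := hS.apex_complete
  antiB i _ hx y hy := by
    subst hx
    refine ⟨?_, hS.apex_anticomplete i y (Or.inl hy)⟩
    rintro rfl
    exact hS.apex_notMem i (Or.inl (Or.inr hy))
  antiC i _ hx y hy := by
    subst hx
    refine ⟨?_, hS.apex_anticomplete i y (Or.inr hy)⟩
    rintro rfl
    exact hS.apex_notMem i (Or.inr hy)
  nonempty_A i := (hS.proper i).nonempty_A
  nonempty_B i := (hS.proper i).nonempty_B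
  rungA i _ hx := (hS.proper i).exists_rung_of_mem_A hx
  rungB i _ hb := (hS.proper i).exists_rung_of_mem_B hb

theorem IsPyramidStripSystem.exists_third (hS : IsPyramidStripSystem G a S) (i j : Fin k) :
    ∃ l, l ≠ i ∧ l ≠ j := by
  have h3 := hS.three_le
  have h : ({i, j} : Finset (Fin k)).card < (Finset.univ : Finset (Fin k)).card := by
    have := Finset.card_le_two (a := i) (b := j)
    rw [Finset.card_univ, Fintype.card_fin]
    omega
  obtain ⟨l, -, hl⟩ := Finset.exists_mem_notMem_of_card_lt_card h
  exact ⟨l, by simpa using hl⟩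

/-- The nonneighbours of `a` outside the system. -/
def outside (G : SimpleGraph V) (a : V) {ι : Type*} (S : ι → Triple V) : Set V :=
  {w | a ≠ w ∧ ¬ G.Adj a w ∧ ∀ j, w ∉ (S j).verts}

/-- Go from `a` through `D i` and `F` to the first vertex `h` of `F` with a neighbour in a base
other than `B i`. By parity `h` is complete to all these bases, so the path without `a` can be
merged into the strip `i`. -/
theorem IsMaximalSystem.not_att_B (hG : EvenHoleFree G) (hS : IsMaximalSystem G a S) {F : Set V}
    (hF : ConnectedSet G F) (hFU : F ⊆ outside G a S) {i : Fin k} {f₀ : V} (hf₀ : f₀ ∈ F)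
    (hatt : Att G f₀ (S i).D) (hanti : ∀ j, j ≠ i → ∀ f ∈ F, ¬ Att G f (S j).D) {j : Fin k}
    (hij : j ≠ i) {f : V} (hf : f ∈ F) : ¬ Att G f (S j).B := by
  intro hfB
  have hI := hS.indecomposable
  have hFr := hI.frame
  obtain ⟨d, hd, hfd⟩ := hatt
  have hconn : ConnectedSet G (insert a ((S i).D ∪ F)) := by
    refine ConnectedSet.insert ((hI.connected i).union_of_adj hF hd hf₀ hfd.symm) ?_
    exact (hFr.att_apex i).mono Set.subset_union_left
  obtain ⟨n, hn⟩ := hconn.exists_pathIn_mem (Set.mem_insert _ _) (Or.inr (Or.inr hf))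
  obtain ⟨h, m, -, -, ⟨hhF, q, hqi, c, hc, hhc⟩, hP, -, -, -⟩ := hn.diff.exists_split
    (fun v => v ∈ F ∧ ∃ j, j ≠ i ∧ Att G v (S j).B) ⟨hf, j, hij, hfB⟩
  obtain ⟨hah, hah', hhV⟩ := hFU hhF
  have hFa : ∀ v ∈ F, v ≠ a := fun v hv => (hFU hv).1.symm
  obtain ⟨T, hT, hP⟩ : ∃ T, (∀ s ∈ T, s ∈ (S i).D ∨ (s ∈ F ∧ ∀ l, l ≠ i → ¬ Att G s (S l).B)) ∧
      PathIn G T a h m := by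
    refine ⟨_, ?_, hP⟩
    rintro s ⟨⟨rfl | hs | hs, h1, -⟩, h2⟩
    · exact absurd rfl h1
    · exact Or.inl hs
    · exact Or.inr ⟨hs, fun l hl h3 => h2 ⟨hs, l, hl, h3⟩⟩
  have hm : 2 ≤ m := hP.two_le hah hah'
  have hFD : ∀ l, l ≠ i → Anti G F (S l).D := by
    intro l hl s hs t ht
    refine ⟨?_, fun h => hanti l hl s hs ⟨t, ht, h⟩⟩
    rintro rfl
    exact (hFU hs).2.2 l ((S l).D_subset_verts ht)
  have hTB : ∀ l, l ≠ i → Anti G T (S l).B := by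
    intro l hl s hs t ht
    rcases hT s hs with hs | ⟨hs, hs'⟩
    · exact hFr.antiDB i l hl.symm s hs t ht
    · refine ⟨?_, fun h => hs' l hl ⟨t, ht, h⟩⟩
      rintro rfl
      exact (hFU hs).2.2 l (Or.inl (Or.inr ht))
  have hTD : ∀ l, l ≠ i → Anti G T (S l).D := by
    intro l hl s hs t ht
    rcases hT s hs with hs | ⟨hs, hs'⟩
    · exact hFr.antiD i l hl.symm s hs t ht
    · exact hFD l hl s hs t ht
  -- If `h d` is a nonedge, the paths from `a` via `h` to `c` and on to `d` have consecutive
  -- lengths, but the arms to `c` and `d` have equal parity.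
  have key : ∀ l l', l ≠ i → l' ≠ i → l ≠ l' → ∀ c ∈ (S l).B, ∀ d ∈ (S l').B, G.Adj h c →
      G.Adj h d := by
    intro l l' hl hl' hll c hc d hd hhc
    by_contra hhd
    have hac := hFr.antiB l a rfl c hc
    have had := hFr.antiB l' a rfl d hd
    have hhd' : h ≠ d := by
      rintro rfl
      exact hhV l' (Or.inl (Or.inr hd))
    obtain ⟨n₁, h1⟩ := hFr.exists_arm hc
    obtain ⟨n₂, h2⟩ := hFr.exists_arm hd
    have h3 := hFr.arm_parity_of_ne hG hll hc hd h1 h2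
    have hTc := hTB l hl
    have hTd := hTB l' hl'
    have h4 := hP.snoc hhc (by clear hTd hT hTB hTD hFD hFa; grind [Anti]) (by omega)
    have h5 := h4.snoc (hFr.adjB l l' hll c hc d hd)
      (by clear hTc hT hTB hTD hFD hFa; grind [Anti]) (by omega)
    have h6 := h4.odd_add hG h1 hac.1 hac.2 (by
      have := hTD l hl
      have := hFD l hl
      clear hTc hTd hT hTB hTD hFD hFa
      grind [Anti])
    have h7 := h5.odd_add hG h2 had.1 had.2 (by
      have := hTD l' hl'
      have := hFD l' hl'
      have := (hFr.antiDB l' l hll.symm).symm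
      clear hTc hTd hT hTB hTD hFD hFa
      grind [Anti])
    omega
  have hcompl : ∀ l, l ≠ i → ∀ d ∈ (S l).B, G.Adj h d := by
    intro l hl d hd
    -- Within the base of `c` itself, adjacency is transferred through a further strip.
    by_cases hlq : q = l
    · obtain ⟨e, hei, hel⟩ := hI.exists_third i l
      obtain ⟨x, hx⟩ := hFr.nonempty_B e
      have := key q e hqi hei (by rw [hlq]; exact hel.symm) c hc x hx hhc
      exact key e l hei hl hel x hx d hd this
    · exact key q l hqi hl hlq c hc d hd hhc
  obtain ⟨u, huT, hau, hQ, -, -⟩ := hP.exists_cons hm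
  have huA : u ∈ (S i).A := by
    rcases hT u huT with (hu | hu) | ⟨hu, -⟩
    · exact hu
    · exact absurd hau (hFr.antiC i a rfl u hu).2
    · exact absurd hau (hFU hu).2.1
  obtain ⟨g, hg, hg0, hgn, hgT⟩ := hQ
  have hT' : ∀ m', m' < m - 1 → g m' ∈ T := by
    intro m' hm'
    rcases Nat.eq_zero_or_pos m' with rfl | h0
    · exact hg0 ▸ huT
    · exact (hgT m' h0 hm').1
  have hverts : ∀ l, ∀ x ∈ (S l).verts, x ∈ (S l).B ∨ x ∈ (S l).D := by
    rintro l x ((hx | hx) | hx)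
    · exact Or.inr (Or.inl hx)
    · exact Or.inl hx
    · exact Or.inr (Or.inr hx)
  have hTV : ∀ l, l ≠ i → ∀ s ∈ T, ∀ x ∈ (S l).verts, s ≠ x ∧ ¬ G.Adj s x := by
    intro l hl s hs x hx
    rcases hverts l x hx with h | h
    · exact hTB l hl s hs x h
    · exact hTD l hl s hs x h
  obtain ⟨i₁, hi₁, -⟩ := hI.exists_third i i
  obtain ⟨i₂, hi₂, hi₁₂⟩ := hI.exists_third i i₁
  refine hS.false_of_merge (J := {i}) hi₁₂.symm (by simpa using hi₁) (by simpa using hi₂) hg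
    (by omega) (hg0 ▸ hau) ?_ ?_ ?_ ?_ ?_ ?_ ?_ ?_ ?_ ⟨m - 1, le_rfl, fun l => hgn ▸ hhV l⟩
  · intro m' h0 hm'
    rcases hm'.lt_or_eq with hm' | rfl
    · exact (hgT m' h0 hm').2
    · exact hgn ▸ ⟨hah, hah'⟩
  · rintro _ rfl (h | h)
    · exact (hFr.antiB _ a rfl _ h).2 (hg0 ▸ hau)
    · exact (hFr.antiC _ a rfl _ h).2 (hg0 ▸ hau)
  · rintro _ rfl h
    exact hhV _ ((S _).D_subset_verts (hgn ▸ h))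
  · rintro m' h0 hm' _ rfl (h | h)
    · exact (hgT m' h0 hm').2.2 (hFr.adjA _ _ h)
    · rcases hT _ (hT' m' hm') with h' | ⟨h', -⟩
      · exact (hI.proper _).disjoint_BD h h'
      · exact (hFU h').2.2 _ (Or.inl (Or.inr h))
  · intro m' hm' l hl hx
    rcases hm'.lt_or_eq with hm' | rfl
    · exact (hTV l (by simpa using hl) _ (hT' m' hm') _ hx).1 rfl
    · exact hhV l (hgn ▸ hx)
  · intro m' hm' l hl x hx
    exact (hTV l (by simpa using hl) _ (hT' m' hm') x hx).2
  · intro l hl x hx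
    exact hgn ▸ hcompl l (by simpa using hl) x hx
  · intro l hl x hx
    exact hgn ▸ (hFD l (by simpa using hl) h hhF x hx).2
  · rintro _ rfl
    exact ⟨0, by omega, Or.inl (hg0 ▸ (S _).A_subset_D huA)⟩

end EvenHoles

/-! ### Building extended near-prisms from sequences. -/

namespace EvenHoles

variable {V : Type*} {G : SimpleGraph V}

theorem hasExtendedNearPrismAt {f : Fin 3 → ℕ → V} {n : Fin 3 → ℕ}
    (hf : ∀ i, IndSeq G (f i) (n i)) (ha : ∀ i j, i < j → G.Adj (f i 0) (f j 0))
    (hb : ∀ i j, i < j → G.Adj (f i (n i)) (f j (n j))) {s t : ℕ} (hs : 0 < s) (hsn : s < n 0)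
    (ht : 0 < t) (htn : t < n 1) (hst : G.Adj (f 0 s) (f 1 t))
    (hcross : ∀ i j, i < j → ∀ p ≤ n i, ∀ q ≤ n j, f i p ≠ f j q ∧ (G.Adj (f i p) (f j q) →
      (p = 0 ∧ q = 0) ∨ (p = n i ∧ q = n j) ∨ (f i p = f 0 s ∧ f j q = f 1 t))) :
    HasExtendedNearPrismAt G (f 1 t) := by
  choose R hR1 hR2 hR3 using fun i => (hf i).exists_walk
  have hcross' : ∀ i j, i ≠ j → ∀ p ≤ n i, ∀ q ≤ n j, f i p ≠ f j q ∧ (G.Adj (f i p) (f j q) →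
      (p = 0 ∧ q = 0) ∨ (p = n i ∧ q = n j) ∨ s(f i p, f j q) = s(f 0 s, f 1 t)) := by
    intro i j hij p hp q hq
    rcases lt_or_gt_of_ne hij with h | h
    · obtain ⟨h1, h2⟩ := hcross i j h p hp q hq
      refine ⟨h1, fun h3 => ?_⟩
      rcases h2 h3 with h4 | h4 | ⟨h4, h5⟩
      · exact Or.inl h4
      · exact Or.inr (Or.inl h4)
      · exact Or.inr (Or.inr (by rw [h4, h5]))
    · obtain ⟨h1, h2⟩ := hcross j i h q hq p hp
      refine ⟨h1.symm, fun h3 => ?_⟩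
      rcases h2 h3.symm with h4 | h4 | ⟨h4, h5⟩
      · exact Or.inl h4.symm
      · exact Or.inr (Or.inl h4.symm)
      · exact Or.inr (Or.inr (by rw [h4, h5, Sym2.eq_swap]))
  refine ⟨fun i => f i 0, fun i => f i (n i), R, f 0 s, f 1 t, ⟨?_, ?_, ?_, fun i =>
    (hR2 i).isPath, ?_, ⟨?_, ?_, ?_⟩, ⟨?_, ?_, ?_⟩, hst, ?_⟩, Or.inr rfl⟩
  · intro i j hij
    rcases lt_or_gt_of_ne hij with h | h
    · exact ha i j h
    · exact (ha j i h).symm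
  · intro i j hij
    rcases lt_or_gt_of_ne hij with h | h
    · exact hb i j h
    · exact (hb j i h).symm
  · ext x
    constructor
    · rintro ⟨⟨i, rfl⟩, ⟨j, hj⟩⟩
      have hij : i = j := by
        by_contra hij
        exact (hcross' i j hij 0 (by omega) (n j) le_rfl).1 hj.symm
      subst hij
      -- Paths `0` and `1` have interior vertices, so only path `2` can have equal ends.
      have hi : i = 2 := by
        have h0 : n i = 0 := by
          by_contra h0
          exact (hf i).inj 0 (n i) (by omega) le_rfl hj.symm
        fin_cases i
        · simp at h0
          omega
        · simp at h0
          omega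
        · rfl
      subst hi
      exact ⟨rfl, hj.symm⟩
    · rintro ⟨h1, h2⟩
      exact ⟨⟨2, h1.symm⟩, ⟨2, h2.symm⟩⟩
  · intro i j hij x hx hx'
    obtain ⟨p, hp, rfl⟩ := (hR3 i x).1 hx
    obtain ⟨q, hq, h⟩ := (hR3 j _).1 hx'
    exact (hcross' i j hij p hp q hq).1 h.symm
  · exact (hR3 0 _).2 ⟨s, hsn.le, rfl⟩
  · exact ((hf 0).inj 0 s hs hsn.le).symm
  · exact (hf 0).inj s _ hsn le_rfl
  · exact (hR3 1 _).2 ⟨t, htn.le, rfl⟩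
  · exact ((hf 1).inj 0 t ht htn.le).symm
  · exact (hf 1).inj t _ htn le_rfl
  · rintro x y ⟨i, hx⟩ ⟨j, hy⟩ hxy
    by_cases hij : i = j
    · subst hij
      exact Or.inl ⟨i, (hR2 i).mem_edges hx hy hxy⟩
    · obtain ⟨p, hp, rfl⟩ := (hR3 i x).1 hx
      obtain ⟨q, hq, rfl⟩ := (hR3 j y).1 hy
      rcases (hcross' i j hij p hp q hq).2 hxy with ⟨rfl, rfl⟩ | ⟨rfl, rfl⟩ | h
      · exact Or.inr (Or.inl ⟨⟨i, rfl⟩, ⟨j, rfl⟩⟩)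
      · exact Or.inr (Or.inr (Or.inl ⟨⟨i, rfl⟩, ⟨j, rfl⟩⟩))
      · exact Or.inr (Or.inr (Or.inr h))

end EvenHoles

/-! ### Nonneighbours of the apex attached to two strips: parity. -/

namespace EvenHoles

variable {V : Type*} {G : SimpleGraph V}

theorem IndSeq.cons {f : ℕ → V} {n : ℕ} (hf : IndSeq G f n) {u : V} (hu : G.Adj u (f 0))
    (h : ∀ i, 0 < i → i ≤ n → u ≠ f i ∧ ¬ G.Adj u (f i)) :
    IndSeq G (fun m => if m = 0 then u else f (m - 1)) (n + 1) := by
  refine ⟨?_, ?_, ?_⟩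
  · intro i hi
    rcases Nat.eq_zero_or_pos i with rfl | h0
    · simpa using hu
    · rw [if_neg (by omega), if_neg (by omega)]
      have := hf.adj (i - 1) (by omega)
      rwa [show i - 1 + 1 = i + 1 - 1 by omega] at this
  · intro i j hij hj
    rw [if_neg (by omega : ¬ j = 0)]
    rcases Nat.eq_zero_or_pos i with rfl | h0
    · rw [if_pos rfl]
      exact (h _ (by omega) (by omega)).2
    · rw [if_neg (by omega)]
      exact hf.chordless _ _ (by omega) (by omega)
  · intro i j hij hj
    rw [if_neg (by omega : ¬ j = 0)]
    rcases Nat.eq_zero_or_pos i with rfl | h0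
    · rw [if_pos rfl]
      rcases Nat.eq_or_lt_of_le (show 1 ≤ j by omega) with rfl | h1
      · exact hu.ne
      · exact (h _ (by omega) (by omega)).1
    · rw [if_neg (by omega)]
      exact hf.inj _ _ (by omega) (by omega)

theorem IndSeq.pathIn_segment {f : ℕ → V} {n : ℕ} (hf : IndSeq G f n) {i j : ℕ} (hij : i ≤ j)
    (hj : j ≤ n) : PathIn G {x | ∃ m, i < m ∧ m < j ∧ f m = x} (f i) (f j) (j - i) :=
  ⟨fun m => f (i + m), hf.shift (by omega), rfl, congrArg f (by omega),
    fun m h1 h2 => ⟨i + m, by omega, by omega, rfl⟩⟩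

theorem forall_fin_three_lt {P : Fin 3 → Fin 3 → Prop} (h01 : P 0 1) (h02 : P 0 2) (h12 : P 1 2) :
    ∀ i j, i < j → P i j := by
  intro i j hij
  fin_cases i <;> fin_cases j <;> first | assumption | exact absurd hij (by decide)

section

variable {a : V} {ι : Type*} {S : ι → Triple V}

theorem Frame.exists_parity (hG : EvenHoleFree G) (hF : Frame G a S)
    (three : ∀ i j : ι, ∃ l, l ≠ i ∧ l ≠ j) :
    ∃ r, ∀ i, ∀ b ∈ (S i).B, ∀ n, PathIn G (S i).D a b n → n % 2 = r % 2 := by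
  rcases isEmpty_or_nonempty ι with h | ⟨⟨i₀⟩⟩
  · exact ⟨0, fun i => h.elim i⟩
  obtain ⟨i₁, h1, -⟩ := three i₀ i₀
  obtain ⟨c, hc⟩ := hF.nonempty_B i₀
  obtain ⟨d, hd⟩ := hF.nonempty_B i₁
  obtain ⟨m, hm⟩ := hF.exists_arm hc
  obtain ⟨n, hn⟩ := hF.exists_arm hd
  have h2 := hF.arm_parity_of_ne hG h1 hd hc hn hm
  refine ⟨m, fun i b hb q hq => ?_⟩
  by_cases hi : i = i₀
  · subst hi
    have := hF.arm_parity_of_ne hG h1 hd hb hn hq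
    omega
  · exact hF.arm_parity_of_ne hG hi hb hc hq hm

/-- The hypotheses on a vertex attached to two strips of a frame. -/
structure TwoAtt (G : SimpleGraph V) (a : V) {ι : Type*} (S : ι → Triple V) (r : ℕ) (i j l : ι)
    (v : V) : Prop extends Frame G a S where
  free : EvenHoleFree G
  arm : ∀ i, ∀ b ∈ (S i).B, ∀ n, PathIn G (S i).D a b n → n % 2 = r % 2
  ij : i ≠ j
  il : i ≠ l
  jl : j ≠ l
  ne : v ≠ a
  nadj : ¬ G.Adj v a
  notMem_D : ∀ q, v ∉ (S q).D
  notMem_B : ∀ q, v ∉ (S q).B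
  att_i : Att G v (S i).D
  att_j : Att G v (S j).D

namespace TwoAtt

variable {r : ℕ} {i j l : ι} {v : V}

/-- A neighbour there would give a third path from `v` to `a`, anticomplete to those through the
strips `i` and `j`. -/
theorem anti_l (H : TwoAtt G a S r i j l v) : Anti G {v} ((S l).D ∪ (S l).B) := by
  obtain ⟨q₁, h1⟩ := (H.conn i).exists_pathIn H.att_i (H.att_apex i)
  obtain ⟨q₂, h2⟩ := (H.conn j).exists_pathIn H.att_j (H.att_apex j)
  have h12 := h1.odd_add H.free h2 H.ne H.nadj (H.antiD i j H.ij)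
  have hD : Anti G {v} (S l).D := by
    rintro _ rfl s hs
    refine ⟨fun h => H.notMem_D l (h ▸ hs), fun h => ?_⟩
    obtain ⟨q₃, h3⟩ := (H.conn l).exists_pathIn ⟨s, hs, h⟩ (H.att_apex l)
    have h13 := h1.odd_add H.free h3 H.ne H.nadj (H.antiD i l H.il)
    have h23 := h2.odd_add H.free h3 H.ne H.nadj (H.antiD j l H.jl)
    omega
  rintro _ rfl s (hs | hs)
  · exact hD _ rfl s hs
  · refine ⟨fun h => H.notMem_B l (h ▸ hs), fun h => ?_⟩
    obtain ⟨n, hn⟩ := H.exists_arm hs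
    have has := H.antiB l a rfl s hs
    have hne := H.ne
    have hnadj := H.nadj
    have h3 := PathIn.cons h hn.symm (by grind [Anti]) (hn.pos_of_ne has.1)
    have hX : ∀ q, q ≠ l → Anti G (S q).D (insert s (S l).D) := by
      intro q hq
      have := H.antiDB q l hq
      have := H.antiD q l hq
      grind [Anti]
    have h13 := h1.odd_add H.free h3 H.ne H.nadj (hX i H.il)
    have h23 := h2.odd_add H.free h3 H.ne H.nadj (hX j H.jl)
    omega

/-- The path from `v` to `a` via the bases of the strips `q` and `l`. -/
theorem path_via_l (H : TwoAtt G a S r i j l v) {q : ι} (hq : q ≠ l) {T : Set V}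
    (hT : T ⊆ (S q).D) (haT : Anti G {a} T) {b : V} (hb : b ∈ (S q).B) {m : ℕ}
    (hm : PathIn G T v b m) : ∃ c ∈ (S l).B, ∃ n,
      PathIn G (insert b (insert c (T ∪ (S l).D))) v a n ∧ n % 2 = (m + r + 1) % 2 := by
  obtain ⟨c, hc⟩ := H.nonempty_B l
  obtain ⟨n, hn⟩ := H.exists_arm hc
  have hvl := H.anti_l
  have hab := H.antiB q a rfl b hb
  have hac := H.antiB l a rfl c hc
  have := H.arm l c hc n hn
  refine ⟨c, hc, _, H.path_across H.ne H.nadj hq hT subset_rfl hb hc hm hn ?_ hac.1 ?_ ?_, by omega⟩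
  · rintro rfl
    exact H.notMem_B q hb
  · exact hvl.mono subset_rfl (Set.insert_subset (Or.inr hc) Set.subset_union_left)
  · rintro _ rfl s (rfl | hs)
    · exact hab
    · exact haT _ rfl s hs

/-- Direct paths from `v` to `a` through `i` and `j` have different parities. Comparing each with
the path to `a` via the other base and the strip `l` forces the paths from `v` to the two bases to
have different parities as well, against `parity_of_ne`. -/
theorem false_of_reach (H : TwoAtt G a S r i j l v) {b c : V} (hb : b ∈ (S i).B)
    (hc : c ∈ (S j).B) {m n : ℕ} (hm : PathIn G (S i).C v b m) (hn : PathIn G (S j).C v c n) :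
    False := by
  obtain ⟨q₁, h1⟩ := (H.conn i).exists_pathIn H.att_i (H.att_apex i)
  obtain ⟨q₂, h2⟩ := (H.conn j).exists_pathIn H.att_j (H.att_apex j)
  have h12 := h1.odd_add H.free h2 H.ne H.nadj (H.antiD i j H.ij)
  obtain ⟨d, hd, n₁, h3, h4⟩ := H.path_via_l H.il (S i).C_subset_D (H.antiC i) hb hm
  obtain ⟨e, he, n₂, h5, h6⟩ := H.path_via_l H.jl (S j).C_subset_D (H.antiC j) hc hn
  have h7 := h2.odd_add H.free h3 H.ne H.nadj
    (H.anti_across H.ij.symm H.jl (S i).C_subset_D subset_rfl hb hd)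
  have h8 := h1.odd_add H.free h5 H.ne H.nadj
    (H.anti_across H.ij H.il (S j).C_subset_D subset_rfl hc he)
  have h9 := H.parity_of_ne H.free H.ij hb hc (by rintro rfl; exact H.notMem_B i hb)
    (by rintro rfl; exact H.notMem_B j hc) (hm.mono (S i).C_subset_D) (hn.mono (S j).C_subset_D)
  omega

end TwoAtt

end

end EvenHoles

/-! ### The extended near-prism at the apex. -/

namespace EvenHoles

variable {V : Type*} {G : SimpleGraph V}

namespace TwoAtt

variable {a : V} {ι : Type*} {S : ι → Triple V} {r : ℕ} {i j l : ι} {v : V}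

/-- The triangles are `{v, g s, g (s + 1)}` and `{b, c, g M}`, with `c` in `B l`. The paths go from
`v` via `x` to `b`, from `g s` back to `a` and on through the strip `l` to `c`, and from `g (s + 1)`
to `g M`; the cross-edge is `x a`. The third path is a single vertex if `s + 1 = M`. -/
theorem hasExtendedNearPrismAt_of_adjacent (H : TwoAtt G a S r i j l v) {I J : Set V} {x b : V}
    {m n : ℕ} (hI : I ⊆ (S j).C) (hJ : J ⊆ (S j).C) (hx : x ∈ (S j).A) (hb : b ∈ (S j).B)
    (hvx : PathIn G I v x m) (hxb : PathIn G J x b n)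
    (hanti : Anti G (insert v I) (insert b J)) {g : ℕ → V} {M s : ℕ} (hg : IndSeq G g M)
    (hg0 : g 0 = a) (hgM : g M ∈ (S i).B) (hgD : ∀ t, 0 < t → t < M → g t ∈ (S i).D) (hs : 0 < s)
    (hsM : s < M) (hvs : G.Adj v (g s)) (hvs' : G.Adj v (g (s + 1)))
    (hv : ∀ t ≤ M, G.Adj v (g t) → t = s ∨ t = s + 1) : HasExtendedNearPrismAt G a := by
  have hax := H.adjA j x hx
  have hm : 0 < m := hvx.pos_of_ne (by
    rintro rfl
    exact H.nadj hax.symm)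
  have hn : 0 < n := (H.arm_of_rung hx hb (hxb.mono hJ)).1
  obtain ⟨c, hc⟩ := H.nonempty_B l
  obtain ⟨q, hq⟩ := H.exists_arm hc
  have hac := H.antiB l a rfl c hc
  have hq0 := hq.pos_of_ne hac.1
  have hvl := H.anti_l
  have hab := H.antiB j a rfl b hb
  have haC := H.antiC j
  have hseg := (hg.pathIn_segment (Nat.zero_le s) hsM.le).symm
  rw [hg0] at hseg
  have hDil := H.antiD i l H.il
  have hDBil := H.antiDB i l H.il
  have hgs := hgD s hs hsM
  obtain ⟨F₀, hF₀, h00, h01, h02, h03, h04⟩ := hvx.exists_concat hxb hanti hm hn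
  obtain ⟨F₁, hF₁, h10, h11, h12, h13, h14⟩ := hseg.exists_concat hq (by
    rintro y hy z hz
    have hy' : y ∈ (S i).D := by
      rcases hy with rfl | ⟨t, h1, h2, rfl⟩
      · exact hgs
      · exact hgD t h1 (by omega)
    rcases hz with rfl | hz
    · exact hDBil y hy' _ hc
    · exact hDil y hy' z hz) (by omega) hq0
  rw [Nat.sub_zero] at hF₁ h11 h12 h13 h14
  have e0 : ∀ t ≤ m + n, (t = 0 ∧ F₀ t = v) ∨ F₀ t ∈ (S j).C ∨ F₀ t = x ∨
      (t = m + n ∧ F₀ t = b) := by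
    intro t ht
    rcases Nat.eq_zero_or_pos t with rfl | h0
    · exact Or.inl ⟨rfl, h00⟩
    rcases ht.lt_or_eq with ht | rfl
    · rcases lt_trichotomy t m with h | rfl | h
      · exact Or.inr (Or.inl (hI (h03 t h0 h)))
      · exact Or.inr (Or.inr (Or.inl h01))
      · exact Or.inr (Or.inl (hJ (h04 t h ht)))
    · exact Or.inr (Or.inr (Or.inr ⟨rfl, h02⟩))
  have e1 : ∀ t ≤ s + q, (t = 0 ∧ F₁ t = g s) ∨ (∃ p, 0 < p ∧ p < s ∧ g p = F₁ t) ∨ F₁ t = a ∨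
      F₁ t ∈ (S l).D ∨ (t = s + q ∧ F₁ t = c) := by
    intro t ht
    rcases Nat.eq_zero_or_pos t with rfl | h0
    · exact Or.inl ⟨rfl, h10⟩
    rcases ht.lt_or_eq with ht | rfl
    · rcases lt_trichotomy t s with h | rfl | h
      · exact Or.inr (Or.inl (h13 t h0 h))
      · exact Or.inr (Or.inr (Or.inl h11))
      · exact Or.inr (Or.inr (Or.inr (Or.inl (h14 t h ht))))
    · exact Or.inr (Or.inr (Or.inr (Or.inr ⟨rfl, h12⟩)))
  have hjD := (S j).C_subset_D
  have hxD := (S j).A_subset_D hx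
  have hvB := H.notMem_B
  have hvD := H.notMem_D
  have hvg : ∀ t, 0 < t → t ≤ M → v ≠ g t := by
    rintro t h0 ht rfl
    rcases ht.lt_or_eq with ht | rfl
    · exact hvD i (hgD t h0 ht)
    · exact hvB i hgM
  have hbM := H.adjB j i H.ij.symm b hb _ hgM
  have hbc := H.adjB j l H.jl b hb c hc
  have hcM := H.adjB l i H.il.symm c hc _ hgM
  have key := hasExtendedNearPrismAt (G := G) (f := ![F₀, F₁, fun t => g (s + 1 + t)])
    (n := ![m + n, s + q, M - (s + 1)]) (s := m) (t := s) (by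
      have := hg.shift (show s + 1 + (M - (s + 1)) ≤ M by omega)
      simp [Fin.forall_fin_succ, hF₀, hF₁, this]) (by
      apply forall_fin_three_lt
      · simpa [h00, h10] using hvs
      · simpa [h00] using hvs'
      · simpa [h10] using hg.adj s hsM) (by
      have hM : s + 1 + (M - (s + 1)) = M := by omega
      apply forall_fin_three_lt
      · simpa [h02, h12] using hbc
      · simpa [h02, hM] using hbM
      · simpa [h12, hM] using hcM) hm (by simpa using hn) hs (by simpa using hq0)
      (by simpa [h01, h11] using hax.symm) ?_
  · simpa [h11] using key
  apply forall_fin_three_lt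
  · change ∀ p ≤ m + n, ∀ p' ≤ s + q, F₀ p ≠ F₁ p' ∧ (G.Adj (F₀ p) (F₁ p') →
      (p = 0 ∧ p' = 0) ∨ (p = m + n ∧ p' = s + q) ∨ (F₀ p = F₀ m ∧ F₁ p' = F₁ s))
    intro p hp p' hp'
    rw [h01, h11]
    have hj : ∀ y ∈ (S j).D, ∀ z, z ∈ (S i).D ∨ z ∈ (S l).D ∨ z = c → y ≠ z ∧ ¬ G.Adj y z := by
      rintro y hy z (hz | hz | rfl)
      · exact H.antiD j i H.ij.symm y hy z hz
      · exact H.antiD j l H.jl y hy z hz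
      · exact H.antiDB j l H.jl y hy z hc
    have hF : F₁ p' = a ∨ F₁ p' ∈ (S i).D ∨ F₁ p' ∈ (S l).D ∨ F₁ p' = c := by
      rcases e1 p' hp' with ⟨-, h⟩ | ⟨t, h1, h2, h⟩ | h | h | ⟨-, h⟩
      · exact Or.inr (Or.inl (h ▸ hgs))
      · exact Or.inr (Or.inl (h ▸ hgD t h1 (by omega)))
      · exact Or.inl h
      · exact Or.inr (Or.inr (Or.inl h))
      · exact Or.inr (Or.inr (Or.inr h))
    rcases e0 p hp with ⟨rfl, h⟩ | h | h | ⟨rfl, h⟩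
    · rw [h]
      rcases e1 p' hp' with ⟨rfl, h'⟩ | ⟨t, h1, h2, h'⟩ | h' | h' | ⟨-, h'⟩
      · rw [h']
        exact ⟨hvg s hs hsM.le, fun _ => Or.inl ⟨rfl, rfl⟩⟩
      · rw [← h']
        refine ⟨hvg t h1 (by omega), fun h3 => ?_⟩
        have := hv t (by omega) h3
        omega
      · rw [h']
        exact ⟨H.ne, fun h => absurd h H.nadj⟩
      · exact ⟨(hvl v rfl _ (Or.inl h')).1, fun h => absurd h (hvl v rfl _ (Or.inl h')).2⟩
      · rw [h']
        exact ⟨(hvl v rfl _ (Or.inr hc)).1, fun h => absurd h (hvl v rfl _ (Or.inr hc)).2⟩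
    · rcases hF with h' | h'
      · rw [h']
        exact ⟨(haC a rfl _ h).1.symm, fun h3 => absurd h3.symm (haC a rfl _ h).2⟩
      · have := hj _ (hjD h) _ h'
        exact ⟨this.1, fun h => absurd h this.2⟩
    · rcases hF with h' | h'
      · rw [h, h']
        exact ⟨hax.ne', fun _ => Or.inr (Or.inr ⟨rfl, rfl⟩)⟩
      · have := hj _ hxD _ h'
        rw [h]
        exact ⟨this.1, fun h => absurd h this.2⟩
    · rw [h]
      have hbi := (H.antiDB i j H.ij).symm b hb
      have hbl := (H.antiDB l j H.jl.symm).symm b hb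
      rcases e1 p' hp' with ⟨rfl, h'⟩ | ⟨t, h1, h2, h'⟩ | h' | h' | ⟨rfl, h'⟩
      · rw [h']
        exact ⟨(hbi _ hgs).1, fun h => absurd h (hbi _ hgs).2⟩
      · have := hbi _ (hgD t h1 (by omega))
        rw [← h']
        exact ⟨this.1, fun h => absurd h this.2⟩
      · rw [h']
        exact ⟨hab.1.symm, fun h => absurd h.symm hab.2⟩
      · exact ⟨(hbl _ h').1, fun h => absurd h (hbl _ h').2⟩
      · rw [h']
        exact ⟨hbc.ne, fun _ => Or.inr (Or.inl ⟨rfl, rfl⟩)⟩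
  · change ∀ p ≤ m + n, ∀ p' ≤ M - (s + 1), F₀ p ≠ g (s + 1 + p') ∧
      (G.Adj (F₀ p) (g (s + 1 + p')) → (p = 0 ∧ p' = 0) ∨ (p = m + n ∧ p' = M - (s + 1)) ∨
        (F₀ p = F₀ m ∧ g (s + 1 + p') = F₁ s))
    intro p hp p' hp'
    have hj : ∀ y ∈ (S j).D, y ≠ g (s + 1 + p') ∧ ¬ G.Adj y (g (s + 1 + p')) := by
      intro y hy
      rcases (show s + 1 + p' ≤ M by omega).lt_or_eq with h | h
      · exact H.antiD j i H.ij.symm y hy _ (hgD _ (by omega) h)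
      · rw [h]
        exact H.antiDB j i H.ij.symm y hy _ hgM
    rcases e0 p hp with ⟨rfl, h⟩ | h | h | ⟨rfl, h⟩
    · rw [h]
      refine ⟨hvg _ (by omega) (by omega), fun h3 => Or.inl ⟨rfl, ?_⟩⟩
      have := hv _ (by omega) h3
      omega
    · exact ⟨(hj _ (hjD h)).1, fun h3 => absurd h3 (hj _ (hjD h)).2⟩
    · rw [h]
      exact ⟨(hj _ hxD).1, fun h3 => absurd h3 (hj _ hxD).2⟩
    · rw [h]
      rcases (show s + 1 + p' ≤ M by omega).lt_or_eq with h' | h'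
      · have := (H.antiDB i j H.ij).symm b hb _ (hgD (s + 1 + p') (by omega) h')
        exact ⟨this.1, fun h3 => absurd h3 this.2⟩
      · rw [h']
        exact ⟨hbM.ne, fun _ => Or.inr (Or.inl ⟨rfl, by omega⟩)⟩
  · change ∀ p ≤ s + q, ∀ p' ≤ M - (s + 1), F₁ p ≠ g (s + 1 + p') ∧
      (G.Adj (F₁ p) (g (s + 1 + p')) → (p = 0 ∧ p' = 0) ∨ (p = s + q ∧ p' = M - (s + 1)) ∨
        (F₁ p = F₀ m ∧ g (s + 1 + p') = F₁ s))
    intro p hp p' hp'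
    rcases e1 p hp with ⟨rfl, h⟩ | ⟨t, h1, h2, h⟩ | h | h | ⟨rfl, h⟩
    · rw [h]
      refine ⟨hg.inj _ _ (by omega) (by omega), fun h3 => Or.inl ⟨rfl, ?_⟩⟩
      have := (hg.adj_iff (by omega) (by omega)).1 h3
      omega
    · rw [← h]
      exact ⟨hg.inj _ _ (by omega) (by omega),
        fun h3 => absurd h3 (hg.chordless _ _ (by omega) (by omega))⟩
    · rw [h, ← hg0]
      exact ⟨hg.inj _ _ (by omega) (by omega),
        fun h3 => absurd h3 (hg.chordless _ _ (by omega) (by omega))⟩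
    · have : F₁ p ≠ g (s + 1 + p') ∧ ¬ G.Adj (F₁ p) (g (s + 1 + p')) := by
        rcases (show s + 1 + p' ≤ M by omega).lt_or_eq with h' | h'
        · exact hDil.symm _ h _ (hgD _ (by omega) h')
        · rw [h']
          exact H.antiDB l i H.il.symm _ h _ hgM
      exact ⟨this.1, fun h3 => absurd h3 this.2⟩
    · rw [h]
      rcases (show s + 1 + p' ≤ M by omega).lt_or_eq with h' | h'
      · have := hDBil.symm c hc _ (hgD (s + 1 + p') (by omega) h')
        exact ⟨this.1, fun h3 => absurd h3 this.2⟩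
      · rw [h']
        exact ⟨hcM.ne, fun _ => Or.inr (Or.inl ⟨rfl, by omega⟩)⟩

end TwoAtt

end EvenHoles

/-! ### No access from such a vertex to a base of the two strips. -/

namespace EvenHoles

variable {V : Type*} {G : SimpleGraph V}

namespace TwoAtt

variable {a : V} {ι : Type*} {S : ι → Triple V} {r : ℕ} {i j l : ι} {v : V}

/-- By `false_of_reach`, `v` cannot reach `B j` through `C j`, so its path to `a` through `D j`
combines with a rung into an induced path to `B j`. This fixes the parity of paths from `v` to `B
i`. On an arm of the strip `i` through a neighbour of `v`, the first and last neighbours of `v` then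
have positions of different parity: consecutive ones give the near-prism, others an even hole. The
hypothesis `full` is needed because vertices of a frame may lie on no rung. -/
theorem false_of_reach_left (H : TwoAtt G a S r i j l v) (hns : ¬ HasExtendedNearPrismAt G a)
    (full : ∀ d ∈ (S i).D, ∃ (f : ℕ → V) (n : ℕ), IndSeq G f n ∧ f 0 ∈ (S i).A ∧ f n ∈ (S i).B ∧
      (∀ m, 0 < m → m < n → f m ∈ (S i).C) ∧ ∃ m < n, f m = d)
    {b₀ : V} (hb₀ : b₀ ∈ (S i).B) {n₀ : ℕ} (hn₀ : PathIn G (S i).C v b₀ n₀) : False := by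
  classical
  have hno : ∀ c ∈ (S j).B, ∀ n, ¬ PathIn G (S j).C v c n := fun c hc n hn =>
    H.false_of_reach hb₀ hc hn₀ hn
  have hvB : ∀ q, ∀ c ∈ (S q).B, v ≠ c := by
    rintro q c hc rfl
    exact H.notMem_B q hc
  -- the path from `v` to `a` through the strip `j` and a rung that does not meet it
  obtain ⟨q₂, hq⟩ := (H.conn j).exists_pathIn H.att_j (H.att_apex j)
  have hq₂ : 2 ≤ q₂ := hq.two_le H.ne H.nadj
  obtain ⟨x, hxD, hax, hxv, -, -⟩ := hq.symm.exists_cons hq₂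
  have hx : x ∈ (S j).A := by
    rcases hxD with h | h
    · exact h
    · exact absurd hax (H.antiC j a rfl x h).2
  replace hxv : PathIn G (S j).C x v (q₂ - 1) := hxv.mono (by
    rintro s ⟨hs | hs, h1, h2⟩
    · exact absurd (H.adjA j s hs) h2
    · exact hs)
  obtain ⟨b, hb, n, hn⟩ := H.rungA j x hx
  obtain ⟨hn0, harm⟩ := H.arm_of_rung hx hb hn
  have hnr := H.arm j b hb _ (harm.mono (Triple.insert_subset_D hx))
  have hvb := hvB j b hb
  obtain ⟨I, hI, J, hJ, h1, h2, hanti⟩ :=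
    (hxv.symm.exists_or_anti hn (by omega) hn0).resolve_left (by
      rintro ⟨k, hk⟩
      rw [Set.union_self] at hk
      exact hno b hb k hk)
  have hvj := (h1.concat h2 hanti (by omega) hn0).mono ((Set.insert_subset_insert
    (Set.union_subset hI hJ)).trans (Triple.insert_subset_D hx))
  have hpar : ∀ c ∈ (S i).B, ∀ m, PathIn G (S i).D v c m → m % 2 = (q₂ + r) % 2 := by
    intro c hc m hm
    have := H.parity_of_ne H.free H.ij hc hb (hvB i c hc) hvb hm hvj
    omega
  -- an arm through a neighbour of `v`
  obtain ⟨d, hd, hvd⟩ := H.att_i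
  obtain ⟨f, N, hf, hf0, hfN, hfC, s₀, hs₀, rfl⟩ := full d hd
  have hafN := H.antiB i a rfl _ hfN
  have hg := hf.cons (H.adjA i _ hf0) (by
    intro m h0 hm
    rcases hm.lt_or_eq with h | rfl
    · exact H.antiC i a rfl _ (hfC m h0 h)
    · exact hafN)
  set g : ℕ → V := fun m => if m = 0 then a else f (m - 1) with hgdef
  have hg0 : g 0 = a := by simp [hgdef]
  have hgs : ∀ m, g (m + 1) = f m := by simp [hgdef]
  have hgM : g (N + 1) ∈ (S i).B := by rwa [hgs]
  have hgD : ∀ t, 0 < t → t < N + 1 → g t ∈ (S i).D := by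
    intro t h0 ht
    obtain ⟨t, rfl⟩ := Nat.exists_eq_add_of_lt h0
    rw [Nat.zero_add, hgs]
    rcases Nat.eq_zero_or_pos t with rfl | h
    · exact (S i).A_subset_D hf0
    · exact (S i).C_subset_D (hfC t h (by omega))
  have hMr := H.arm i _ hgM (N + 1) ⟨g, hg, hg0, rfl, hgD⟩
  have hva : ¬ G.Adj v (g 0) := hg0 ▸ H.nadj
  have hvs₀ : G.Adj v (g (s₀ + 1)) := by rwa [hgs]
  -- the first and last neighbours of `v` on the arm
  obtain ⟨s, hvs, hmin⟩ : ∃ s, G.Adj v (g s) ∧ ∀ m < s, ¬ G.Adj v (g m) := by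
    have hex : ∃ s, G.Adj v (g s) := ⟨_, hvs₀⟩
    exact ⟨Nat.find hex, Nat.find_spec hex, fun m hm => Nat.find_min hex hm⟩
  obtain ⟨t, htM, hvt, hmax⟩ : ∃ t ≤ N + 1, G.Adj v (g t) ∧ ∀ m, t < m → m ≤ N + 1 →
      ¬ G.Adj v (g m) := by
    let P := fun m => G.Adj v (g m)
    exact ⟨Nat.findGreatest P (N + 1), Nat.findGreatest_le _,
      Nat.findGreatest_spec (P := P) (show s₀ + 1 ≤ N + 1 by omega) hvs₀,
      fun m h1 h2 => Nat.findGreatest_is_greatest h1 h2⟩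
  have hs0 : 0 < s := Nat.pos_of_ne_zero (by
    rintro rfl
    exact hva hvs)
  have hss : s ≤ s₀ + 1 := by
    by_contra h
    exact hmin (s₀ + 1) (by omega) hvs₀
  have hts : s₀ + 1 ≤ t := by
    by_contra h
    exact hmax (s₀ + 1) (by omega) (by omega) hvs₀
  have hsub : ∀ p p', 0 < p → p' ≤ N + 1 → {y | ∃ m, p ≤ m ∧ m < p' ∧ g m = y} ⊆ (S i).D := by
    rintro p p' hp hp' _ ⟨m, h1, h2, rfl⟩
    exact hgD m (by omega) (by omega)
  have hvg : ∀ m, 0 < m → m ≤ N + 1 → v ≠ g m := by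
    rintro m h0 hm rfl
    rcases hm.lt_or_eq with hm | rfl
    · exact H.notMem_D i (hgD m h0 hm)
    · exact H.notMem_B i hgM
  have hP₁ : PathIn G {y | ∃ m, 1 ≤ m ∧ m < s + 1 ∧ g m = y} v a (s + 1) := by
    have h3 := (hg.pathIn_segment (Nat.zero_le s) (by omega)).symm
    rw [hg0, Nat.sub_zero] at h3
    refine (PathIn.cons hvs h3 ?_ hs0).mono ?_
    · rintro _ rfl y (rfl | ⟨m, h4, h5, rfl⟩)
      · exact ⟨H.ne, H.nadj⟩
      · exact ⟨hvg m h4 (by omega), hmin m h5⟩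
    · rintro y (rfl | ⟨m, h4, h5, rfl⟩)
      · exact ⟨s, by omega, by omega, rfl⟩
      · exact ⟨m, by omega, by omega, rfl⟩
  have hP₂ : PathIn G {y | ∃ m, t ≤ m ∧ m < N + 1 ∧ g m = y} v (g (N + 1)) (N + 1 - t + 1) := by
    rcases htM.lt_or_eq with ht | rfl
    · refine (PathIn.cons hvt (hg.pathIn_segment ht.le le_rfl) ?_ (by omega)).mono ?_
      · rintro _ rfl y (rfl | ⟨m, h4, h5, rfl⟩)
        · exact ⟨hvg _ (by omega) le_rfl, hmax _ ht le_rfl⟩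
        · exact ⟨hvg m (by omega) (by omega), hmax m h4 h5.le⟩
      · rintro y (rfl | ⟨m, h4, h5, rfl⟩)
        · exact ⟨t, by omega, by omega, rfl⟩
        · exact ⟨m, by omega, by omega, rfl⟩
    · rw [Nat.sub_self]
      exact .of_adj _ hvt
  have hsubs := hsub 1 (s + 1) one_pos (by omega)
  have hsubt := hsub t (N + 1) (by omega) le_rfl
  have h3 := hq.odd_add H.free (hP₁.mono hsubs) H.ne H.nadj (H.antiD j i H.ij.symm)
  have h4 := hpar _ hgM _ (hP₂.mono hsubt)
  -- By `h3`, `h4` and `hMr`, the positions `s` and `t` have different parity, so `t < s + 2` means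
  -- `t = s + 1`.
  rcases Nat.lt_or_ge t (s + 2) with hst | hst
  · have : t = s + 1 := by omega
    subst this
    refine hns (H.hasExtendedNearPrismAt_of_adjacent hI hJ hx hb h1 h2 hanti hg hg0 hgM hgD hs0
      (by omega) hvs hvt fun m hm hvm => ?_)
    by_contra h
    rcases Nat.lt_or_ge m s with h5 | h5
    · exact hmin m h5 hvm
    · exact hmax m (by omega) hm hvm
  -- The initial and final parts of the arm are now anticomplete, so returning to `a` along the
  -- first and via the strip `l` along the second closes an even hole.
  · obtain ⟨c, hc, n₂, h5, h6⟩ := H.path_via_l H.il hsubt (by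
      rintro _ rfl y ⟨m, h5, h6, rfl⟩
      rw [← hg0]
      exact ⟨hg.inj _ _ (by omega) (by omega), hg.chordless _ _ (by omega) (by omega)⟩) hgM hP₂
    have := hP₁.odd_add H.free h5 H.ne H.nadj (by
      rintro _ ⟨m, h7, h8, rfl⟩ y (rfl | rfl | ⟨m', h9, h10, rfl⟩ | hy)
      · exact ⟨hg.inj _ _ (by omega) (by omega), hg.chordless _ _ (by omega) (by omega)⟩
      · exact H.antiDB i l H.il _ (hgD m (by omega) (by omega)) _ hc
      · exact ⟨hg.inj _ _ (by omega) (by omega), hg.chordless _ _ (by omega) (by omega)⟩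
      · exact H.antiD i l H.il _ (hgD m (by omega) (by omega)) y hy)
    omega

end TwoAtt

end EvenHoles

/-! ### Enlarging the strips, and ends of linking paths. -/

namespace EvenHoles

variable {V : Type*} {G : SimpleGraph V}

/-- Enlarge the sets `C i` by `E i`. -/
def enlarge {ι : Type*} (S : ι → Triple V) (E : ι → Set V) (i : ι) : Triple V where
  A := (S i).A
  B := (S i).B
  C := (S i).C ∪ E i

theorem enlarge_D {ι : Type*} (S : ι → Triple V) (E : ι → Set V) (i : ι) :
    (enlarge S E i).D = (S i).D ∪ E i :=
  (Set.union_assoc _ _ _).symm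

theorem Anti.union_left {S T U : Set V} (h1 : Anti G S U) (h2 : Anti G T U) :
    Anti G (S ∪ T) U := by
  rintro s (hs | hs) t ht
  · exact h1 s hs t ht
  · exact h2 s hs t ht

theorem Frame.enlarge {a : V} {ι : Type*} {S : ι → Triple V} (hF : Frame G a S) {E : ι → Set V}
    (hconn : ∀ i, ConnectedSet G ((S i).D ∪ E i)) (hEE : ∀ i j, i ≠ j → Anti G (E i) (E j))
    (hED : ∀ i j, i ≠ j → Anti G (E i) (S j).D) (hEB : ∀ i j, i ≠ j → Anti G (E i) (S j).B)
    (hEa : ∀ i, Anti G {a} (E i)) : Frame G a (enlarge S E) where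
  conn i := by
    rw [enlarge_D]
    exact hconn i
  antiD i j hij := by
    rw [enlarge_D, enlarge_D]
    exact Anti.union_left ((hF.antiD i j hij).symm.union_left (hED j i hij.symm)).symm
      ((hED i j hij).symm.union_left (hEE i j hij).symm).symm
  antiDB i j hij := by
    rw [enlarge_D]
    exact (hF.antiDB i j hij).union_left (hEB i j hij)
  adjB := hF.adjB
  adjA := hF.adjA
  antiB := hF.antiB
  antiC i := ((hF.antiC i).symm.union_left (hEa i).symm).symm
  nonempty_A := hF.nonempty_A
  nonempty_B := hF.nonempty_B
  rungA i x hx := by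
    obtain ⟨b, hb, n, hn⟩ := hF.rungA i x hx
    exact ⟨b, hb, n, hn.mono Set.subset_union_left⟩
  rungB i b hb := by
    obtain ⟨x, hx, n, hn⟩ := hF.rungB i b hb
    exact ⟨x, hx, n, hn.mono Set.subset_union_left⟩

variable {a : V} {k : ℕ} {S : Fin k → Triple V}

theorem notMem_D_of_mem_outside {x : V} (hx : x ∈ outside G a S) (j : Fin k) : x ∉ (S j).D :=
  fun h => hx.2.2 j ((S j).D_subset_verts h)

theorem notMem_B_of_mem_outside {x : V} (hx : x ∈ outside G a S) (j : Fin k) : x ∉ (S j).B :=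
  fun h => hx.2.2 j (Or.inl (Or.inr h))

theorem IsIndecomposableSystem.exists_path_to_B (hS : IsIndecomposableSystem G a S) {v : V}
    {i : Fin k} (hv : Att G v ((S i).B ∪ (S i).C)) :
    ∃ b ∈ (S i).B, ∃ n, PathIn G (S i).C v b n := by
  obtain ⟨s, hs | hs, h⟩ := hv
  · exact ⟨s, hs, 1, .of_adj _ h⟩
  · obtain ⟨b, hb, n, hn⟩ := (hS.proper i).exists_path_of_mem_C hs
    obtain ⟨m, hm⟩ := hn.exists_prepend h hs
    exact ⟨b, hb, m, hm⟩

/-- Absorb `X` into the strip `j`; then `v` is attached to the strips `i` and `j` of the resulting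
frame, and `false_of_reach_left` applies. The strip `i` is unchanged, so its vertices still lie on
rungs. -/
theorem IsIndecomposableSystem.not_att_of_joined (hG : EvenHoleFree G)
    (hS : IsIndecomposableSystem G a S) (hns : ¬ HasExtendedNearPrismAt G a) {i j : Fin k}
    (hij : i ≠ j) {v : V} {X : Set V} (hv : v ∈ outside G a S) (hXU : X ⊆ outside G a S)
    (hvX : v ∉ X) (hvi : Att G v (S i).D)
    (hX : X = ∅ ∧ Att G v (S j).D ∨ ConnectedSet G X ∧ Att G v X ∧ ∃ x ∈ X, Att G x (S j).D)
    (hXanti : ∀ x ∈ X, ∀ l, l ≠ j → ¬ Att G x (S l).D ∧ ¬ Att G x (S l).B) :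
    ¬ Att G v ((S i).B ∪ (S i).C) := by
  intro hBC
  have hFr := hS.frame
  obtain ⟨b, hb, n, hn⟩ := hS.exists_path_to_B hBC
  have hF : Frame G a (enlarge S fun q => {x | q = j ∧ x ∈ X}) := by
    refine hFr.enlarge ?_ ?_ ?_ ?_ ?_
    · intro q
      by_cases hq : q = j
      · subst hq
        rcases hX with ⟨rfl, -⟩ | ⟨hXc, -, x, hx, y, hy, hxy⟩
        · simpa using hFr.conn q
        · simpa using (hFr.conn q).union_of_adj hXc hy hx hxy.symm
      · simpa [hq] using hFr.conn q
    · rintro q q' hq x ⟨rfl, -⟩ y ⟨rfl, -⟩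
      exact absurd rfl hq
    · rintro q q' hq x ⟨rfl, hx⟩ y hy
      refine ⟨fun h => notMem_D_of_mem_outside (hXU hx) q' (h ▸ hy), fun h => ?_⟩
      exact (hXanti x hx q' hq.symm).1 ⟨y, hy, h⟩
    · rintro q q' hq x ⟨rfl, hx⟩ y hy
      refine ⟨fun h => notMem_B_of_mem_outside (hXU hx) q' (h ▸ hy), fun h => ?_⟩
      exact (hXanti x hx q' hq.symm).2 ⟨y, hy, h⟩
    · rintro q _ rfl x ⟨-, hx⟩
      exact ⟨(hXU hx).1, (hXU hx).2.1⟩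
  obtain ⟨l, hli, hlj⟩ := hS.exists_third i j
  obtain ⟨r, hr⟩ := hF.exists_parity hG hS.exists_third
  have hDi : (enlarge S (fun q => {x | q = j ∧ x ∈ X}) i).D = (S i).D := by
    rw [enlarge_D]
    simp [hij]
  have H : TwoAtt G a (enlarge S fun q => {x | q = j ∧ x ∈ X}) r i j l v :=
    { hF with
      free := hG
      arm := hr
      ij := hij
      il := hli.symm
      jl := hlj.symm
      ne := hv.1.symm
      nadj := fun h => hv.2.1 h.symm
      notMem_D := by
        intro q
        rw [enlarge_D]
        rintro (h | ⟨-, h⟩)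
        · exact notMem_D_of_mem_outside hv q h
        · exact hvX h
      notMem_B := fun q => notMem_B_of_mem_outside (S := S) hv q
      att_i := hDi ▸ hvi
      att_j := by
        rw [enlarge_D]
        rcases hX with ⟨-, h⟩ | ⟨-, h, -⟩
        · exact h.mono Set.subset_union_left
        · exact h.mono fun x hx => Or.inr ⟨rfl, hx⟩ }
  refine H.false_of_reach_left hns ?_ hb (hn.mono Set.subset_union_left)
  intro d hd
  rw [hDi] at hd
  obtain ⟨f, m, hf, h0, hm, hC, s, hs, rfl⟩ :=
    (hS.proper i).exists_indSeq ((S i).D_subset_verts hd)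
  refine ⟨f, m, hf, h0, hm, fun q h1 h2 => Or.inl (hC q h1 h2), s, lt_of_le_of_ne hs ?_, rfl⟩
  rintro rfl
  exact (hS.proper i).disjoint_BD hm hd

end EvenHoles

/-! ### No outside component is attached to two strips. -/

namespace EvenHoles

variable {V : Type*} {G : SimpleGraph V}

variable {a : V} {k : ℕ} {S : Fin k → Triple V}

/-- A path outside the system attached to `A i` and `A j` at its ends and anticomplete to
`B ∪ C` in both strips yields an even hole. -/
theorem IsIndecomposableSystem.false_of_joined_A (hG : EvenHoleFree G)
    (hS : IsIndecomposableSystem G a S) {i j : Fin k} (hij : i ≠ j) {X : Set V}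
    (hXU : X ⊆ outside G a S) {x z : V} (hx : x ∈ (S i).A) (hz : z ∈ (S j).A) {n : ℕ}
    (hP : PathIn G X x z n)
    (hX : ∀ q, q = i ∨ q = j → ∀ y ∈ X, ¬ Att G y ((S q).B ∪ (S q).C)) : False := by
  have hFr := hS.frame
  have hxz := hFr.antiD i j hij x (Or.inl hx) z (Or.inl hz)
  have h1 := odd_of_anti_apex hG (hFr.adjA i x hx) (hFr.adjA j z hz) hxz.1
    (by rintro _ rfl y hy; exact ⟨(hXU hy).1, (hXU hy).2.1⟩) hP
  obtain ⟨b, hb, m₁, hm₁⟩ := hFr.rungA i x hx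
  obtain ⟨c, hc, m₂, hm₂⟩ := hFr.rungA j z hz
  obtain ⟨h2, h3⟩ := hFr.arm_of_rung hx hb hm₁
  obtain ⟨h4, h5⟩ := hFr.arm_of_rung hz hc hm₂
  have h6 := hFr.arm_parity_of_ne hG hij hb hc (h3.mono (Triple.insert_subset_D hx))
    (h5.mono (Triple.insert_subset_D hz))
  have h7 := hFr.path_across hxz.1 hxz.2 hij (S i).C_subset_D (S j).C_subset_D hb hc hm₁ hm₂
    (hm₁.ne_of_pos h2) (hm₂.ne_of_pos h4) (by
      rintro _ rfl y (rfl | hy)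
      · exact hFr.antiDB i j hij _ (Or.inl hx) _ hc
      · exact hFr.antiD i j hij _ (Or.inl hx) _ (Or.inr hy)) (by
      rintro _ rfl y (rfl | hy)
      · exact hFr.antiDB j i hij.symm _ (Or.inl hz) _ hb
      · exact hFr.antiD j i hij.symm _ (Or.inl hz) _ (Or.inr hy))
  have key : ∀ q, q = i ∨ q = j → ∀ y ∈ X, ∀ w ∈ (S q).B ∪ (S q).C, y ≠ w ∧ ¬ G.Adj y w := by
    intro q hq y hy w hw
    refine ⟨?_, fun h => hX q hq y hy ⟨w, hw, h⟩⟩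
    rintro rfl
    rcases hw with hw | hw
    · exact notMem_B_of_mem_outside (hXU hy) q hw
    · exact notMem_D_of_mem_outside (hXU hy) q (Or.inr hw)
  have := hP.odd_add hG h7 hxz.1 hxz.2 (by
    rintro y hy w (rfl | rfl | hw | hw)
    · exact key i (Or.inl rfl) y hy _ (Or.inl hb)
    · exact key j (Or.inr rfl) y hy _ (Or.inl hc)
    · exact key i (Or.inl rfl) y hy _ (Or.inr hw)
    · exact key j (Or.inr rfl) y hy _ (Or.inr hw))
  omega

/-- By induction on its length, the linking path is attached to strips only at its ends. Each end
can then see only the set `A` of its strip, so adding vertices of `A i` and `A j` gives the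
situation of `false_of_joined_A`. -/
theorem IsMaximalSystem.not_joined (hG : EvenHoleFree G) (hS : IsMaximalSystem G a S)
    (hns : ¬ HasExtendedNearPrismAt G a) {n : ℕ} : ∀ {f g : V} {i j : Fin k}, i ≠ j →
      f ∈ outside G a S → g ∈ outside G a S → PathIn G (outside G a S) f g n →
      Att G f (S i).D → ¬ Att G g (S j).D := by
  induction n using Nat.strong_induction_on with
  | _ n ih =>
  intro f g i j hij hf hg hfg hfi hgj
  have hI := hS.indecomposable
  have hFr := hI.frame
  obtain ⟨F, hF, rfl, rfl, hFU⟩ := hfg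
  have hU : ∀ m ≤ n, F m ∈ outside G a S := by
    intro m hm
    rcases Nat.eq_zero_or_pos m with rfl | h0
    · exact hf
    rcases hm.lt_or_eq with hm | rfl
    · exact hFU m h0 hm
    · exact hg
  have hseg : ∀ p q, p ≤ q → q ≤ n → PathIn G (outside G a S) (F p) (F q) (q - p) := by
    intro p q hpq hq
    refine (hF.pathIn_segment hpq hq).mono ?_
    rintro _ ⟨m, h1, h2, rfl⟩
    exact hU m (by omega)
  -- only the first vertex is attached to strips other than `j`
  have hleft : ∀ m < n, ∀ l, l ≠ i → ¬ Att G (F m) (S l).D := by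
    intro m hm l hl h
    exact ih m hm hl.symm hf (hU m hm.le) (by simpa using hseg 0 m (Nat.zero_le _) hm.le) hfi h
  have hright : ∀ m, 0 < m → m ≤ n → ∀ l, l ≠ j → ¬ Att G (F m) (S l).D := by
    intro m h0 hm l hl h
    exact ih (n - m) (by omega) hl (hU m hm) hg (hseg m n hm le_rfl) h hgj
  have hconn : ∀ p q, p ≤ q → q ≤ n → ConnectedSet G {x | ∃ m, p ≤ m ∧ m ≤ q ∧ F m = x} := by
    intro p q hpq hq
    have := connectedSet_segment (G := G) (f := F) p (q - p) fun m _ h => hF.adj m (by omega)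
    rwa [show p + (q - p) = q by omega] at this
  -- The path without its last vertex is a connected set attached to the strip `i` only;
  -- symmetrically, without its first vertex, to `j` only.
  have hleftB : ∀ m < n, ∀ l, l ≠ i → ¬ Att G (F m) (S l).B := by
    intro m hm l hl
    refine hS.not_att_B hG (hconn 0 (n - 1) (by omega) (by omega)) ?_ (f₀ := F 0) (i := i)
      ⟨0, by omega, by omega, rfl⟩ hfi ?_ hl ⟨m, by omega, by omega, rfl⟩
    · rintro _ ⟨m, h1, h2, rfl⟩
      exact hU m (by omega)
    · rintro l hl _ ⟨m, h1, h2, rfl⟩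
      exact hleft m (by omega) l hl
  have hrightB : ∀ m, 0 < m → m ≤ n → ∀ l, l ≠ j → ¬ Att G (F m) (S l).B := by
    intro m h0 hm l hl
    refine hS.not_att_B hG (hconn 1 n (by omega) le_rfl) ?_ (f₀ := F n) (i := j)
      ⟨n, by omega, by omega, rfl⟩ hgj ?_ hl ⟨m, by omega, by omega, rfl⟩
    · rintro _ ⟨m, h1, h2, rfl⟩
      exact hU m (by omega)
    · rintro l hl _ ⟨m, h1, h2, rfl⟩
      exact hright m (by omega) h2 l hl
  have hf' : ¬ Att G (F 0) ((S i).B ∪ (S i).C) := by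
    refine hI.not_att_of_joined hG hns hij (X := {x | ∃ m, 1 ≤ m ∧ m ≤ n ∧ F m = x}) hf ?_ ?_ hfi
      ?_ ?_
    · rintro _ ⟨m, h1, h2, rfl⟩
      exact hU m h2
    · rintro ⟨m, h1, h2, h⟩
      exact hF.inj 0 m h1 h2 h.symm
    · rcases Nat.eq_zero_or_pos n with rfl | h0
      · refine Or.inl ⟨?_, hgj⟩
        ext x
        simp only [Set.mem_ofPred_eq, Set.mem_empty_iff_false, iff_false]
        rintro ⟨m, h1, h2, -⟩
        omega
      · exact Or.inr ⟨hconn 1 n h0 le_rfl, ⟨F 1, ⟨1, le_rfl, h0, rfl⟩, hF.adj 0 h0⟩, F n,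
          ⟨n, h0, le_rfl, rfl⟩, hgj⟩
    · rintro _ ⟨m, h1, h2, rfl⟩ l hl
      exact ⟨hright m h1 h2 l hl, hrightB m h1 h2 l hl⟩
  have hg' : ¬ Att G (F n) ((S j).B ∪ (S j).C) := by
    refine hI.not_att_of_joined hG hns hij.symm (X := {x | ∃ m, 0 ≤ m ∧ m ≤ n - 1 ∧ 0 < n ∧ F m = x})
      hg ?_ ?_ hgj ?_ ?_
    · rintro _ ⟨m, h1, h2, -, rfl⟩
      exact hU m (by omega)
    · rintro ⟨m, h1, h2, h3, h⟩
      exact hF.inj m n (by omega) le_rfl h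
    · rcases Nat.eq_zero_or_pos n with rfl | h0
      · refine Or.inl ⟨?_, hfi⟩
        ext x
        simp
      · refine Or.inr ⟨?_, ⟨F (n - 1), ⟨n - 1, by omega, le_rfl, h0, rfl⟩, ?_⟩, F 0,
          ⟨0, by omega, by omega, h0, rfl⟩, hfi⟩
        · convert hconn 0 (n - 1) (by omega) (by omega) using 6
          simp [h0]
        · have := hF.adj (n - 1) (by omega)
          rw [show n - 1 + 1 = n by omega] at this
          exact this.symm
    · rintro _ ⟨m, h1, h2, h3, rfl⟩ l hl
      exact ⟨hleft m (by omega) l hl, hleftB m (by omega) l hl⟩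
  -- so `F 0` and `F n` are attached to `A i` and `A j`
  have hA : ∀ {v : V} {q : Fin k}, Att G v (S q).D → ¬ Att G v ((S q).B ∪ (S q).C) →
      ∃ x ∈ (S q).A, G.Adj v x := by
    rintro v q ⟨x, hx | hx, h⟩ hn
    · exact ⟨x, hx, h⟩
    · exact absurd ⟨x, Or.inr hx, h⟩ hn
  obtain ⟨x, hx, hfx⟩ := hA hfi hf'
  obtain ⟨z, hz, hgz⟩ := hA hgj hg'
  have hXU : {y | ∃ m ≤ n, F m = y} ⊆ outside G a S := by
    rintro _ ⟨m, h, rfl⟩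
    exact hU m h
  have hX : ∀ q, q = i ∨ q = j → ∀ y ∈ {y | ∃ m ≤ n, F m = y},
      ¬ Att G y ((S q).B ∪ (S q).C) := by
    rintro q hq _ ⟨m, hm, rfl⟩ ⟨s, hs, hms⟩
    have hsplit : (m = 0 ∧ q = i) ∨ (m = n ∧ q = j) ∨
        (¬ Att G (F m) (S q).B ∧ ¬ Att G (F m) (S q).D) := by
      rcases hq with rfl | rfl
      · rcases Nat.eq_zero_or_pos m with h0 | h0
        · exact Or.inl ⟨h0, rfl⟩
        · exact Or.inr (Or.inr ⟨hrightB m h0 hm _ hij, hright m h0 hm _ hij⟩)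
      · rcases hm.lt_or_eq with h0 | h0
        · exact Or.inr (Or.inr ⟨hleftB m h0 _ hij.symm, hleft m h0 _ hij.symm⟩)
        · exact Or.inr (Or.inl ⟨h0, rfl⟩)
    rcases hsplit with ⟨rfl, rfl⟩ | ⟨rfl, rfl⟩ | ⟨h1, h2⟩
    · exact hf' ⟨s, hs, hms⟩
    · exact hg' ⟨s, hs, hms⟩
    · rcases hs with hs | hs
      · exact h1 ⟨s, hs, hms⟩
      · exact h2 ⟨s, Or.inr hs, hms⟩
  have hxz : x ≠ z := (hFr.antiD i j hij x (Or.inl hx) z (Or.inl hz)).1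
  have hmem : ∀ m ≤ n, F m ∈ {y | ∃ m ≤ n, F m = y} := fun m h => ⟨m, h, rfl⟩
  obtain ⟨p, hp⟩ := exists_pathIn_of_seq (G := G) (S := {y | ∃ m ≤ n, F m = y}) (n := n + 2)
    (f := fun m => if m = 0 then x else if m ≤ n + 1 then F (m - 1) else z) (by
      intro m hm
      rcases Nat.eq_zero_or_pos m with rfl | h0
      · simpa using hfx.symm
      · rcases Nat.lt_or_ge m (n + 1) with h1 | h1
        · have := hF.adj (m - 1) (by omega)
          simpa [h0.ne', show m ≤ n + 1 by omega, show m + 1 ≤ n + 1 by omega,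
            show m - 1 + 1 = m by omega, show m ≤ n by omega] using this
        · have : m = n + 1 := by omega
          subst this
          simpa using hgz) (by
      intro m h0 hm
      simpa [h0.ne', show m ≤ n + 1 by omega] using hmem (m - 1) (by omega))
  exact hI.false_of_joined_A hG hij hXU hx hz (by simpa using hp) hX

end EvenHoles

/-! ### Absorbing the outside components: the core of a maximal system. -/

namespace EvenHoles

variable {V : Type*} {G : SimpleGraph V}

section

variable {a : V} {ι : Type*} {S : ι → Triple V}

/-- The vertices of `outside G a S` joined within this set to a vertex attached to `D i`. -/
def joined (G : SimpleGraph V) (a : V) (S : ι → Triple V) (i : ι) : Set V :=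
  {w ∈ outside G a S | ∃ f ∈ outside G a S, Att G f (S i).D ∧
    ∃ n, PathIn G (outside G a S) w f n}

/-- The vertices of `outside G a S` not joined to any strip. -/
def unjoined (G : SimpleGraph V) (a : V) (S : ι → Triple V) : Set V :=
  {w ∈ outside G a S | ∀ i, w ∉ joined G a S i}

theorem joined_subset (i : ι) : joined G a S i ⊆ outside G a S := Set.sep_subset _ _

theorem mem_joined_of_att {f : V} {i : ι} (hf : f ∈ outside G a S) (h : Att G f (S i).D) :
    f ∈ joined G a S i :=
  ⟨hf, f, hf, h, 0, .refl _ _⟩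

theorem mem_joined_of_path {x y : V} {i : ι} {n : ℕ} (hx : x ∈ joined G a S i)
    (hy : y ∈ outside G a S) (h : PathIn G (outside G a S) x y n) : y ∈ joined G a S i := by
  obtain ⟨hxU, f, hf, hfi, m, hm⟩ := hx
  by_cases hyf : y = f
  · subst hyf
    exact mem_joined_of_att hy hfi
  · obtain ⟨k, hk⟩ := h.symm.trans hm hyf
    refine ⟨hy, f, hf, hfi, k, hk.mono ?_⟩
    rw [Set.union_self]
    exact Set.insert_subset hxU subset_rfl

theorem mem_joined_of_adj {x y : V} {i : ι} (hx : x ∈ joined G a S i)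
    (hy : y ∈ outside G a S) (h : G.Adj x y) : y ∈ joined G a S i :=
  mem_joined_of_path hx hy (.of_adj _ h)

theorem exists_connectedSet_of_mem_joined {x : V} {i : ι} (hx : x ∈ joined G a S i) :
    ∃ F ⊆ joined G a S i, ConnectedSet G F ∧ x ∈ F ∧ ∃ f ∈ F, Att G f (S i).D := by
  obtain ⟨hxU, f, hf, hfi, n, F, hF, rfl, rfl, hFU⟩ := id hx
  refine ⟨{y | ∃ m, 0 ≤ m ∧ m ≤ 0 + n ∧ F m = y}, ?_,
    connectedSet_segment 0 n fun m _ h => hF.adj m (by omega), ⟨0, le_rfl, by omega, rfl⟩, F n,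
    ⟨n, by omega, by omega, rfl⟩, hfi⟩
  rintro _ ⟨m, -, hm, rfl⟩
  have hU : F m ∈ outside G a S := by
    rcases Nat.eq_zero_or_pos m with rfl | h0
    · exact hxU
    rcases (show m ≤ n by omega).lt_or_eq with h1 | rfl
    · exact hFU m h0 h1
    · exact hf
  refine mem_joined_of_path hx hU ((hF.pathIn_segment (Nat.zero_le m) (by omega)).mono ?_)
  rintro _ ⟨m', h1, h2, rfl⟩
  exact hFU m' h1 (by omega)

theorem pathIn_joined {x w : V} {i : ι} {n : ℕ} (hx : x ∈ joined G a S i) (hxw : x ≠ w)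
    (h : PathIn G (outside G a S) x w n) :
    PathIn G (joined G a S i) x w n ∧ Att G w (joined G a S i) := by
  have hn := h.pos_of_ne hxw
  obtain ⟨F, hF, rfl, rfl, hFU⟩ := h
  have key : ∀ m < n, F m ∈ joined G a S i := by
    intro m hm
    rcases Nat.eq_zero_or_pos m with rfl | h0
    · exact hx
    refine mem_joined_of_path hx (hFU m h0 hm)
      ((hF.pathIn_segment (Nat.zero_le m) (by omega)).mono ?_)
    rintro _ ⟨m', h1, h2, rfl⟩
    exact hFU m' h1 (by omega)
  refine ⟨⟨F, hF, rfl, rfl, fun m _ h => key m h⟩, F (n - 1), key _ (by omega), ?_⟩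
  have := hF.adj (n - 1) (by omega)
  rw [show n - 1 + 1 = n by omega] at this
  exact this.symm

theorem pathIn_unjoined {x w : V} {n : ℕ} (hx : x ∈ unjoined G a S) (hxw : x ≠ w)
    (h : PathIn G (outside G a S) x w n) :
    PathIn G (unjoined G a S) x w n ∧ Att G w (unjoined G a S) := by
  have hn := h.pos_of_ne hxw
  obtain ⟨F, hF, rfl, rfl, hFU⟩ := h
  have key : ∀ m < n, F m ∈ unjoined G a S := by
    intro m hm
    rcases Nat.eq_zero_or_pos m with rfl | h0
    · exact hx
    refine ⟨hFU m h0 hm, fun i hi => hx.2 i ?_⟩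
    refine mem_joined_of_path hi hx.1
      ((hF.pathIn_segment (Nat.zero_le m) (by omega)).symm.mono ?_)
    rintro _ ⟨m', h1, h2, rfl⟩
    exact hFU m' h1 (by omega)
  refine ⟨⟨F, hF, rfl, rfl, fun m _ h => key m h⟩, F (n - 1), key _ (by omega), ?_⟩
  have := hF.adj (n - 1) (by omega)
  rw [show n - 1 + 1 = n by omega] at this
  exact this.symm

end

variable {a : V} {k : ℕ} {S : Fin k → Triple V}

theorem IsMaximalSystem.joined_disjoint (hG : EvenHoleFree G) (hS : IsMaximalSystem G a S)
    (hns : ¬ HasExtendedNearPrismAt G a) {i j : Fin k} (hij : i ≠ j) {x : V}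
    (hi : x ∈ joined G a S i) : x ∉ joined G a S j := by
  rintro ⟨hx, g, hg, hgj, n, hn⟩
  obtain ⟨-, f, hf, hfi, m, hm⟩ := hi
  by_cases hfg : f = g
  · subst hfg
    exact hS.not_joined hG hns hij hf hf (.refl _ _) hfi hgj
  · obtain ⟨k, hk⟩ := hm.symm.trans hn hfg
    refine hS.not_joined hG hns hij hf hg (hk.mono ?_) hfi hgj
    rw [Set.union_self]
    exact Set.insert_subset hx subset_rfl

theorem IsMaximalSystem.anti_joined_D (hG : EvenHoleFree G) (hS : IsMaximalSystem G a S)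
    (hns : ¬ HasExtendedNearPrismAt G a) {i j : Fin k} (hij : i ≠ j) :
    Anti G (joined G a S i) (S j).D := by
  intro x hx y hy
  refine ⟨?_, fun h => ?_⟩
  · rintro rfl
    exact notMem_D_of_mem_outside hx.1 j hy
  · exact hS.joined_disjoint hG hns hij hx (mem_joined_of_att hx.1 ⟨y, hy, h⟩)

theorem IsMaximalSystem.anti_joined_B (hG : EvenHoleFree G) (hS : IsMaximalSystem G a S)
    (hns : ¬ HasExtendedNearPrismAt G a) {i j : Fin k} (hij : i ≠ j) :
    Anti G (joined G a S i) (S j).B := by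
  intro x hx y hy
  refine ⟨?_, fun h => ?_⟩
  · rintro rfl
    exact notMem_B_of_mem_outside hx.1 j hy
  · obtain ⟨F, hF, hFc, hxF, f, hf, hfi⟩ := exists_connectedSet_of_mem_joined hx
    refine hS.not_att_B hG hFc (hF.trans (joined_subset i)) hf hfi ?_ hij.symm hxF ⟨y, hy, h⟩
    rintro l hl z hz ⟨w, hw, hzw⟩
    exact (hS.anti_joined_D hG hns hl.symm z (hF hz) w hw).2 hzw

theorem IsMaximalSystem.frame_joined (hG : EvenHoleFree G) (hS : IsMaximalSystem G a S)
    (hns : ¬ HasExtendedNearPrismAt G a) : Frame G a (EvenHoles.enlarge S (joined G a S)) := by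
  have hI := hS.indecomposable
  have hFr := hI.frame
  refine hFr.enlarge ?_ ?_ (fun i j hij => hS.anti_joined_D hG hns hij)
    (fun i j hij => hS.anti_joined_B hG hns hij) ?_
  · intro i
    refine (hFr.conn i).of_patches Set.subset_union_left ?_
    rintro v (hv | hv)
    · exact ⟨_, Set.subset_union_left, hFr.conn i, hv, v, hv, hv⟩
    · obtain ⟨F, hF, hFc, hvF, f, hf, d, hd, hfd⟩ := exists_connectedSet_of_mem_joined hv
      exact ⟨(S i).D ∪ F, Set.union_subset_union_right _ hF,
        (hFr.conn i).union_of_adj hFc hd hf hfd.symm, Or.inr hvF, d, hd, Or.inl hd⟩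
  · intro i j hij x hx y hy
    refine ⟨?_, fun h => ?_⟩
    · rintro rfl
      exact hS.joined_disjoint hG hns hij hx hy
    · exact hS.joined_disjoint hG hns hij hx (mem_joined_of_adj hy hx.1 h.symm)
  · rintro i _ rfl x hx
    exact ⟨hx.1.1, hx.1.2.1⟩

theorem mem_closedNbhd_compl {w : V} : w ∈ (closedNbhd G a)ᶜ ↔ a ≠ w ∧ ¬ G.Adj a w := by
  simp [closedNbhd, eq_comm]

theorem IsIndecomposableSystem.mem_BC_or_outside (hS : IsIndecomposableSystem G a S) {w : V}
    (hw : a ≠ w ∧ ¬ G.Adj a w) : (∃ i, w ∈ (S i).B ∪ (S i).C) ∨ w ∈ outside G a S := by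
  by_cases h : ∃ i, w ∈ (S i).verts
  · obtain ⟨i, (h | h) | h⟩ := h
    · exact absurd (hS.apex_complete i w h) hw.2
    · exact Or.inl ⟨i, Or.inl h⟩
    · exact Or.inl ⟨i, Or.inr h⟩
  · exact Or.inr ⟨hw.1, hw.2, fun j hj => h ⟨j, hj⟩⟩

theorem IsIndecomposableSystem.exists_path_of_mem_outside (hS : IsIndecomposableSystem G a S)
    (hW : ConnectedSet G (closedNbhd G a)ᶜ) {x : V} (hx : x ∈ outside G a S) :
    ∃ i, ∃ w ∈ (S i).B ∪ (S i).C, ∃ n, PathIn G (outside G a S) x w n := by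
  have hFr := hS.frame
  have i₀ : Fin k := ⟨0, by have := hS.three_le; omega⟩
  obtain ⟨b, hb⟩ := hFr.nonempty_B i₀
  obtain ⟨n, hn⟩ := hW.exists_pathIn_mem (mem_closedNbhd_compl.2 ⟨hx.1, hx.2.1⟩)
    (mem_closedNbhd_compl.2 (hFr.antiB i₀ a rfl b hb))
  obtain ⟨w, m, -, -, ⟨i, hw⟩, h, -⟩ := hn.exists_split (fun v => ∃ i, v ∈ (S i).B ∪ (S i).C)
    ⟨i₀, Or.inl hb⟩
  refine ⟨i, w, hw, m, h.mono ?_⟩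
  rintro v ⟨hv, hv'⟩
  exact (hS.mem_BC_or_outside (mem_closedNbhd_compl.1 hv)).resolve_left hv'

/-- Connectedness of the nonneighbours of `a` gives every outside vertex a path into some `B ∪ C`.
From a component joined to the strip `i` it can only enter that strip; from an unjoined one it can
only enter a base. -/
theorem IsMaximalSystem.core (hG : EvenHoleFree G) (hS : IsMaximalSystem G a S)
    (hns : ¬ HasExtendedNearPrismAt G a) (hW : ConnectedSet G (closedNbhd G a)ᶜ) :
    ∃ r, Core G a (EvenHoles.enlarge S (joined G a S)) (unjoined G a S) r := by
  have hI := hS.indecomposable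
  have hF := hS.frame_joined hG hns
  obtain ⟨r, hr⟩ := hF.exists_parity hG hI.exists_third
  have hne : ∀ {x w i}, x ∈ outside G a S → w ∈ (S i).B ∪ (S i).C → x ≠ w := by
    rintro x w i hx (hw | hw) rfl
    · exact notMem_B_of_mem_outside hx i hw
    · exact notMem_D_of_mem_outside hx i (Or.inr hw)
  refine ⟨r, { hF with
    three := hI.exists_third
    parity := hr
    antiR := ?_, apexR := ?_, disjointR := ?_, reachC := ?_, reachR := ?_ }⟩
  · intro i
    rw [enlarge_D]
    rintro x hx y (hy | hy)
    · refine ⟨?_, fun h => hx.2 i (mem_joined_of_att hx.1 ⟨y, hy, h⟩)⟩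
      rintro rfl
      exact notMem_D_of_mem_outside hx.1 i hy
    · refine ⟨?_, fun h => hx.2 i (mem_joined_of_adj hy hx.1 h.symm)⟩
      rintro rfl
      exact hx.2 i hy
  · rintro _ rfl x hx
    exact ⟨hx.1.1, hx.1.2.1⟩
  · exact fun i x hx => notMem_B_of_mem_outside hx.1 i
  · rintro i c (hc | hc)
    · obtain ⟨b, hb, n, hn⟩ := (hI.proper i).exists_path_of_mem_C hc
      exact ⟨b, hb, n, hn.mono Set.subset_union_left⟩
    · obtain ⟨l, w, hw, n, hn⟩ := hI.exists_path_of_mem_outside hW hc.1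
      obtain ⟨h1, e, he, hwe⟩ := pathIn_joined hc (hne hc.1 hw) hn
      have hli : l = i := by
        by_contra hli
        rcases hw with hw | hw
        · exact (hS.anti_joined_B hG hns (Ne.symm hli) e he w hw).2 hwe.symm
        · exact (hS.anti_joined_D hG hns (Ne.symm hli) e he w (Or.inr hw)).2 hwe.symm
      subst hli
      rcases hw with hw | hw
      · exact ⟨w, hw, n, h1.mono Set.subset_union_right⟩
      · obtain ⟨b, hb, m, hm⟩ := (hI.proper l).exists_path_of_mem_C hw
        obtain ⟨q, hq⟩ := h1.trans hm (hne hc.1 (Or.inl hb))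
        refine ⟨b, hb, q, hq.mono ?_⟩
        exact Set.insert_subset (Or.inl hw)
          (Set.union_subset Set.subset_union_right Set.subset_union_left)
  · intro x hx
    obtain ⟨l, w, hw, n, hn⟩ := hI.exists_path_of_mem_outside hW hx.1
    obtain ⟨h1, e, he, hwe⟩ := pathIn_unjoined hx (hne hx.1 hw) hn
    rcases hw with hw | hw
    · exact ⟨l, w, hw, n, h1⟩
    · exact absurd (mem_joined_of_att he.1 ⟨w, Or.inr hw, hwe.symm⟩) (he.2 l)

end EvenHoles

/-! ### Paths from a neighbour of the apex to the bases. -/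

namespace EvenHoles

variable {V : Type*} {G : SimpleGraph V}

theorem IndSeq.snoc {f : ℕ → V} {n : ℕ} (hf : IndSeq G f n) {c : V} (hc : G.Adj (f n) c)
    (h : ∀ i, i < n → f i ≠ c ∧ ¬ G.Adj (f i) c) :
    IndSeq G (fun m => if m ≤ n then f m else c) (n + 1) := by
  refine ⟨?_, ?_, ?_⟩
  · intro i hi
    rw [if_pos (by omega)]
    rcases (show i ≤ n by omega).lt_or_eq with h1 | rfl
    · rw [if_pos (by omega)]
      exact hf.adj i h1
    · rw [if_neg (by omega)]
      exact hc
  · intro i j hij hj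
    rw [if_pos (by omega : i ≤ n)]
    split_ifs with h1
    · exact hf.chordless i j hij h1
    · exact (h i (by omega)).2
  · intro i j hij hj
    rw [if_pos (by omega : i ≤ n)]
    split_ifs with h1
    · exact hf.inj i j hij h1
    · rcases (show i ≤ n by omega).lt_or_eq with h2 | rfl
      · exact (h i h2).1
      · exact hc.ne

variable {a : V} {k : ℕ} {S : Fin k → Triple V}

/-- `v` lies in a base or has a neighbour in one. -/
def NearB (G : SimpleGraph V) {ι : Type*} (S : ι → Triple V) (v : V) : Prop :=
  ∃ q, v ∈ (S q).B ∨ ∃ c ∈ (S q).B, G.Adj v c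

/-- From every neighbour `y` of the apex outside the system there is a path to the first vertex with
a neighbour in the bases. -/
theorem IsMaximalSystem.exists_path_nearB {r : ℕ}
    (hS : IsMaximalSystem G a S)
    (K : Core G a (EvenHoles.enlarge S (joined G a S)) (unjoined G a S) r) {y : V}
    (hyV : ∀ j, y ∉ (S j).verts)
    (hfar : (∃ i, Att G y ((S i).B ∪ ((S i).C ∪ joined G a S i))) ∨ Att G y (unjoined G a S)) :
    ∃ (T : Set V) (F : ℕ → V) (m : ℕ),
      (T ⊆ unjoined G a S ∨ ∃ l, T ⊆ (S l).C ∪ joined G a S l) ∧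
      IndSeq G F m ∧ F 0 = y ∧ (∀ p, 0 < p → p ≤ m → F p ∈ T) ∧ (∀ p < m, ¬ NearB G S (F p)) ∧
      ∃ q, ∃ c ∈ (S q).B, G.Adj (F m) c := by
  have hI := hS.indecomposable
  obtain ⟨T, l, b, n, hT, hb, hn⟩ : ∃ (T : Set V) (l : Fin k) (b : V) (n : ℕ),
      (T ⊆ unjoined G a S ∨ ∃ l, T ⊆ (S l).C ∪ joined G a S l) ∧ b ∈ (S l).B ∧
      PathIn G T y b n := by
    rcases hfar with ⟨i, h⟩ | ⟨s, hs, h⟩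
    · obtain ⟨b, hb, n, hn⟩ := K.exists_path_to_B (i := i) h
      exact ⟨_, i, b, n, Or.inr ⟨i, subset_rfl⟩, hb, hn⟩
    · obtain ⟨i, b, hb, n, hn⟩ := K.reachR s hs
      obtain ⟨m, hm⟩ := hn.exists_prepend h hs
      exact ⟨_, i, b, m, Or.inl subset_rfl, hb, hm⟩
  have hTB : ∀ x ∈ T, ∀ q, x ∉ (S q).B := by
    intro x hx q hxq
    rcases hT with hT | ⟨l, hT⟩
    · exact notMem_B_of_mem_outside (hT hx).1 q hxq
    · rcases hT hx with h | h
      · by_cases hlq : l = q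
        · subst hlq
          exact (hI.proper l).disjoint_BD hxq (Or.inr h)
        · exact (hI.frame.antiDB l q hlq x (Or.inr h) x hxq).1 rfl
      · exact notMem_B_of_mem_outside h.1 q hxq
  obtain ⟨e, m, m', -, he, h1, h2, h3, h4⟩ :=
    hn.exists_split (fun v => NearB G S v) ⟨l, Or.inl hb⟩
  have hyB : ∀ q, y ∉ (S q).B := fun q h => hyV q (Or.inl (Or.inr h))
  obtain ⟨F, hF, rfl, rfl, hFT⟩ := h1
  have hnear : ∀ p < m, ¬ NearB G S (F p) := by
    intro p hp
    rcases Nat.eq_zero_or_pos p with rfl | h0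
    · exact h3 hp
    · exact (hFT p h0 hp).2
  have heB : ∀ q, F m ∉ (S q).B := by
    intro q hq
    rcases Nat.eq_zero_or_pos m with rfl | h0
    · exact hyB q hq
    · refine hnear (m - 1) (by omega) ⟨q, Or.inr ⟨_, hq, ?_⟩⟩
      have := hF.adj (m - 1) (by omega)
      rwa [show m - 1 + 1 = m by omega] at this
  refine ⟨T, F, m, hT, hF, rfl, ?_, hnear, ?_⟩
  · intro p h0 hp
    rcases hp.lt_or_eq with hp | rfl
    · exact (hFT p h0 hp).1
    · refine h4 h0 (Nat.pos_of_ne_zero ?_)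
      rintro rfl
      obtain ⟨f, -, h5, h6, -⟩ := h2
      exact heB l (h5.symm.trans h6 ▸ hb)
  · obtain ⟨q, h | h⟩ := he
    · exact absurd h (heB q)
    · exact ⟨q, h⟩

/-- If the last vertex of a path starting at a neighbour of `a` has a neighbour in the base of a
strip to which the path is anticomplete, then it is complete to the bases of all such strips. -/
theorem Frame.adj_of_adj_of_anti {ι : Type*} {S : ι → Triple V} (hG : EvenHoleFree G)
    (hFr : Frame G a S) {F : ℕ → V} {m : ℕ} (hF : IndSeq G F m) (hay : G.Adj a (F 0))
    (haF : ∀ p, 0 < p → p ≤ m → a ≠ F p ∧ ¬ G.Adj a (F p)) (hnear : ∀ p < m, ¬ NearB G S (F p))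
    (hB : ∀ q, F m ∉ (S q).B) {i j : ι} (hij : i ≠ j)
    (hi : ∀ p ≤ m, Anti G {F p} (S i).D) (hj : ∀ p ≤ m, Anti G {F p} (S j).D) {c d : V}
    (hc : c ∈ (S i).B) (hd : d ∈ (S j).B) (hec : G.Adj (F m) c) : G.Adj (F m) d := by
  by_contra hed
  have hac := hFr.antiB i a rfl c hc
  have had := hFr.antiB j a rfl d hd
  have hcd := hFr.adjB i j hij c hc d hd
  have hne : F m ≠ d := by
    intro h
    exact hB j (h ▸ hd)
  have hnc : ∀ p < m, ∀ q, ∀ x ∈ (S q).B, F p ≠ x ∧ ¬ G.Adj (F p) x := by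
    refine fun p hp q x hx => ⟨?_, fun h => hnear p hp ⟨q, Or.inr ⟨x, hx, h⟩⟩⟩
    intro h
    exact hnear p hp ⟨q, Or.inl (h ▸ hx)⟩
  obtain ⟨n₁, h1⟩ := hFr.exists_arm hc
  obtain ⟨n₂, h2⟩ := hFr.exists_arm hd
  have h3 := hFr.arm_parity_of_ne hG hij hc hd h1 h2
  have hP : PathIn G {x | ∃ p < m, F p = x} a (F m) (m + 1) := by
    refine ⟨_, hF.cons hay haF, by simp, by simp, fun p h0 hp => ?_⟩
    rw [if_neg (by omega)]
    exact ⟨p - 1, by omega, rfl⟩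
  have h4 := hP.snoc hec (by
    rintro x (rfl | ⟨p, hp, rfl⟩) _ rfl
    · exact hac
    · exact hnc p hp i _ hc) (by omega)
  have h5 := h4.snoc hcd (by
    rintro x (rfl | rfl | ⟨p, hp, rfl⟩) _ rfl
    · exact had
    · exact ⟨hne, hed⟩
    · exact hnc p hp j _ hd) (by omega)
  have h6 := h4.odd_add hG h1 hac.1 hac.2 (by
    rintro x (rfl | ⟨p, hp, rfl⟩) z hz
    · exact hi m le_rfl _ rfl z hz
    · exact hi p hp.le _ rfl z hz)
  have h7 := h5.odd_add hG h2 had.1 had.2 (by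
    rintro x (rfl | rfl | ⟨p, hp, rfl⟩) z hz
    · exact (hFr.antiDB j i hij.symm).symm _ hc z hz
    · exact hj m le_rfl _ rfl z hz
    · exact hj p hp.le _ rfl z hz)
  omega

end EvenHoles

/-! ### A neighbour of the apex outside the system misses at most one strip. -/

namespace EvenHoles

variable {V : Type*} {G : SimpleGraph V}

section

variable {a : V} {k : ℕ} {S : Fin k → Triple V}

/-- The bases of two strips missed by a neighbour of a splendid apex are not both complete to it. -/
theorem Frame.false_of_adj_bases {ι : Type*} {S : ι → Triple V} (hF : Frame G a S)
    (hns : ¬ HasShortPyramid G a) {y : V} (hay : G.Adj a y) {i j : ι} (hij : i ≠ j)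
    (hi : Anti G {y} (S i).D) (hj : Anti G {y} (S j).D) {b c : V} (hb : b ∈ (S i).B)
    (hc : c ∈ (S j).B) (hyb : G.Adj y b) (hyc : G.Adj y c) : False := by
  have hab := hF.antiB i a rfl b hb
  have hac := hF.antiB j a rfl c hc
  obtain ⟨m, hm⟩ := hF.exists_arm hb
  obtain ⟨n, hn⟩ := hF.exists_arm hc
  refine hns (hasShortPyramid hay hyb hyc (hF.adjB i j hij b hb c hc) hm hn
    (hm.two_le hab.1 hab.2) (hn.two_le hac.1 hac.2) ?_ ?_ ?_)
  · rintro x hx _ (rfl | hz)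
    · exact hF.antiDB i j hij x hx _ hc
    · exact hF.antiD i j hij x hx _ hz
  · exact (hF.antiDB j i hij.symm).mono subset_rfl (Set.singleton_subset_iff.2 hb)
  · rintro x hx z (hz | hz)
    · exact hi x hx z hz
    · exact hj x hx z hz

/-- Suppose that `y` misses the strips `i` and `j`, and follow a path from `y` to the first vertex
`F m` with a neighbour in a base. The path touches neither `D i` nor `D j`, so two strips survive
when the touched ones are merged with it. If `F m` sees an untouched base, it is complete to all
untouched bases and the path can be merged as it is, unless `m = 0`, when there is a short pyramid.
Otherwise the path is first extended by a vertex of a touched base. -/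
theorem IsMaximalSystem.att_or_att (hG : EvenHoleFree G) (hS : IsMaximalSystem G a S)
    (hns : ¬ HasShortPyramid G a) {r : ℕ}
    (K : Core G a (EvenHoles.enlarge S (joined G a S)) (unjoined G a S) r) {y : V}
    (hay : G.Adj a y) (hyV : ∀ j, y ∉ (S j).verts)
    (hfar : (∃ i, Att G y ((S i).B ∪ ((S i).C ∪ joined G a S i))) ∨ Att G y (unjoined G a S))
    {i j : Fin k} (hij : i ≠ j) :
    Att G y (EvenHoles.enlarge S (joined G a S) i).D ∨
      Att G y (EvenHoles.enlarge S (joined G a S) j).D := by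
  by_contra! hno
  obtain ⟨hyi, hyj⟩ := hno
  have hI := hS.indecomposable
  have hFr := hI.frame
  obtain ⟨T, F, m, hT, hF, hF0, hFT, hnear, l₀, c, hc, hmc⟩ := hS.exists_path_nearB K hyV hfar
  have hDsub : ∀ q, (S q).D ⊆ (EvenHoles.enlarge S (joined G a S) q).D := by
    intro q
    rw [enlarge_D]
    exact Set.subset_union_left
  have hTD : ∀ l, (S l).C ∪ joined G a S l ⊆ (EvenHoles.enlarge S (joined G a S) l).D :=
    fun l => Set.subset_union_right
  have hTa : ∀ x ∈ T, a ≠ x ∧ ¬ G.Adj a x := by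
    intro x hx
    rcases hT with hT | ⟨l, hT⟩
    · exact K.apexR a rfl x (hT hx)
    · exact K.antiC l a rfl x (hT hx)
  have hTB : ∀ x ∈ T, ∀ q, x ∉ (S q).B := by
    intro x hx q hxq
    rcases hT with hT | ⟨l, hT⟩
    · exact K.disjointR q x (hT hx) hxq
    · rcases hT hx with h | h
      · by_cases hlq : l = q
        · subst hlq
          exact (hI.proper l).disjoint_BD hxq (Or.inr h)
        · exact (hFr.antiDB l q hlq x (Or.inr h) x hxq).1 rfl
      · exact notMem_B_of_mem_outside h.1 q hxq
  have hFB : ∀ p ≤ m, ∀ q, F p ∉ (S q).B := by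
    intro p hp q hq
    rcases Nat.eq_zero_or_pos p with rfl | h0
    · exact hyV q (Or.inl (Or.inr (hF0 ▸ hq)))
    · exact hTB _ (hFT p h0 hp) q hq
  have haF : ∀ p, 0 < p → p ≤ m → a ≠ F p ∧ ¬ G.Adj a (F p) :=
    fun p h0 hp => hTa _ (hFT p h0 hp)
  have haF0 : G.Adj a (F 0) := hF0.symm ▸ hay
  have hTi : ∀ q, ¬ Att G y (EvenHoles.enlarge S (joined G a S) q).D → 0 < m →
      Anti G T (EvenHoles.enlarge S (joined G a S) q).D ∧ (T ⊆ unjoined G a S ∨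
        ∃ l, l ≠ q ∧ T ⊆ (S l).C ∪ joined G a S l) := by
    intro q hq hm
    rcases hT with hT | ⟨l, hT⟩
    · exact ⟨(K.antiR q).mono hT subset_rfl, Or.inl hT⟩
    · have hlq : l ≠ q := by
        rintro rfl
        refine hq ⟨F 1, hTD l (hT (hFT 1 one_pos hm)), ?_⟩
        have := hF.adj 0 hm
        rwa [hF0] at this
      exact ⟨(K.antiD l q hlq).mono (hT.trans (hTD l)) subset_rfl, Or.inr ⟨l, hlq, hT⟩⟩
  -- The strips touched by the path, which are to be merged.
  let J : Set (Fin k) := {q | ∃ p ≤ m, F p ∈ (S q).D ∨ Att G (F p) (S q).D}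
  have hJ : ∀ q, q ∉ J → ∀ p ≤ m, Anti G {F p} (S q).D := by
    rintro q hq p hp _ rfl z hz
    refine ⟨?_, fun h => hq ⟨p, hp, Or.inr ⟨z, hz, h⟩⟩⟩
    intro h
    exact hq ⟨p, hp, Or.inl (h ▸ hz)⟩
  have hnotJ : ∀ q, ¬ Att G y (EvenHoles.enlarge S (joined G a S) q).D → q ∉ J := by
    rintro q hq ⟨p, hp, h⟩
    rcases Nat.eq_zero_or_pos p with rfl | h0
    · rw [hF0] at h
      rcases h with h | h
      · exact hyV q ((S q).D_subset_verts h)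
      · exact hq (h.mono (hDsub q))
    · have := (hTi q hq (h0.trans_le hp)).1 _ (hFT p h0 hp)
      rcases h with h | ⟨z, hz, h⟩
      · exact (this _ (hDsub q h)).1 rfl
      · exact (this _ (hDsub q hz)).2 h
  have hiJ := hnotJ i hyi
  have hjJ := hnotJ j hyj
  have hFv : ∀ p ≤ m, ∀ q ∉ J, F p ∉ (S q).verts := by
    rintro p hp q hq ((h | h) | h)
    · exact (hJ q hq p hp _ rfl _ (Or.inl h)).1 rfl
    · exact hFB p hp q h
    · exact (hJ q hq p hp _ rfl _ (Or.inr h)).1 rfl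
  have hFx : ∀ p ≤ m, ∀ q ∉ J, ∀ x ∈ (S q).verts, G.Adj (F p) x → p = m ∧ x ∈ (S q).B := by
    rintro p hp q hq x ((h | h) | h) hpx
    · exact absurd hpx (hJ q hq p hp _ rfl _ (Or.inl h)).2
    · refine ⟨?_, h⟩
      by_contra hne
      exact hnear p (by omega) ⟨q, Or.inr ⟨x, h, hpx⟩⟩
    · exact absurd hpx (hJ q hq p hp _ rfl _ (Or.inr h)).2
  by_cases hcase : ∃ q ∉ J, ∃ b ∈ (S q).B, G.Adj (F m) b
  · obtain ⟨q, hq, b, hb, hmb⟩ := hcase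
    have key : ∀ {q q' : Fin k} {b d : V}, q ≠ q' → q ∉ J → q' ∉ J → b ∈ (S q).B → d ∈ (S q').B →
        G.Adj (F m) b → G.Adj (F m) d := fun h h1 h2 =>
      hFr.adj_of_adj_of_anti hG hF haF0 haF hnear (hFB m le_rfl) h (hJ _ h1) (hJ _ h2)
    have hall : ∀ q' ∉ J, ∀ d ∈ (S q').B, G.Adj (F m) d := by
      intro q' hq' d hd
      by_cases hqq : q = q'
      · subst hqq
        -- To reach other vertices of the same base, adjacency is transferred through one of the
        -- untouched strips `i`, `j`.
        obtain ⟨s, hsq, hs⟩ : ∃ s, s ≠ q ∧ s ∉ J := by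
          by_cases h : i = q
          · exact ⟨j, fun h' => hij (h.trans h'.symm), hjJ⟩
          · exact ⟨i, h, hiJ⟩
        obtain ⟨e, he⟩ := hFr.nonempty_B s
        exact key hsq hs hq he hd (key hsq.symm hq hs hb he hmb)
      · exact key hqq hq hq' hb hd hmb
    obtain ⟨bi, hbi⟩ := hFr.nonempty_B i
    obtain ⟨bj, hbj⟩ := hFr.nonempty_B j
    rcases Nat.eq_zero_or_pos m with rfl | hm
    · exact hFr.false_of_adj_bases hns haF0 hij (hJ i hiJ 0 le_rfl) (hJ j hjJ 0 le_rfl) hbi hbj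
        (hall i hiJ bi hbi) (hall j hjJ bj hbj)
    -- Vertices of another enlarged strip have no neighbours in `B i`, so the path lies in `R` after
    -- `y`, and `F m` is new.
    · have hTR : T ⊆ unjoined G a S := by
        rcases (hTi i hyi hm).2 with h | ⟨l, hl, h⟩
        · exact h
        · exact absurd (hall i hiJ bi hbi)
            (K.antiDB l i hl _ (hTD l (h (hFT m hm le_rfl))) bi hbi).2
      have hFo : ∀ p ≤ m, ∀ q, F p ∉ (S q).verts := by
        intro p hp q
        rcases Nat.eq_zero_or_pos p with rfl | h0
        · exact hF0 ▸ hyV q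
        · exact (hTR (hFT p h0 hp)).1.2.2 q
      refine hS.false_of_merge hij hiJ hjJ hF hm haF0 haF ?_ ?_ ?_ hFv ?_ hall ?_ ?_
        ⟨m, le_rfl, hFo m le_rfl⟩
      · rintro q - (h | h)
        · exact hFo 0 (Nat.zero_le m) q (Or.inl (Or.inr h))
        · exact hFo 0 (Nat.zero_le m) q (Or.inr h)
      · rintro q - (h | h)
        · exact hFo m le_rfl q (Or.inl (Or.inl h))
        · exact hFo m le_rfl q (Or.inr h)
      · exact fun p _ hp q _ h => hFo p hp.le q (Or.inl h)
      · intro p hp q hq x hx h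
        have := (hFx p hp.le q hq x hx h).1
        omega
      · exact fun q hq x hx => (hJ q hq m le_rfl _ rfl x hx).2
      · rintro q ⟨p, hp, h⟩
        rcases hp.lt_or_eq with hp | rfl
        · exact ⟨p, hp, h⟩
        · have := K.antiR q _ (hTR (hFT p hm le_rfl))
          rcases h with h | ⟨z, hz, h⟩
          · exact absurd rfl (this _ (hDsub q h)).1
          · exact absurd h (this _ (hDsub q hz)).2
  · push Not at hcase
    have hlJ : l₀ ∈ J := by
      by_contra h
      exact hcase l₀ h c hc hmc
    have hcv : ∀ q, q ≠ l₀ → c ∉ (S q).verts := fun q hq h =>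
      Set.disjoint_left.1 (hI.disjoint q l₀ hq) h (Or.inl (Or.inr hc))
    have hcD : ∀ q, c ∉ (S q).D := by
      intro q h
      by_cases hq : q = l₀
      · subst hq
        exact (hI.proper q).disjoint_BD hc h
      · exact hcv q hq ((S q).D_subset_verts h)
    have hneJ : ∀ q, q ∉ J → q ≠ l₀ := by
      rintro q hq rfl
      exact hq hlJ
    have hsnoc := hF.snoc hmc fun p hp =>
      ⟨fun h => hFB p hp.le l₀ (h ▸ hc), fun h => hnear p hp ⟨l₀, Or.inr ⟨c, hc, h⟩⟩⟩
    -- The path now ends at `c` in a merged base, which is complete to every untouched base; the new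
    -- vertex is `y`, since the rest of the path may lie in the system.
    refine hS.false_of_merge hij hiJ hjJ hsnoc (Nat.succ_pos m) ?_ ?_ ?_ ?_ ?_ ?_ ?_ ?_ ?_ ?_ ?_
    · simpa using haF0
    · intro p h0 hp
      split_ifs with h
      · exact haF p h0 h
      · exact hFr.antiB l₀ a rfl c hc
    · rintro q -
      rw [if_pos (Nat.zero_le m), hF0]
      rintro (h | h)
      · exact hyV q (Or.inl (Or.inr h))
      · exact hyV q (Or.inr h)
    · rintro q -
      rw [if_neg (by omega)]
      exact hcD q
    · rintro p h0 hp q -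
      rw [if_pos (by omega)]
      rintro (h | h)
      · exact (haF p h0 (by omega)).2 (hFr.adjA q _ h)
      · exact hFB p (by omega) q h
    · intro p hp q hq
      split_ifs with h
      · exact hFv p h q hq
      · exact hcv q (hneJ q hq)
    · intro p hp q hq x hx h
      rw [if_pos (by omega)] at h
      obtain ⟨rfl, hxB⟩ := hFx p (by omega) q hq x hx h
      exact hcase q hq x hxB h
    · intro q hq x hx
      rw [if_neg (by omega)]
      exact hFr.adjB l₀ q (hneJ q hq).symm c hc x hx
    · intro q hq x hx h
      rw [if_neg (by omega)] at h
      exact (hFr.antiDB q l₀ (hneJ q hq) x hx c hc).2 h.symm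
    · rintro q ⟨p, hp, h⟩
      refine ⟨p, by omega, ?_⟩
      rwa [if_pos hp]
    · refine ⟨0, by omega, ?_⟩
      rw [if_pos (Nat.zero_le m), hF0]
      exact hyV

theorem IsMaximalSystem.outer (hG : EvenHoleFree G) (hS : IsMaximalSystem G a S)
    (ha : Splendid G a) {r : ℕ}
    (K : Core G a (EvenHoles.enlarge S (joined G a S)) (unjoined G a S) r) {y : V}
    (hay : G.Adj a y) (hyV : ∀ j, y ∉ (S j).verts) :
    Outer G a (EvenHoles.enlarge S (joined G a S)) (unjoined G a S) y := by
  have hfar : (∃ i, Att G y ((S i).B ∪ ((S i).C ∪ joined G a S i))) ∨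
      Att G y (unjoined G a S) := by
    obtain ⟨w, hw, hyw⟩ := ha.nbr_has_far_nbr y hay
    rcases hS.indecomposable.mem_BC_or_outside (mem_closedNbhd_compl.1 hw) with
      ⟨i, h | h⟩ | h
    · exact Or.inl ⟨i, w, Or.inl h, hyw⟩
    · exact Or.inl ⟨i, w, Or.inr (Or.inl h), hyw⟩
    · by_cases hj : ∃ i, w ∈ joined G a S i
      · obtain ⟨i, hi⟩ := hj
        exact Or.inl ⟨i, w, Or.inr (Or.inr hi), hyw⟩
      · exact Or.inr ⟨w, ⟨h, not_exists.1 hj⟩, hyw⟩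
  exact ⟨hay, fun i h => hyV i (Or.inl (Or.inl h)),
    fun i j hij => hS.att_or_att hG ha.no_short_pyramid K hay hyV hfar hij, hfar⟩

end

end EvenHoles

theorem mainTheorem6 {V : Type*} [Finite V] (G : SimpleGraph V)
    (hG : EvenHoles.EvenHoleFree G) (a : V) (ha : EvenHoles.Splendid G a)
    (hprism : ¬ EvenHoles.HasExtendedNearPrismAt G a)
    {k : ℕ} (S : Fin k → EvenHoles.Triple V) (hS : EvenHoles.IsMaximalSystem G a S) :
    G.IsClique (EvenHoles.closedNbhd G a \ EvenHoles.systemVerts a S) := by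
  obtain ⟨r, K⟩ := hS.core hG hprism ha.connected
  have houter : ∀ y ∈ EvenHoles.closedNbhd G a \ EvenHoles.systemVerts a S,
      EvenHoles.Outer G a (EvenHoles.enlarge S (EvenHoles.joined G a S))
        (EvenHoles.unjoined G a S) y := by
    rintro y ⟨hy, hyS⟩
    refine hS.outer hG ha K (hy.resolve_left fun h => hyS (Or.inr h)) fun j h => ?_
    exact hyS (Or.inl (Set.mem_iUnion.2 ⟨j, h⟩))
  intro y hy z hz hyz
  exact K.adj_of_outer hG ha.no_short_pyramid (houter y hy) (houter z hz) hyz
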